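/- Let $K$ be a field of characteristic zero; chain complexes are $\mathbb Z$-graded, possibly unbounded, with differential of degree $-1$, and dg algebras and dg coalgebras need not be (co)unital. Write $\hom_K(V,W)$ for the internal hom of chain complexes over $K$, whose degree $n$ part consists of the linear maps raising degrees by $n$. For a dg coalgebra or dg Lie coalgebra $C$ with coproduct (or cobracket) $\Delta$, its coradical filtration is $F_0C=0\subseteq F_1C\subseteq F_2C\subseteq\cdots$, where $F_kC$ consists of the elements annihilated by all iterated coproducts (cobrackets) with more than $k$ outputs; $C$ is conilpotent if this filtration is exhaustive. Let $L$ be a conilpotent dg Lie coalgebra over $K$, let $U^cL$ be its universal enveloping conilpotent coalgebra (the value at $L$ of the right adjoint of the functor which sends a conilpotent dg coalgebra to the same complex with the cobracket $\Delta-\tau\Delta$, $\tau$ being the Koszul-signed symmetry; concretely, the largest dg subcoalgebra of the cofree conilpotent dg coalgebra $\bigoplus_{n\ge1}L^{\otimes n}$ on $L$ for which the projection to $L$ is a morphism of Lie coalgebras), with its projection $p\colon U^cL\to L$, and let $A$ be a commutative dg algebra over $K$. Then $\hom_K(L,A)$ is a dg Lie algebra with the bracket $[f,g](x)=\sum\pm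 f(x_{(1)})g(x_{(2)})$ given by the cobracket of $L$ and the product of $A$, with Koszul signs, and $\hom_K(U^cL,A)$ is a dg Lie algebra with the graded commutator of the convolution product. For $C=L$ or $C=U^cL$, filter $\hom_K(C,A)$ by the subspaces of those maps which vanish on $F_kC$, $k\ge0$. Consider the map of complete filtered dg Lie algebras $$p^*\colon\hom_K(L,A)\longrightarrow\hom_K(U^cL,A),\qquad f\mapsto f\circ p.$$ There is a chain map (linear of degree $0$) $r\colon\hom_K(U^cL,A)\to\hom_K(L,A)$ with $r\circ p^*=\mathrm{id}$ which preserves the filtrations and is a morphism of $\hom_K(L,A)$-modules, i.e. $r([p^*f,g])=[f,r(g)]$ for all $f\in\hom_K(L,A)$ and $g\in\hom_K(U^cL,A)$. -/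

import Mathlib

noncomputable section

open scoped TensorProduct DirectSum

namespace DGPBW

universe u v w

/-- A chain complex over `K`: a `ℤ`-graded vector space `V = ⨁ i, gr i` with a differential `d` of
degree `-1` satisfying `d² = 0`. -/
structure DGModule (K : Type u) (V : Type v) [Field K] [AddCommGroup V] [Module K V] where
  gr : ℤ → Submodule K V
  isInternal : DirectSum.IsInternal gr
  d : V →ₗ[K] V
  d_mem : ∀ (i : ℤ) (x : V), x ∈ gr i → d x ∈ gr (i - 1)
  d_d : ∀ x : V, d (d x) = 0

namespace DGModule

section

variable {K : Type u} [Field K]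
variable {V : Type v} [AddCommGroup V] [Module K V]
variable {W : Type w} [AddCommGroup W] [Module K W]

/-- The decomposition of a graded vector space into its homogeneous components. -/
def dec (M : DGModule K V) : V ≃ₗ[K] ⨁ i, M.gr i :=
  (LinearEquiv.ofBijective (DirectSum.coeLinearMap M.gr) M.isInternal).symm

theorem dec_of_mem (M : DGModule K V) {i : ℤ} {x : V} (hx : x ∈ M.gr i) :
    M.dec x = DirectSum.lof K ℤ (fun i => M.gr i) i ⟨x, hx⟩ := by
  rw [dec, LinearEquiv.symm_apply_eq]
  exact (DirectSum.coeLinearMap_lof (fun i => M.gr i) i ⟨x, hx⟩).symm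

/-- A linear map out of a graded vector space, given by a family of linear maps on its homogeneous
components. -/
def ofHomogeneous (M : DGModule K V) (φ : (i : ℤ) → V →ₗ[K] W) : V →ₗ[K] W :=
  DirectSum.toModule K ℤ W (fun i => φ i ∘ₗ (M.gr i).subtype) ∘ₗ M.dec.toLinearMap

theorem ofHomogeneous_of_mem (M : DGModule K V) (φ : (i : ℤ) → V →ₗ[K] W) {i : ℤ} {x : V}
    (hx : x ∈ M.gr i) : M.ofHomogeneous φ x = φ i x := by
  simp [ofHomogeneous, M.dec_of_mem hx, DirectSum.toModule_lof]

theorem hom_induction (M : DGModule K V) {P : V → Prop} (zero : P 0)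
    (add : ∀ x y, P x → P y → P (x + y)) (mem : ∀ i, ∀ x ∈ M.gr i, P x) (x : V) : P x := by
  have hx : x ∈ ⨆ i, M.gr i := by rw [M.isInternal.submodule_iSup_eq_top]; trivial
  exact Submodule.iSup_induction M.gr (motive := P) hx mem zero add

theorem hom_ext (M : DGModule K V) {f g : V →ₗ[K] W} (h : ∀ i, ∀ x ∈ M.gr i, f x = g x) :
    f = g := by
  ext x
  induction x using M.hom_induction with
  | zero => simp
  | add x y hx hy => simp [hx, hy]
  | mem i x hx => exact h i x hx

/-- The projection onto the homogeneous component of degree `n`. -/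
def comp (M : DGModule K V) (n : ℤ) : V →ₗ[K] V :=
  M.ofHomogeneous fun i => if i = n then LinearMap.id else 0

theorem comp_of_mem (M : DGModule K V) {n i : ℤ} {x : V} (hx : x ∈ M.gr i) :
    M.comp n x = if i = n then x else 0 := by
  rw [comp, ofHomogeneous_of_mem M _ hx]; split_ifs <;> rfl

theorem comp_mem (M : DGModule K V) (n : ℤ) (x : V) : M.comp n x ∈ M.gr n := by
  induction x using M.hom_induction with
  | zero => simp
  | add x y hx hy => rw [map_add]; exact add_mem hx hy
  | mem i x hx =>
    rw [M.comp_of_mem hx]; split_ifs with h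
    · exact h ▸ hx
    · exact zero_mem _

/-- The operator `x ↦ (-1) ^ (n * i) • x` for `x` of degree `i`: the Koszul sign that arises when
an operation of degree `n` moves past `x`. -/
def sgn (M : DGModule K V) (n : ℤ) : V →ₗ[K] V :=
  M.ofHomogeneous fun i => ((-1 : K) ^ (n * i)) • LinearMap.id

theorem sgn_of_mem (M : DGModule K V) (n : ℤ) {i : ℤ} {x : V} (hx : x ∈ M.gr i) :
    M.sgn n x = ((-1 : K) ^ (n * i)) • x := by
  rw [sgn, ofHomogeneous_of_mem M _ hx]; rfl

theorem sgn_mem (M : DGModule K V) (n : ℤ) {i : ℤ} {x : V} (hx : x ∈ M.gr i) :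
    M.sgn n x ∈ M.gr i := by
  rw [M.sgn_of_mem n hx]; exact Submodule.smul_mem _ _ hx

theorem sgn_d (M : DGModule K V) (x : V) : M.sgn (-1) (M.d x) = - M.d (M.sgn (-1) x) := by
  induction x using M.hom_induction with
  | zero => simp
  | add x y hx hy => simp only [map_add, hx, hy, neg_add]
  | mem i x hx =>
    rw [M.sgn_of_mem _ hx, M.sgn_of_mem _ (M.d_mem i x hx), map_smul, ← neg_smul]
    congr 1
    rw [show (-1 : ℤ) * (i - 1) = -1 * i + 1 by ring, zpow_add₀ (by simp)]
    simp

theorem sgn_sgn (M : DGModule K V) (x : V) : M.sgn (-1) (M.sgn (-1) x) = x := by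
  induction x using M.hom_induction with
  | zero => simp
  | add x y hx hy => simp only [map_add, hx, hy]
  | mem i x hx =>
    rw [M.sgn_of_mem _ hx, map_smul, M.sgn_of_mem _ hx, smul_smul, ← zpow_add₀ (by simp),
      Even.neg_one_zpow ⟨_, rfl⟩, one_smul]

/-- The part of total degree `n` of the tensor product of two graded vector spaces. -/
def tensorGr (M : DGModule K V) (N : DGModule K W) (n : ℤ) : Submodule K (V ⊗[K] W) :=
  Submodule.span K {t | ∃ i j : ℤ, i + j = n ∧ ∃ x ∈ M.gr i, ∃ y ∈ N.gr j, x ⊗ₜ[K] y = t}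

/-- The symmetry `x ⊗ y ↦ (-1) ^ (|x| * |y|) • y ⊗ x` of the tensor product. -/
def swap (M : DGModule K V) (N : DGModule K W) : V ⊗[K] W →ₗ[K] W ⊗[K] V :=
  TensorProduct.lift
    (M.ofHomogeneous fun i => (TensorProduct.mk K W V).flip.compl₂ (N.sgn i))

theorem swap_tmul (M : DGModule K V) (N : DGModule K W) {i j : ℤ} {x : V} {y : W}
    (hx : x ∈ M.gr i) (hy : y ∈ N.gr j) :
    M.swap N (x ⊗ₜ[K] y) = ((-1 : K) ^ (i * j)) • (y ⊗ₜ[K] x) := by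
  simp [swap, ofHomogeneous_of_mem M _ hx, N.sgn_of_mem i hy, TensorProduct.smul_tmul']

/-- The differential `d ⊗ 1 + 1 ⊗ d` of the tensor product, with the Koszul sign
`x ⊗ y ↦ d x ⊗ y + (-1) ^ |x| • x ⊗ d y`. -/
def tensorD (M : DGModule K V) (N : DGModule K W) : V ⊗[K] W →ₗ[K] V ⊗[K] W :=
  TensorProduct.map M.d LinearMap.id + TensorProduct.map (M.sgn (-1)) N.d

/-- The cyclic permutation `x ⊗ y ⊗ z ↦ ± z ⊗ x ⊗ y` of `V ⊗ V ⊗ V`, with its Koszul sign. -/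
def cyc (M : DGModule K V) : (V ⊗[K] V) ⊗[K] V →ₗ[K] (V ⊗[K] V) ⊗[K] V :=
  (M.swap M).rTensor V ∘ₗ (TensorProduct.assoc K V V V).symm.toLinearMap ∘ₗ
    (M.swap M).lTensor V ∘ₗ (TensorProduct.assoc K V V V).toLinearMap

/-- Projection of a tensor product of graded vector spaces onto total degree `n`. -/
def tensorComp (M : DGModule K V) (N : DGModule K W) (n : ℤ) : V ⊗[K] W →ₗ[K] V ⊗[K] W :=
  TensorProduct.lift (M.ofHomogeneous fun i => (TensorProduct.mk K V W).compl₂ (N.comp (n - i)))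

theorem tensorComp_tmul (M : DGModule K V) (N : DGModule K W) (n : ℤ) {i : ℤ} {x : V} (y : W)
    (hx : x ∈ M.gr i) : M.tensorComp N n (x ⊗ₜ[K] y) = x ⊗ₜ[K] N.comp (n - i) y := by
  simp [tensorComp, ofHomogeneous_of_mem M _ hx]

theorem tmul_mem_tensorGr (M : DGModule K V) (N : DGModule K W) {n i j : ℤ} {x : V} {y : W}
    (h : i + j = n) (hx : x ∈ M.gr i) (hy : y ∈ N.gr j) : x ⊗ₜ[K] y ∈ M.tensorGr N n :=
  Submodule.subset_span ⟨i, j, h, x, hx, y, hy, rfl⟩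

theorem mem_tensorGr_iff (M : DGModule K V) (N : DGModule K W) {n : ℤ} {t : V ⊗[K] W} :
    t ∈ M.tensorGr N n ↔ M.tensorComp N n t = t := by
  constructor
  · intro ht
    induction ht using Submodule.span_induction with
    | mem t ht =>
      obtain ⟨i, j, h, x, hx, y, hy, rfl⟩ := ht
      rw [tensorComp_tmul M N n y hx, N.comp_of_mem hy, if_pos (by omega)]
    | zero => simp
    | add a b _ _ ha hb => rw [map_add, ha, hb]
    | smul c a _ ha => rw [map_smul, ha]
  · intro ht
    rw [← ht]
    clear ht
    induction t using TensorProduct.induction_on with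
    | zero => simp
    | add a b ha hb => rw [map_add]; exact add_mem ha hb
    | tmul x y =>
      induction x using M.hom_induction with
      | zero => simp
      | add a b ha hb => rw [TensorProduct.add_tmul, map_add]; exact add_mem ha hb
      | mem i x hx =>
        rw [tensorComp_tmul M N n y hx]
        exact M.tmul_mem_tensorGr N (by omega) hx (N.comp_mem _ _)

theorem exists_sum_comp (M : DGModule K V) (x : V) :
    ∃ s : Finset ℤ, ∀ s' : Finset ℤ, s ⊆ s' → ∑ i ∈ s', M.comp i x = x := by
  induction x using M.hom_induction with
  | zero => exact ⟨∅, by simp⟩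
  | add x y hx hy =>
    obtain ⟨s, hs⟩ := hx
    obtain ⟨t, ht⟩ := hy
    refine ⟨s ∪ t, fun s' h => ?_⟩
    simp only [map_add, Finset.sum_add_distrib]
    rw [hs s' (Finset.union_subset_left h), ht s' (Finset.union_subset_right h)]
  | mem i x hx =>
    refine ⟨{i}, fun s' h => ?_⟩
    simp only [M.comp_of_mem hx]
    rw [Finset.sum_ite_eq, if_pos (h (Finset.mem_singleton_self i))]

theorem sgn_mem_of_homogeneous (M : DGModule K V) {U : Submodule K V}
    (hom : ∀ n, ∀ x ∈ U, M.comp n x ∈ U) (m : ℤ) (x : V) (hx : x ∈ U) : M.sgn m x ∈ U := by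
  obtain ⟨s, hs⟩ := M.exists_sum_comp x
  rw [← hs s subset_rfl, map_sum]
  refine sum_mem fun i _ => ?_
  rw [M.sgn_of_mem m (M.comp_mem i x)]
  exact Submodule.smul_mem _ _ (hom i x hx)

theorem swap_mem_of_homogeneous (M : DGModule K V) {U : Submodule K V}
    (hom : ∀ n, ∀ x ∈ U, M.comp n x ∈ U) (w : V ⊗[K] V)
    (hw : w ∈ LinearMap.range (TensorProduct.mapIncl U U)) :
    M.swap M w ∈ LinearMap.range (TensorProduct.mapIncl U U) := by
  obtain ⟨w, rfl⟩ := hw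
  induction w using TensorProduct.induction_on with
  | zero => simp
  | add a b ha hb => rw [map_add, map_add]; exact add_mem ha hb
  | tmul x y =>
    obtain ⟨s, hs⟩ := M.exists_sum_comp (x : V)
    rw [TensorProduct.mapIncl, TensorProduct.map_tmul, Submodule.subtype_apply,
      Submodule.subtype_apply, ← hs s subset_rfl, TensorProduct.sum_tmul, map_sum]
    refine sum_mem fun i _ => ?_
    have h : M.swap M (M.comp i (x : V) ⊗ₜ[K] (y : V)) = M.sgn i (y : V) ⊗ₜ M.comp i (x : V) := by
      simp [swap, ofHomogeneous_of_mem M _ (M.comp_mem i (x : V))]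
    rw [h]
    exact ⟨⟨_, M.sgn_mem_of_homogeneous hom i y y.2⟩ ⊗ₜ ⟨_, hom i x x.2⟩, rfl⟩

theorem tensorComp_mem_of_homogeneous (M : DGModule K V) {U : Submodule K V}
    (hom : ∀ n, ∀ x ∈ U, M.comp n x ∈ U) (n : ℤ) (w : V ⊗[K] V)
    (hw : w ∈ LinearMap.range (TensorProduct.mapIncl U U)) :
    M.tensorComp M n w ∈ LinearMap.range (TensorProduct.mapIncl U U) := by
  obtain ⟨w, rfl⟩ := hw
  induction w using TensorProduct.induction_on with
  | zero => simp
  | add a b ha hb => rw [map_add, map_add]; exact add_mem ha hb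
  | tmul x y =>
    obtain ⟨s, hs⟩ := M.exists_sum_comp (x : V)
    rw [TensorProduct.mapIncl, TensorProduct.map_tmul, Submodule.subtype_apply,
      Submodule.subtype_apply, ← hs s subset_rfl, TensorProduct.sum_tmul, map_sum]
    refine sum_mem fun i _ => ?_
    rw [M.tensorComp_tmul M n _ (M.comp_mem i (x : V))]
    exact ⟨⟨_, hom i x x.2⟩ ⊗ₜ ⟨_, hom (n - i) y y.2⟩, rfl⟩

theorem tensorComp_of_mem (M : DGModule K V) (N : DGModule K W) {n i : ℤ} {t : V ⊗[K] W}
    (ht : t ∈ M.tensorGr N i) : M.tensorComp N n t = if i = n then t else 0 := by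
  induction ht using Submodule.span_induction with
  | mem t ht =>
    obtain ⟨j, k, h, x, hx, y, hy, rfl⟩ := ht
    rw [tensorComp_tmul M N n y hx, N.comp_of_mem hy]
    by_cases hn : i = n
    · rw [if_pos hn, if_pos (by omega)]
    · rw [if_neg hn, if_neg (by omega), TensorProduct.tmul_zero]
  | zero => simp
  | add a b _ _ ha hb => rw [map_add, ha, hb]; split_ifs <;> simp
  | smul c a _ ha => rw [map_smul, ha]; split_ifs <;> simp

/-- A homogeneous subspace stable under the differential, as a chain complex. -/
def restrict (M : DGModule K V) (U : Submodule K V) (hom : ∀ n, ∀ x ∈ U, M.comp n x ∈ U)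
    (hd : ∀ x ∈ U, M.d x ∈ U) : DGModule K U where
  gr n := (M.gr n).comap U.subtype
  isInternal := by
    have key : ∀ (n : ℤ) (f : ⨁ i, (M.gr i).comap U.subtype),
        M.comp n ((DirectSum.coeLinearMap (fun i => (M.gr i).comap U.subtype) f : U) : V) =
          ((f n : U) : V) := by
      intro n f
      induction f using DirectSum.induction_on with
      | zero => simp
      | of i x =>
        have hx : ((x : U) : V) ∈ M.gr i := x.2
        rw [DirectSum.coeLinearMap_of, M.comp_of_mem hx]
        split_ifs with h
        · subst h; rw [DirectSum.of_eq_same]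
        · rw [DirectSum.of_eq_of_ne _ _ _ (Ne.symm h)]; rfl
      | add f g hf hg => simp [hf, hg]
    constructor
    · intro f g hfg
      apply DFinsupp.ext
      intro n
      apply Subtype.ext
      apply Subtype.ext
      have h : DirectSum.coeLinearMap (fun i => (M.gr i).comap U.subtype) f =
        DirectSum.coeLinearMap (fun i => (M.gr i).comap U.subtype) g := hfg
      have h1 := key n f
      rw [h, key n g] at h1
      exact h1.symm
    · intro x
      obtain ⟨s, hs⟩ := M.exists_sum_comp (x : V)
      refine ⟨∑ i ∈ s, DirectSum.of (fun i => (M.gr i).comap U.subtype) i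
        ⟨⟨M.comp i x, hom i x x.2⟩, M.comp_mem i x⟩, ?_⟩
      change DirectSum.coeLinearMap (fun i => (M.gr i).comap U.subtype) _ = x
      apply Subtype.ext
      rw [map_sum]
      simp only [DirectSum.coeLinearMap_of]
      rw [AddSubmonoidClass.coe_finsetSum]
      exact hs s subset_rfl
  d := M.d.restrict hd
  d_mem i x hx := M.d_mem i x hx
  d_d x := Subtype.ext (M.d_d x)

theorem mapIncl_swap (M : DGModule K V) (U : Submodule K V) (hom : ∀ n, ∀ x ∈ U, M.comp n x ∈ U)
    (hd : ∀ x ∈ U, M.d x ∈ U) (w : U ⊗[K] U) :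
    TensorProduct.mapIncl U U ((M.restrict U hom hd).swap (M.restrict U hom hd) w) =
      M.swap M (TensorProduct.mapIncl U U w) := by
  induction w using TensorProduct.induction_on with
  | zero => simp
  | add a b ha hb => simp only [map_add, ha, hb]
  | tmul x y =>
    induction x using (M.restrict U hom hd).hom_induction with
    | zero => simp
    | add a b ha hb => simp only [TensorProduct.add_tmul, map_add, ha, hb]
    | mem i x hx =>
      induction y using (M.restrict U hom hd).hom_induction with
      | zero => simp
      | add a b ha hb => simp only [TensorProduct.tmul_add, map_add, ha, hb]
      | mem j y hy =>
        have hx' : (x : V) ∈ M.gr i := hx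
        have hy' : (y : V) ∈ M.gr j := hy
        rw [swap_tmul _ _ hx hy, map_smul]
        simp only [TensorProduct.mapIncl, TensorProduct.map_tmul, Submodule.subtype_apply]
        rw [swap_tmul _ _ hx' hy']

theorem mapIncl_tensorD (M : DGModule K V) (U : Submodule K V)
    (hom : ∀ n, ∀ x ∈ U, M.comp n x ∈ U) (hd : ∀ x ∈ U, M.d x ∈ U) (w : U ⊗[K] U) :
    TensorProduct.mapIncl U U ((M.restrict U hom hd).tensorD (M.restrict U hom hd) w) =
      M.tensorD M (TensorProduct.mapIncl U U w) := by
  induction w using TensorProduct.induction_on with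
  | zero => simp
  | add a b ha hb => simp only [map_add, ha, hb]
  | tmul x y =>
    induction x using (M.restrict U hom hd).hom_induction with
    | zero => simp
    | add a b ha hb => simp only [TensorProduct.add_tmul, map_add, ha, hb]
    | mem i x hx =>
      have hx' : (x : V) ∈ M.gr i := hx
      simp only [tensorD, LinearMap.add_apply, TensorProduct.map_tmul, map_add,
        TensorProduct.mapIncl, sgn_of_mem _ _ hx, Submodule.subtype_apply]
      rw [M.sgn_of_mem _ hx']
      rfl

theorem mapIncl_tensorComp (M : DGModule K V) (U : Submodule K V)
    (hom : ∀ n, ∀ x ∈ U, M.comp n x ∈ U) (hd : ∀ x ∈ U, M.d x ∈ U) (n : ℤ) (w : U ⊗[K] U) :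
    TensorProduct.mapIncl U U ((M.restrict U hom hd).tensorComp (M.restrict U hom hd) n w) =
      M.tensorComp M n (TensorProduct.mapIncl U U w) := by
  induction w using TensorProduct.induction_on with
  | zero => simp
  | add a b ha hb => simp only [map_add, ha, hb]
  | tmul x y =>
    induction x using (M.restrict U hom hd).hom_induction with
    | zero => simp
    | add a b ha hb => simp only [TensorProduct.add_tmul, map_add, ha, hb]
    | mem i x hx =>
      induction y using (M.restrict U hom hd).hom_induction with
      | zero => simp
      | add a b ha hb => simp only [TensorProduct.tmul_add, map_add, ha, hb]
      | mem j y hy =>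
        have hx' : (x : V) ∈ M.gr i := hx
        have hy' : (y : V) ∈ M.gr j := hy
        rw [tensorComp_tmul _ _ _ _ hx, comp_of_mem _ hy]
        simp only [TensorProduct.mapIncl, TensorProduct.map_tmul, Submodule.subtype_apply]
        rw [tensorComp_tmul _ _ _ _ hx', comp_of_mem _ hy']
        split_ifs <;> rfl

end

end DGModule

/-- A (not necessarily counital) coassociative dg coalgebra. -/
structure DGCoalgebra (K : Type u) (C : Type v) [Field K] [AddCommGroup C] [Module K C] extends
    DGModule K C where
  comul : C →ₗ[K] C ⊗[K] C
  comul_mem : ∀ (n : ℤ) (x : C), x ∈ gr n → comul x ∈ toDGModule.tensorGr toDGModule n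
  comul_d : ∀ x : C, comul (d x) = toDGModule.tensorD toDGModule (comul x)
  coassoc : ∀ x : C,
    TensorProduct.assoc K C C C (comul.rTensor C (comul x)) = comul.lTensor C (comul x)

/-- A dg Lie coalgebra over a field of characteristic zero: the cobracket is antisymmetric,
satisfies the co-Jacobi identity and is compatible with the grading and the differential. -/
structure DGLieCoalgebra (K : Type u) (L : Type v) [Field K] [AddCommGroup L] [Module K L] extends
    DGModule K L where
  cobracket : L →ₗ[K] L ⊗[K] L
  cobracket_mem : ∀ (n : ℤ) (x : L), x ∈ gr n → cobracket x ∈ toDGModule.tensorGr toDGModule n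
  cobracket_d : ∀ x : L, cobracket (d x) = toDGModule.tensorD toDGModule (cobracket x)
  antisymm : ∀ x : L, toDGModule.swap toDGModule (cobracket x) = - cobracket x
  cojacobi : ∀ x : L,
    cobracket.rTensor L (cobracket x) + toDGModule.cyc (cobracket.rTensor L (cobracket x)) +
      toDGModule.cyc (toDGModule.cyc (cobracket.rTensor L (cobracket x))) = 0

/-- A commutative dg algebra, not necessarily unital; the underlying associative `K`-algebra is
given by the type class arguments. -/
structure CommDGAlgebra (K : Type u) (A : Type v) [Field K] [NonUnitalRing A] [Module K A]
    [IsScalarTower K A A] [SMulCommClass K A A] extends DGModule K A where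
  mul_mem : ∀ (i j : ℤ) (a b : A), a ∈ gr i → b ∈ gr j → a * b ∈ gr (i + j)
  leibniz : ∀ (i : ℤ) (a b : A), a ∈ gr i → d (a * b) = d a * b + ((-1 : K) ^ i) • (a * d b)
  comm : ∀ (i j : ℤ) (a b : A), a ∈ gr i → b ∈ gr j → a * b = ((-1 : K) ^ (i * j)) • (b * a)

namespace TensorCoalgebra

open TensorAlgebra (ι)

section Recursion

variable {K : Type u} [Field K] {L : Type v} [AddCommGroup L] [Module K L]
variable {N : Type w} [AddCommGroup N] [Module K N]

theorem induction_left {P : TensorAlgebra K L → Prop} (one : P 1)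
    (add : ∀ s t, P s → P t → P (s + t)) (smul : ∀ (c : K) t, P t → P (c • t))
    (ι_mul : ∀ x t, P t → P (ι K x * t)) (t : TensorAlgebra K L) : P t := by
  suffices h : ∀ s, P s → P (t * s) by simpa using h 1 one
  induction t using TensorAlgebra.induction with
  | algebraMap r => intro s hs; rw [← Algebra.smul_def]; exact smul r s hs
  | ι x => exact fun s hs => ι_mul x s hs
  | mul a b ha hb => intro s hs; rw [mul_assoc]; exact ha _ (hb _ hs)
  | add a b ha hb => intro s hs; rw [add_mul]; exact add _ _ (ha _ hs) (hb _ hs)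

/-- Two linear maps out of the tensor space agree when they satisfy the same recursion. -/
theorem linear_ext {f g : TensorAlgebra K L →ₗ[K] N} (one : f 1 = g 1)
    (step : ∀ x t, f t = g t → f (ι K x * t) = g (ι K x * t)) : f = g := by
  ext t
  induction t using induction_left with
  | one => exact one
  | add s t hs ht => rw [map_add, map_add, hs, ht]
  | smul c t ht => rw [map_smul, map_smul, ht]
  | ι_mul x t ht => exact step x t ht

/-- One step of the recursion in `leftRec`: `(t, n) ↦ (x ⊗ t, φ x (t, n))`. -/
def leftStep (φ : L →ₗ[K] (TensorAlgebra K L × N) →ₗ[K] N) :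
    L →ₗ[K] Module.End K (TensorAlgebra K L × N) where
  toFun x := ((LinearMap.mulLeft K (ι K x)) ∘ₗ LinearMap.fst K _ _).prod (φ x)
  map_add' x y := by ext <;> simp [add_mul]
  map_smul' c x := by ext <;> simp

/-- The linear map `f` on the tensor space `⨁ n, L^{⊗ n}` with `f 1 = 0` and
`f (x ⊗ t) = φ x (t, f t)` for `x : L`. -/
def leftRec (φ : L →ₗ[K] (TensorAlgebra K L × N) →ₗ[K] N) : TensorAlgebra K L →ₗ[K] N :=
  LinearMap.snd K (TensorAlgebra K L) N ∘ₗ LinearMap.applyₗ (1, 0) ∘ₗ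
    (TensorAlgebra.lift K (leftStep φ)).toLinearMap

theorem lift_leftStep_fst (φ : L →ₗ[K] (TensorAlgebra K L × N) →ₗ[K] N) (t : TensorAlgebra K L)
    (p : TensorAlgebra K L × N) : (TensorAlgebra.lift K (leftStep φ) t p).1 = t * p.1 := by
  induction t using induction_left with
  | one => simp
  | add s t hs ht => simp [hs, ht, add_mul]
  | smul c t ht => simp [ht]
  | ι_mul x t ht =>
    rw [map_mul, Module.End.mul_apply, TensorAlgebra.lift_ι_apply, mul_assoc, ← ht]; rfl

theorem leftRec_one (φ : L →ₗ[K] (TensorAlgebra K L × N) →ₗ[K] N) : leftRec φ 1 = 0 := by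
  simp [leftRec]

theorem leftRec_ι_mul (φ : L →ₗ[K] (TensorAlgebra K L × N) →ₗ[K] N) (x : L)
    (t : TensorAlgebra K L) : leftRec φ (ι K x * t) = φ x (t, leftRec φ t) := by
  have h : TensorAlgebra.lift K (leftStep φ) t (1, 0) = (t, leftRec φ t) := by
    ext
    · simp [lift_leftStep_fst]
    · rfl
  rw [← h]
  simp [leftRec, leftStep]

end Recursion

section Structure

variable {K : Type u} [Field K] {L : Type v} [AddCommGroup L] [Module K L]

/-- The part of degree `n` of the tensor space of a graded vector space: it is spanned by the
tensors `x₁ ⊗ ⋯ ⊗ xₖ` of homogeneous elements with `|x₁| + ⋯ + |xₖ| = n`. -/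
def wordGr (M : DGModule K L) (n : ℤ) : Submodule K (TensorAlgebra K L) :=
  Submodule.span K {t | ∃ l : List ((i : ℤ) × M.gr i),
    (l.map Sigma.fst).sum = n ∧ (l.map fun x => ι K (x.2 : L)).prod = t}

theorem wordGr_induction (M : DGModule K L)
    {P : (n : ℤ) → TensorAlgebra K L → Prop} (zero : ∀ n, P n 0) (one : P 0 1)
    (add : ∀ n s t, P n s → P n t → P n (s + t)) (smul : ∀ n (c : K) t, P n t → P n (c • t))
    (ι_mul : ∀ i x n t, x ∈ M.gr i → t ∈ wordGr M n → P n t → P (i + n) (ι K x * t))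
    {n : ℤ} {t : TensorAlgebra K L} (ht : t ∈ wordGr M n) : P n t := by
  induction ht using Submodule.span_induction with
  | zero => exact zero n
  | add s t _ _ hs ht => exact add n s t hs ht
  | smul c t _ ht => exact smul n c t ht
  | mem t ht =>
    obtain ⟨l, rfl, rfl⟩ := ht
    induction l with
    | nil => simpa using one
    | cons x l ih =>
      simp only [List.map_cons, List.sum_cons, List.prod_cons]
      exact ι_mul _ _ _ _ x.2.2 (Submodule.subset_span ⟨l, rfl, rfl⟩) ih

instance gradedMonoid (M : DGModule K L) : SetLike.GradedMonoid (wordGr M) where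
  one_mem := Submodule.subset_span ⟨[], by simp, by simp⟩
  mul_mem := by
    intro i j s t hs ht
    have h : s * t ∈ wordGr M i * wordGr M j := Submodule.mul_mem_mul hs ht
    rw [wordGr, wordGr, Submodule.span_mul_span] at h
    refine Submodule.span_mono ?_ h
    rintro _ ⟨_, ⟨l, rfl, rfl⟩, _, ⟨l', rfl, rfl⟩, rfl⟩
    exact ⟨l ++ l', by simp, by simp⟩

theorem ι_mem_wordGr (M : DGModule K L) {i : ℤ} {x : L} (hx : x ∈ M.gr i) :
    ι K x ∈ wordGr M i :=
  Submodule.subset_span ⟨[⟨i, x, hx⟩], by simp, by simp⟩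

/-- The map which sends `x : L` to its homogeneous components in the tensor space. -/
def decι (M : DGModule K L) : L →ₗ[K] ⨁ i, wordGr M i :=
  DirectSum.toModule K ℤ _ (fun i => DirectSum.lof K ℤ (fun i => wordGr M i) i ∘ₗ
    ((ι K).restrict (p := M.gr i) (q := wordGr M i) fun _ hx => ι_mem_wordGr M hx)) ∘ₗ
    M.dec.toLinearMap

theorem decι_of_mem (M : DGModule K L) {i : ℤ} {x : L} (hx : x ∈ M.gr i) :
    decι M x = DirectSum.of (fun i => wordGr M i) i ⟨ι K x, ι_mem_wordGr M hx⟩ := by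
  simp [decι, M.dec_of_mem hx, DirectSum.toModule_lof]
  rfl

theorem wordGr_isInternal (M : DGModule K L) : DirectSum.IsInternal (wordGr M) := by
  have : GradedAlgebra (wordGr M) := GradedAlgebra.ofAlgHom _ (TensorAlgebra.lift K (decι M))
    (by
      apply TensorAlgebra.hom_ext
      apply M.hom_ext
      intro i x hx
      simp [decι_of_mem M hx])
    (by
      rintro n ⟨t, ht⟩
      have key : ∀ {n : ℤ} {t : TensorAlgebra K L} (ht : t ∈ wordGr M n),
          ∃ h : t ∈ wordGr M n, TensorAlgebra.lift K (decι M) t =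
            DirectSum.of (fun i => wordGr M i) n ⟨t, h⟩ := by
        intro n t ht
        refine wordGr_induction M (P := fun n t => ∃ h : t ∈ wordGr M n,
          TensorAlgebra.lift K (decι M) t = DirectSum.of (fun i => wordGr M i) n ⟨t, h⟩)
          ?zero ?one ?add ?smul ?ι_mul ht
        case zero =>
          intro n
          refine ⟨zero_mem _, ?_⟩
          rw [map_zero]; exact (map_zero (DirectSum.of (fun i => wordGr M i) n)).symm
        case one => exact ⟨SetLike.GradedOne.one_mem, by rw [map_one]; rfl⟩
        case add =>
          rintro n s t hs ht
          obtain ⟨hs, es⟩ := hs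
          obtain ⟨ht, et⟩ := ht
          refine ⟨add_mem hs ht, ?_⟩
          rw [map_add, es, et, ← map_add]; rfl
        case smul =>
          rintro n c t ht
          obtain ⟨ht, et⟩ := ht
          refine ⟨Submodule.smul_mem _ c ht, ?_⟩
          rw [map_smul, et, ← DirectSum.lof_eq_of K, ← map_smul]; rfl
        case ι_mul =>
          rintro i x n t hx ht h
          obtain ⟨_, et⟩ := h
          refine ⟨SetLike.GradedMul.mul_mem (ι_mem_wordGr M hx) ht, ?_⟩
          rw [map_mul, et, TensorAlgebra.lift_ι_apply, decι_of_mem M hx, DirectSum.of_mul_of]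
          rfl
      exact (key ht).2)
  exact DirectSum.Decomposition.isInternal _

/-- The differential of the tensor space:
`d (x ⊗ t) = d x ⊗ t + (-1) ^ |x| • x ⊗ d t` for `x : L`. -/
def wordD (M : DGModule K L) : TensorAlgebra K L →ₗ[K] TensorAlgebra K L :=
  leftRec
    { toFun := fun x => (LinearMap.mulLeft K (ι K (M.d x))).coprod
        (LinearMap.mulLeft K (ι K (M.sgn (-1) x)))
      map_add' := fun x y => by ext <;> simp [add_mul]
      map_smul' := fun c x => by ext <;> simp }

theorem wordD_one (M : DGModule K L) : wordD M 1 = 0 := leftRec_one _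

theorem wordD_ι_mul (M : DGModule K L) (x : L) (t : TensorAlgebra K L) :
    wordD M (ι K x * t) = ι K (M.d x) * t + ι K (M.sgn (-1) x) * wordD M t := by
  rw [wordD, leftRec_ι_mul]; rfl

theorem wordD_mem (M : DGModule K L) (n : ℤ) (t : TensorAlgebra K L) (ht : t ∈ wordGr M n) :
    wordD M t ∈ wordGr M (n - 1) := by
  refine wordGr_induction M (P := fun n t => wordD M t ∈ wordGr M (n - 1))
    ?_ ?_ ?_ ?_ ?_ ht
  · intro n; simp
  · simp [wordD_one]
  · intro n s t hs ht; rw [map_add]; exact add_mem hs ht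
  · intro n c t ht; rw [map_smul]; exact Submodule.smul_mem _ c ht
  · intro i x n t hx ht h
    rw [wordD_ι_mul]
    refine add_mem ?_ ?_
    · rw [show i + n - 1 = (i - 1) + n by ring]
      exact SetLike.GradedMul.mul_mem (ι_mem_wordGr M (M.d_mem i x hx)) ht
    · rw [show i + n - 1 = i + (n - 1) by ring]
      exact SetLike.GradedMul.mul_mem (ι_mem_wordGr M (M.sgn_mem _ hx)) h

theorem wordD_wordD (M : DGModule K L) (t : TensorAlgebra K L) : wordD M (wordD M t) = 0 := by
  induction t using induction_left with
  | one => simp [wordD_one]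
  | add s t hs ht => simp [hs, ht]
  | smul c t ht => simp [ht]
  | ι_mul x t ht => simp [wordD_ι_mul, ht, M.d_d, M.sgn_d]

/-- The tensor space of a chain complex, as a chain complex. -/
def words (M : DGModule K L) : DGModule K (TensorAlgebra K L) where
  gr := wordGr M
  isInternal := wordGr_isInternal M
  d := wordD M
  d_mem := wordD_mem M
  d_d := wordD_wordD M

theorem words_sgn_one (M : DGModule K L) (m : ℤ) : (words M).sgn m 1 = 1 := by
  rw [(words M).sgn_of_mem m (i := 0) (SetLike.GradedOne.one_mem (A := wordGr M))]; simp

theorem words_sgn_ι_mul (M : DGModule K L) (m : ℤ) (x : L) (t : TensorAlgebra K L) :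
    (words M).sgn m (ι K x * t) = ι K (M.sgn m x) * (words M).sgn m t := by
  induction x using M.hom_induction with
  | zero => simp
  | add x y hx hy => simp [add_mul, hx, hy]
  | mem i x hx =>
    induction t using (words M).hom_induction with
    | zero => simp
    | add s t hs ht => simp only [mul_add, map_add, hs, ht]
    | mem j t ht =>
      rw [(words M).sgn_of_mem m ht, M.sgn_of_mem m hx,
        (words M).sgn_of_mem m (i := i + j)
          (SetLike.GradedMul.mul_mem (A := wordGr M) (ι_mem_wordGr M hx) ht),
        mul_add, zpow_add₀ (by simp), map_smul, smul_mul_smul_comm]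

/-- The projection of the tensor space onto its part `⨁ n ≥ 1, L^{⊗ n}` of positive length. -/
def pos : TensorAlgebra K L →ₗ[K] TensorAlgebra K L :=
  LinearMap.id - Algebra.linearMap K _ ∘ₗ TensorAlgebra.algebraMapInv.toLinearMap

/-- The reduced deconcatenation coproduct
`x₁ ⊗ ⋯ ⊗ xₙ ↦ ∑ 0 < i < n, (x₁ ⊗ ⋯ ⊗ xᵢ) ⊗ (xᵢ₊₁ ⊗ ⋯ ⊗ xₙ)`, defined by recursion:
`x ⊗ t ↦ x ⊗ pos t + (x ⊗ 1) * deconc t`. -/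
def deconc : TensorAlgebra K L →ₗ[K] TensorAlgebra K L ⊗[K] TensorAlgebra K L :=
  leftRec
    { toFun := fun x => (TensorProduct.mk K _ _ (ι K x) ∘ₗ pos).coprod
        ((LinearMap.mulLeft K (ι K x)).rTensor _)
      map_add' := fun x y => by
        ext <;> simp [add_mul, TensorProduct.add_tmul]
      map_smul' := fun c x => by
        ext <;> simp [TensorProduct.smul_tmul'] }

theorem deconc_one : deconc (1 : TensorAlgebra K L) = 0 := leftRec_one _

theorem deconc_ι_mul (x : L) (t : TensorAlgebra K L) :
    deconc (ι K x * t) =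
      ι K x ⊗ₜ[K] pos t + (LinearMap.mulLeft K (ι K x)).rTensor _ (deconc t) := by
  rw [deconc, leftRec_ι_mul]; rfl

theorem pos_one : pos (1 : TensorAlgebra K L) = 0 := by simp [pos]

theorem pos_ι_mul (x : L) (t : TensorAlgebra K L) : pos (ι K x * t) = ι K x * t := by
  simp [pos, TensorAlgebra.algebraMapInv]

theorem deconc_prod (l : List L) :
    deconc ((l.map (ι K)).prod) = ∑ i ∈ Finset.Ico 1 l.length,
      ((l.take i).map (ι K)).prod ⊗ₜ[K] ((l.drop i).map (ι K)).prod := by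
  induction l with
  | nil => simp [deconc_one]
  | cons x l ih =>
    rw [List.map_cons, List.prod_cons, deconc_ι_mul, ih, map_sum]
    cases l with
    | nil => simp [pos_one]
    | cons y l =>
      rw [Finset.sum_eq_sum_Ico_succ_bot (a := 1) (b := (x :: y :: l).length) (by simp),
        List.length_cons (a := x), ← Finset.sum_Ico_add' _ 1 _ 1]
      simp [pos_ι_mul]

end Structure

end TensorCoalgebra

namespace TensorCoalgebra

open TensorAlgebra (ι)

section Coalgebra

variable {K : Type u} [Field K] {L : Type v} [AddCommGroup L] [Module K L]

theorem pos_pos (t : TensorAlgebra K L) : pos (pos t) = pos t := by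
  simp [pos, TensorAlgebra.algebraMapInv]

theorem deconc_pos (t : TensorAlgebra K L) : deconc (pos t) = deconc t := by
  simp [pos, Algebra.algebraMap_eq_smul_one, deconc_one]

theorem wordD_pos (M : DGModule K L) (t : TensorAlgebra K L) : wordD M (pos t) = wordD M t := by
  simp [pos, Algebra.algebraMap_eq_smul_one, wordD_one]

theorem pos_wordD (M : DGModule K L) (t : TensorAlgebra K L) : pos (wordD M t) = wordD M t := by
  induction t using induction_left with
  | one => simp [wordD_one]
  | add s t hs ht => simp [hs, ht]
  | smul c t ht => simp [ht]
  | ι_mul x t ht => simp [wordD_ι_mul, pos_ι_mul]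

theorem pos_rTensor_deconc (t : TensorAlgebra K L) :
    pos.rTensor (TensorAlgebra K L) (deconc t) = deconc t := by
  induction t using induction_left with
  | one => simp [deconc_one]
  | add s t hs ht => simp [hs, ht]
  | smul c t ht => simp [ht]
  | ι_mul x t ht =>
    have h1 : pos ∘ₗ LinearMap.mulLeft K (ι K x) = LinearMap.mulLeft K (ι K x) := by
      ext t; simp [pos_ι_mul]
    have h2 := pos_ι_mul x (1 : TensorAlgebra K L)
    rw [mul_one] at h2
    rw [deconc_ι_mul, map_add, LinearMap.rTensor_tmul, h2, ← LinearMap.rTensor_comp_apply, h1]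

theorem deconc_coassoc (t : TensorAlgebra K L) :
    TensorProduct.assoc K _ _ _ (deconc.rTensor (TensorAlgebra K L) (deconc t)) =
      deconc.lTensor (TensorAlgebra K L) (deconc t) := by
  induction t using induction_left with
  | one => simp [deconc_one]
  | add s t hs ht => simp [hs, ht]
  | smul c t ht => simp [ht]
  | ι_mul x t ht =>
    have h0 : deconc (ι K x) = 0 := by
      have := deconc_ι_mul x (1 : TensorAlgebra K L)
      simpa [pos_one, deconc_one] using this
    have h1 : ∀ w : TensorAlgebra K L ⊗[K] TensorAlgebra K L,
        TensorProduct.assoc K _ _ _ (deconc.rTensor (TensorAlgebra K L)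
          ((LinearMap.mulLeft K (ι K x)).rTensor _ w)) =
        ι K x ⊗ₜ[K] pos.rTensor (TensorAlgebra K L) w +
          (LinearMap.mulLeft K (ι K x)).rTensor _
            (TensorProduct.assoc K _ _ _ (deconc.rTensor (TensorAlgebra K L) w)) := by
      intro w
      induction w using TensorProduct.induction_on with
      | zero => simp
      | add a b ha hb => simp only [map_add, ha, hb, TensorProduct.tmul_add]; abel
      | tmul a b =>
        simp only [LinearMap.rTensor_tmul, LinearMap.mulLeft_apply, deconc_ι_mul,
          TensorProduct.add_tmul, map_add, TensorProduct.assoc_tmul]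
        congr 1
        induction deconc a using TensorProduct.induction_on with
        | zero => simp
        | add p q hp hq => simp only [map_add, TensorProduct.add_tmul, hp, hq]
        | tmul p q => simp
    have h2 : ∀ w : TensorAlgebra K L ⊗[K] TensorAlgebra K L,
        deconc.lTensor (TensorAlgebra K L) ((LinearMap.mulLeft K (ι K x)).rTensor _ w) =
        (LinearMap.mulLeft K (ι K x)).rTensor _ (deconc.lTensor (TensorAlgebra K L) w) := by
      intro w
      induction w using TensorProduct.induction_on with
      | zero => simp
      | add a b ha hb => simp only [map_add, ha, hb]
      | tmul a b => simp
    rw [deconc_ι_mul, map_add, map_add, map_add, h1, h2, ht, LinearMap.rTensor_tmul, h0,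
      LinearMap.lTensor_tmul, deconc_pos, pos_rTensor_deconc]
    simp

theorem deconc_wordD (M : DGModule K L) (t : TensorAlgebra K L) :
    deconc (wordD M t) = (words M).tensorD (words M) (deconc t) := by
  induction t using induction_left with
  | one => simp [deconc_one, wordD_one]
  | add s t hs ht => simp [hs, ht]
  | smul c t ht => simp [ht]
  | ι_mul x t ht =>
    have h1 : ∀ w : TensorAlgebra K L ⊗[K] TensorAlgebra K L,
        (words M).tensorD (words M) ((LinearMap.mulLeft K (ι K x)).rTensor _ w) =
        (LinearMap.mulLeft K (ι K (M.d x))).rTensor _ w +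
          (LinearMap.mulLeft K (ι K (M.sgn (-1) x))).rTensor _
            ((words M).tensorD (words M) w) := by
      intro w
      induction w using TensorProduct.induction_on with
      | zero => simp
      | add a b ha hb => simp only [map_add, ha, hb]; abel
      | tmul a b =>
        have h : (words M).d = wordD M := rfl
        simp [DGModule.tensorD, h, wordD_ι_mul, words_sgn_ι_mul, TensorProduct.add_tmul, add_assoc]
    have h2 : (words M).d (ι K x) = ι K (M.d x) := by
      have := wordD_ι_mul M x 1
      rw [mul_one, mul_one, wordD_one, mul_zero, add_zero] at this
      exact this
    have h3 : (words M).sgn (-1) (ι K x) = ι K (M.sgn (-1) x) := by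
      have := words_sgn_ι_mul M (-1) x 1
      simpa [words_sgn_one] using this
    have h4 : (words M).d (pos t) = pos (wordD M t) := by
      rw [pos_wordD]; exact wordD_pos M t
    rw [wordD_ι_mul, map_add, deconc_ι_mul, deconc_ι_mul, deconc_ι_mul, map_add, h1, ht,
      DGModule.tensorD]
    simp only [LinearMap.add_apply, TensorProduct.map_tmul, LinearMap.id_apply, h2, h3, h4]
    abel

theorem deconc_mem (M : DGModule K L) (n : ℤ) (t : TensorAlgebra K L) (ht : t ∈ wordGr M n) :
    deconc t ∈ (words M).tensorGr (words M) n := by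
  refine (wordGr_induction M (P := fun n t => pos t ∈ wordGr M n ∧
    deconc t ∈ (words M).tensorGr (words M) n) ?_ ?_ ?_ ?_ ?_ ht).2
  · intro n; simp
  · simp [deconc_one, pos_one]
  · intro n s t hs ht
    rw [map_add, map_add]
    exact ⟨add_mem hs.1 ht.1, add_mem hs.2 ht.2⟩
  · intro n c t ht
    rw [map_smul, map_smul]
    exact ⟨Submodule.smul_mem _ c ht.1, Submodule.smul_mem _ c ht.2⟩
  · intro i x n t hx ht h
    constructor
    · rw [pos_ι_mul]
      exact SetLike.GradedMul.mul_mem (ι_mem_wordGr M hx) ht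
    · rw [deconc_ι_mul]
      refine add_mem ((words M).tmul_mem_tensorGr (words M) rfl (ι_mem_wordGr M hx) h.1) ?_
      have : (words M).tensorGr (words M) n ≤ ((words M).tensorGr (words M) (i + n)).comap
          ((LinearMap.mulLeft K (ι K x)).rTensor _) := by
        refine Submodule.span_le.2 ?_
        rintro _ ⟨j, k, hjk, a, ha, b, hb, rfl⟩
        exact (words M).tmul_mem_tensorGr (words M) (i := i + j) (by omega)
          (SetLike.GradedMul.mul_mem (A := wordGr M) (ι_mem_wordGr M hx) ha) hb
      exact this h.2

end Coalgebra

end TensorCoalgebra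

open TensorCoalgebra

section Enveloping

variable {K : Type u} [Field K] {L : Type v} [AddCommGroup L] [Module K L]

/-- A dg subcoalgebra `C` of the reduced tensor coalgebra `⨁ n ≥ 1, L^{⊗ n}` (the cofree conilpotent
dg coalgebra on the chain complex `L`) such that the projection `C → L` is a morphism of Lie
coalgebras, where `C` carries the cocommutator `Δ - swap ∘ Δ` of its coproduct. -/
structure IsLieSubcoalgebra (L' : DGLieCoalgebra K L) (C : Submodule K (TensorAlgebra K L)) :
    Prop where
  reduced : ∀ t ∈ C, TensorAlgebra.algebraMapInv t = 0
  homogeneous : ∀ (n : ℤ), ∀ t ∈ C, (words L'.toDGModule).comp n t ∈ C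
  d_mem : ∀ t ∈ C, (words L'.toDGModule).d t ∈ C
  deconc_mem : ∀ t ∈ C, deconc t ∈ LinearMap.range (TensorProduct.mapIncl C C)
  lie : ∀ t ∈ C, TensorProduct.map TensorAlgebra.ιInv TensorAlgebra.ιInv
    (deconc t - (words L'.toDGModule).swap (words L'.toDGModule) (deconc t)) =
      L'.cobracket (TensorAlgebra.ιInv t)

/-- The underlying space of the universal enveloping conilpotent coalgebra of a dg Lie coalgebra
`L`: the largest dg subcoalgebra of the cofree conilpotent dg coalgebra on `L` for which the
projection to `L` is a morphism of Lie coalgebras. -/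
def envelopingSubmodule (L' : DGLieCoalgebra K L) : Submodule K (TensorAlgebra K L) :=
  sSup {C | IsLieSubcoalgebra L' C}

theorem envelopingSubmodule_isLieSubcoalgebra (L' : DGLieCoalgebra K L) :
    IsLieSubcoalgebra L' (envelopingSubmodule L') := by
  have key : ∀ {P : TensorAlgebra K L → Prop}, P 0 → (∀ s t, P s → P t → P (s + t)) →
      (∀ C, IsLieSubcoalgebra L' C → ∀ t ∈ C, P t) → ∀ t ∈ envelopingSubmodule L', P t := by
    intro P h0 hadd h t ht
    rw [envelopingSubmodule, sSup_eq_iSup'] at ht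
    exact Submodule.iSup_induction _ (motive := P) ht (fun C t ht => h C.1 C.2 t ht) h0 hadd
  have le : ∀ C, IsLieSubcoalgebra L' C → C ≤ envelopingSubmodule L' := fun C hC => le_sSup hC
  constructor
  · exact key (by simp) (fun s t hs ht => by simp [hs, ht]) fun C hC => hC.reduced
  · intro n
    exact key (by simp) (fun s t hs ht => by rw [map_add]; exact add_mem hs ht)
      fun C hC t ht => le C hC (hC.homogeneous n t ht)
  · exact key (by simp) (fun s t hs ht => by rw [map_add]; exact add_mem hs ht)
      fun C hC t ht => le C hC (hC.d_mem t ht)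
  · refine key (by simp) (fun s t hs ht => by rw [map_add]; exact add_mem hs ht)
      fun C hC t ht => ?_
    obtain ⟨w, hw⟩ := hC.deconc_mem t ht
    refine ⟨TensorProduct.map (Submodule.inclusion (le C hC)) (Submodule.inclusion (le C hC)) w, ?_⟩
    rw [← hw, TensorProduct.mapIncl, TensorProduct.mapIncl, ← LinearMap.comp_apply,
      ← TensorProduct.map_comp]
    rfl
  · refine key (by simp) (fun s t hs ht => ?_) fun C hC => hC.lie
    simp only [map_add, ← hs, ← ht, map_sub]
    abel

end Enveloping

section EnvelopingCoalgebra

variable {K : Type u} [Field K] {L : Type v} [AddCommGroup L] [Module K L]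

theorem mapIncl_injective (U : Submodule K L) :
    Function.Injective (TensorProduct.mapIncl U U) :=
  TensorProduct.map_injective_of_flat_flat _ _ U.subtype_injective U.subtype_injective

/-- The universal enveloping conilpotent coalgebra as a chain complex. -/
def envelopingDGModule (L' : DGLieCoalgebra K L) : DGModule K (envelopingSubmodule L') :=
  (words L'.toDGModule).restrict (envelopingSubmodule L')
    (envelopingSubmodule_isLieSubcoalgebra L').homogeneous
    (envelopingSubmodule_isLieSubcoalgebra L').d_mem

/-- The coproduct of the universal enveloping conilpotent coalgebra: the restriction of the reduced
deconcatenation coproduct. -/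
def envelopingComul (L' : DGLieCoalgebra K L) :
    envelopingSubmodule L' →ₗ[K] envelopingSubmodule L' ⊗[K] envelopingSubmodule L' :=
  (LinearEquiv.ofInjective _ (mapIncl_injective (envelopingSubmodule L'))).symm.toLinearMap ∘ₗ
    deconc.restrict (envelopingSubmodule_isLieSubcoalgebra L').deconc_mem

theorem mapIncl_envelopingComul (L' : DGLieCoalgebra K L) (c : envelopingSubmodule L') :
    TensorProduct.mapIncl _ _ (envelopingComul L' c) = deconc (c : TensorAlgebra K L) := by
  have h := LinearEquiv.apply_symm_apply
    (LinearEquiv.ofInjective _ (mapIncl_injective (envelopingSubmodule L')))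
    (deconc.restrict (envelopingSubmodule_isLieSubcoalgebra L').deconc_mem c)
  exact congrArg Subtype.val h

/-- The universal enveloping conilpotent coalgebra `Uᶜ L` of a dg Lie coalgebra `L`. -/
def envelopingCoalgebra (L' : DGLieCoalgebra K L) : DGCoalgebra K (envelopingSubmodule L') where
  toDGModule := envelopingDGModule L'
  comul := envelopingComul L'
  comul_mem n x hx := by
    rw [DGModule.mem_tensorGr_iff]
    apply mapIncl_injective
    rw [envelopingDGModule, DGModule.mapIncl_tensorComp, mapIncl_envelopingComul,
      ← DGModule.mem_tensorGr_iff]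
    exact deconc_mem L'.toDGModule n x hx
  comul_d x := by
    apply mapIncl_injective
    rw [envelopingDGModule, DGModule.mapIncl_tensorD, mapIncl_envelopingComul,
      mapIncl_envelopingComul]
    exact deconc_wordD L'.toDGModule x
  coassoc x := by
    have inj : Function.Injective (TensorProduct.map (envelopingSubmodule L').subtype
        (TensorProduct.mapIncl (envelopingSubmodule L') (envelopingSubmodule L'))) :=
      TensorProduct.map_injective_of_flat_flat _ _ (Submodule.subtype_injective _)
        (mapIncl_injective _)
    apply inj
    have h1 : ∀ w, TensorProduct.map (envelopingSubmodule L').subtype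
        (TensorProduct.mapIncl (envelopingSubmodule L') (envelopingSubmodule L'))
          (TensorProduct.assoc K _ _ _ ((envelopingComul L').rTensor _ w)) =
        TensorProduct.assoc K _ _ _ (deconc.rTensor _ (TensorProduct.mapIncl _ _ w)) := by
      intro w
      induction w using TensorProduct.induction_on with
      | zero => simp
      | add a b ha hb => simp only [map_add, ha, hb]
      | tmul a b =>
        rw [TensorProduct.mapIncl, TensorProduct.map_tmul, LinearMap.rTensor_tmul,
          LinearMap.rTensor_tmul, Submodule.subtype_apply, ← mapIncl_envelopingComul]
        induction envelopingComul L' a using TensorProduct.induction_on with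
        | zero => simp
        | add p q hp hq => simp only [map_add, TensorProduct.add_tmul, hp, hq]
        | tmul p q => simp [TensorProduct.mapIncl]
    have h2 : ∀ w, TensorProduct.map (envelopingSubmodule L').subtype
        (TensorProduct.mapIncl (envelopingSubmodule L') (envelopingSubmodule L'))
          ((envelopingComul L').lTensor _ w) =
        deconc.lTensor _ (TensorProduct.mapIncl _ _ w) := by
      intro w
      induction w using TensorProduct.induction_on with
      | zero => simp
      | add a b ha hb => simp only [map_add, ha, hb]
      | tmul a b =>
        rw [LinearMap.lTensor_tmul, TensorProduct.map_tmul, mapIncl_envelopingComul]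
        simp [TensorProduct.mapIncl]
    rw [h1, h2, mapIncl_envelopingComul, deconc_coassoc]

/-- The projection `Uᶜ L → L`. -/
def envelopingProj (L' : DGLieCoalgebra K L) : envelopingSubmodule L' →ₗ[K] L :=
  TensorAlgebra.ιInv ∘ₗ (envelopingSubmodule L').subtype

theorem ιInv_one : TensorAlgebra.ιInv (1 : TensorAlgebra K L) = (0 : L) := by
  let _ : Module Kᵐᵒᵖ L := Module.compHom _ ((RingHom.id K).fromOpposite mul_comm)
  have : IsCentralScalar K L := ⟨fun r m => rfl⟩
  have h : (TensorAlgebra.toTrivSqZeroExt (1 : TensorAlgebra K L)).snd = (0 : L) := by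
    rw [map_one, TrivSqZeroExt.snd_one]
  exact h

theorem ιInv_ι_mul (x : L) (t : TensorAlgebra K L) :
    TensorAlgebra.ιInv (TensorAlgebra.ι K x * t) = TensorAlgebra.algebraMapInv t • x := by
  let _ : Module Kᵐᵒᵖ L := Module.compHom _ ((RingHom.id K).fromOpposite mul_comm)
  have : IsCentralScalar K L := ⟨fun r m => rfl⟩
  have h : (TensorAlgebra.toTrivSqZeroExt t).fst = TensorAlgebra.algebraMapInv t := by
    have : (TrivSqZeroExt.fstHom K K L).comp TensorAlgebra.toTrivSqZeroExt =
        TensorAlgebra.algebraMapInv := by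
      apply TensorAlgebra.hom_ext
      ext x
      simp [TensorAlgebra.algebraMapInv]
    exact DFunLike.congr_fun this t
  rw [← h]
  simp [TensorAlgebra.ιInv]

theorem algebraMapInv_of_mem (M : DGModule K L) {n : ℤ} {t : TensorAlgebra K L}
    (ht : t ∈ wordGr M n) (hn : n ≠ 0) : TensorAlgebra.algebraMapInv t = 0 := by
  refine wordGr_induction M (P := fun n t => n ≠ 0 → TensorAlgebra.algebraMapInv t = 0)
    ?_ ?_ ?_ ?_ ?_ ht hn
  · simp
  · simp
  · intro n s t hs ht hn; rw [map_add, hs hn, ht hn, add_zero]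
  · intro n c t ht hn; rw [map_smul, ht hn, smul_zero]
  · intro i x n t hx ht h hn; simp [TensorAlgebra.algebraMapInv]

theorem ιInv_mem (M : DGModule K L) {n : ℤ} {t : TensorAlgebra K L} (ht : t ∈ wordGr M n) :
    TensorAlgebra.ιInv t ∈ M.gr n := by
  refine wordGr_induction M (P := fun n t => TensorAlgebra.ιInv t ∈ M.gr n) ?_ ?_ ?_ ?_ ?_ ht
  · simp
  · rw [ιInv_one]; exact zero_mem _
  · intro n s t hs ht; rw [map_add]; exact add_mem hs ht
  · intro n c t ht; rw [map_smul]; exact Submodule.smul_mem _ c ht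
  · intro i x n t hx ht h
    rw [ιInv_ι_mul]
    by_cases hn : n = 0
    · subst hn; rw [add_zero]; exact Submodule.smul_mem _ _ hx
    · rw [algebraMapInv_of_mem M ht hn, zero_smul]; exact zero_mem _

theorem ιInv_wordD (M : DGModule K L) (t : TensorAlgebra K L) :
    TensorAlgebra.ιInv (wordD M t) = M.d (TensorAlgebra.ιInv t) := by
  induction t using induction_left with
  | one => simp [wordD_one, ιInv_one]
  | add s t hs ht => simp [hs, ht]
  | smul c t ht => simp [ht]
  | ι_mul x t ht =>
    have h : TensorAlgebra.algebraMapInv (wordD M t) = 0 := by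
      have h := pos_wordD M t
      simpa [pos] using h
    rw [wordD_ι_mul, map_add, ιInv_ι_mul, ιInv_ι_mul, ιInv_ι_mul, h, map_smul]
    simp

theorem envelopingProj_mem (L' : DGLieCoalgebra K L) {n : ℤ} {c : envelopingSubmodule L'}
    (hc : c ∈ (envelopingCoalgebra L').gr n) : envelopingProj L' c ∈ L'.gr n :=
  ιInv_mem L'.toDGModule hc

theorem envelopingProj_d (L' : DGLieCoalgebra K L) (c : envelopingSubmodule L') :
    envelopingProj L' ((envelopingCoalgebra L').d c) = L'.d (envelopingProj L' c) :=
  ιInv_wordD L'.toDGModule c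

/-- The cocommutator `Δ - swap ∘ Δ` of the coproduct of a dg coalgebra. -/
def DGCoalgebra.cocommutator {C : Type w} [AddCommGroup C] [Module K C] (C' : DGCoalgebra K C) :
    C →ₗ[K] C ⊗[K] C :=
  C'.comul - C'.swap C'.toDGModule ∘ₗ C'.comul

/-- The projection `Uᶜ L → L` is compatible with cobrackets. -/
theorem envelopingProj_cobracket (L' : DGLieCoalgebra K L) (c : envelopingSubmodule L') :
    TensorProduct.map (envelopingProj L') (envelopingProj L')
      ((envelopingCoalgebra L').cocommutator c) = L'.cobracket (envelopingProj L' c) := by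
  have h := (envelopingSubmodule_isLieSubcoalgebra L').lie c c.2
  rw [← mapIncl_envelopingComul, ← DGModule.mapIncl_swap _ _
    (envelopingSubmodule_isLieSubcoalgebra L').homogeneous
    (envelopingSubmodule_isLieSubcoalgebra L').d_mem, ← map_sub, TensorProduct.mapIncl,
    ← LinearMap.comp_apply, ← TensorProduct.map_comp] at h
  exact h

end EnvelopingCoalgebra

section Coradical

variable {K : Type u} [Field K] {C : Type v} [AddCommGroup C] [Module K C]

/-- The coradical filtration associated with a coproduct or a Lie cobracket `Δ`: the `k`-th term
`F k` consists of the elements which are annihilated by all iterated coproducts (or cobrackets) with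
more than `k` outputs. Thus `F 0 = 0`, `F 1` is the kernel of `Δ`, and
`F (k + 1) = {x | Δ x ∈ F k ⊗ F k}`. -/
def coradical (Δ : C →ₗ[K] C ⊗[K] C) : ℕ → Submodule K C
  | 0 => ⊥
  | k + 1 => (LinearMap.range (TensorProduct.mapIncl (coradical Δ k) (coradical Δ k))).comap Δ

/-- A dg Lie coalgebra is conilpotent if its coradical filtration is exhaustive. -/
def DGLieCoalgebra.IsConilpotent (C' : DGLieCoalgebra K C) : Prop :=
  ∀ x : C, ∃ k : ℕ, x ∈ coradical C'.cobracket k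

theorem coradical_homogeneous (M : DGModule K C) (Δ : C →ₗ[K] C ⊗[K] C)
    (hΔ : ∀ i, ∀ x ∈ M.gr i, Δ x ∈ M.tensorGr M i) (k : ℕ) :
    ∀ n, ∀ x ∈ coradical Δ k, M.comp n x ∈ coradical Δ k := by
  induction k with
  | zero =>
    intro n x hx
    obtain rfl : x = 0 := hx
    rw [map_zero]; exact zero_mem _
  | succ k ih =>
    intro n x hx
    have h : Δ (M.comp n x) = M.tensorComp M n (Δ x) := by
      clear hx
      induction x using M.hom_induction with
      | zero => simp
      | add x y hx hy => simp only [map_add, hx, hy]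
      | mem i x hx =>
        rw [M.tensorComp_of_mem M (hΔ i x hx), M.comp_of_mem hx]
        split_ifs <;> simp
    change Δ (M.comp n x) ∈
      LinearMap.range (TensorProduct.mapIncl (coradical Δ k) (coradical Δ k))
    rw [h]
    exact M.tensorComp_mem_of_homogeneous ih n _ hx

end Coradical

section Hom

variable {K : Type u} [Field K]
variable {V : Type v} [AddCommGroup V] [Module K V]
variable {W : Type w} [AddCommGroup W] [Module K W]

/-- The degree `n` part of the internal hom of chain complexes `hom(V, W)`: the linear maps which
raise the degree by `n`. -/
def homGr (M : DGModule K V) (N : DGModule K W) (n : ℤ) : Submodule K (V →ₗ[K] W) where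
  carrier := {f | ∀ i, ∀ x ∈ M.gr i, f x ∈ N.gr (i + n)}
  zero_mem' _ _ _ := zero_mem _
  add_mem' hf hg i x hx := add_mem (hf i x hx) (hg i x hx)
  smul_mem' c _ hf i x hx := Submodule.smul_mem _ c (hf i x hx)

/-- The differential `f ↦ d ∘ f - (-1) ^ n • f ∘ d` of the internal hom, for `f` of degree `n`. -/
def homD (M : DGModule K V) (N : DGModule K W) (n : ℤ) : homGr M N n →ₗ[K] homGr M N (n - 1) where
  toFun f := ⟨N.d ∘ₗ f.1 - ((-1 : K) ^ n) • (f.1 ∘ₗ M.d), fun i x hx => by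
    refine sub_mem ?_ (Submodule.smul_mem _ _ ?_)
    · rw [show i + (n - 1) = i + n - 1 by ring]
      exact N.d_mem _ _ (f.2 i x hx)
    · rw [show i + (n - 1) = i - 1 + n by ring]
      exact f.2 _ _ (M.d_mem i x hx)⟩
  map_add' f g := by
    apply Subtype.ext
    simp only [Submodule.coe_add, LinearMap.comp_add, LinearMap.add_comp, smul_add]
    abel
  map_smul' c f := by
    apply Subtype.ext
    simp only [Submodule.coe_smul, LinearMap.comp_smul, LinearMap.smul_comp, RingHom.id_apply,
      smul_sub, smul_comm c]

/-- The filtration on `hom(V, W)` induced by a coproduct or cobracket `Δ` on `V`: the `k`-th term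
consists of the maps which vanish on the `k`-th term of the coradical filtration. It is a decreasing
filtration, with everything in the term `k = 0`. -/
def homFil (M : DGModule K V) (N : DGModule K W) (Δ : V →ₗ[K] V ⊗[K] V) (n : ℤ) (k : ℕ) :
    Submodule K (homGr M N n) where
  carrier := {f | ∀ x ∈ coradical Δ k, f.1 x = 0}
  zero_mem' := fun _ _ => rfl
  add_mem' := fun {f g} hf hg x hx => by
    rw [Submodule.coe_add, LinearMap.add_apply, hf x hx, hg x hx, add_zero]
  smul_mem' := fun c f hf x hx => by
    rw [Submodule.coe_smul, LinearMap.smul_apply, hf x hx, smul_zero]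

variable {A : Type w} [NonUnitalRing A] [Module K A] [IsScalarTower K A A] [SMulCommClass K A A]

/-- The convolution `x ↦ ∑ ± f x₍₁₎ * g x₍₂₎` with respect to `Δ x = ∑ x₍₁₎ ⊗ x₍₂₎`, where `g` has
degree `n` and the Koszul sign is `(-1) ^ (n * |x₍₁₎|)`. -/
def convolution (M : DGModule K V) (n : ℤ) (f g : V →ₗ[K] A) (Δ : V →ₗ[K] V ⊗[K] V) : V →ₗ[K] A :=
  LinearMap.mul' K A ∘ₗ TensorProduct.map (f ∘ₗ M.sgn n) g ∘ₗ Δ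

theorem convolution_mem (M : DGModule K V) (A' : CommDGAlgebra K A) {Δ : V →ₗ[K] V ⊗[K] V}
    (hΔ : ∀ i, ∀ x ∈ M.gr i, Δ x ∈ M.tensorGr M i) {m n : ℤ} {f g : V →ₗ[K] A}
    (hf : f ∈ homGr M A'.toDGModule m) (hg : g ∈ homGr M A'.toDGModule n) :
    convolution M n f g Δ ∈ homGr M A'.toDGModule (m + n) := by
  intro i x hx
  have h : M.tensorGr M i ≤ (A'.gr (i + (m + n))).comap
      (LinearMap.mul' K A ∘ₗ TensorProduct.map (f ∘ₗ M.sgn n) g) := by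
    refine Submodule.span_le.2 ?_
    rintro _ ⟨j, k, rfl, a, ha, b, hb, rfl⟩
    have := A'.mul_mem _ _ _ _ (hf j _ (M.sgn_mem n ha)) (hg k b hb)
    rw [show j + m + (k + n) = j + k + (m + n) by ring] at this
    simpa using this
  exact h (hΔ i x hx)

/-- The bracket of `hom(C, A)` for a dg coalgebra `C`: the graded commutator
`f * g - (-1) ^ (m * n) • g * f` of the convolution product, for `f` and `g` of degrees `m`, `n`. -/
def coalgebraBracket (C' : DGCoalgebra K V) (A' : CommDGAlgebra K A) {m n : ℤ}
    (f : homGr C'.toDGModule A'.toDGModule m) (g : homGr C'.toDGModule A'.toDGModule n) :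
    homGr C'.toDGModule A'.toDGModule (m + n) :=
  ⟨convolution C'.toDGModule n f.1 g.1 C'.comul -
      ((-1 : K) ^ (m * n)) • convolution C'.toDGModule m g.1 f.1 C'.comul,
    sub_mem (convolution_mem _ A' C'.comul_mem f.2 g.2)
      (Submodule.smul_mem _ _
        (add_comm n m ▸ convolution_mem _ A' C'.comul_mem g.2 f.2))⟩

/-- The bracket of `hom(L, A)` for a dg Lie coalgebra `L`: the convolution
`x ↦ ∑ ± f x₍₁₎ * g x₍₂₎` with respect to the cobracket of `L`. -/
def lieCoalgebraBracket (L' : DGLieCoalgebra K V) (A' : CommDGAlgebra K A) {m n : ℤ}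
    (f : homGr L'.toDGModule A'.toDGModule m) (g : homGr L'.toDGModule A'.toDGModule n) :
    homGr L'.toDGModule A'.toDGModule (m + n) :=
  ⟨convolution L'.toDGModule n f.1 g.1 L'.cobracket,
    convolution_mem _ A' L'.cobracket_mem f.2 g.2⟩

/-- The map `hom(L, W) → hom(Uᶜ L, W)` induced by the projection `Uᶜ L → L`, in degree `n`. -/
def homProj (L' : DGLieCoalgebra K V) (N : DGModule K W) (n : ℤ) :
    homGr L'.toDGModule N n →ₗ[K] homGr (envelopingCoalgebra L').toDGModule N n where
  toFun f := ⟨f.1 ∘ₗ envelopingProj L', fun i _ hx => f.2 i _ (envelopingProj_mem L' hx)⟩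
  map_add' _ _ := rfl
  map_smul' _ _ := rfl

/-- The induced map `hom(L, W) → hom(Uᶜ L, W)` is a chain map. -/
theorem homProj_homD (L' : DGLieCoalgebra K V) (N : DGModule K W) (n : ℤ)
    (f : homGr L'.toDGModule N n) :
    homProj L' N (n - 1) (homD L'.toDGModule N n f) =
      homD (envelopingCoalgebra L').toDGModule N n (homProj L' N n f) := by
  apply Subtype.ext
  ext c
  simp [homProj, homD, envelopingProj_d]

theorem envelopingProj_coradical (L' : DGLieCoalgebra K V) (k : ℕ) :
    ∀ c ∈ coradical (envelopingCoalgebra L').comul k,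
      envelopingProj L' c ∈ coradical L'.cobracket k := by
  induction k with
  | zero =>
    intro c hc
    obtain rfl : c = 0 := hc
    simp
  | succ k ih =>
    rintro c ⟨w, hw⟩
    change L'.cobracket (envelopingProj L' c) ∈ LinearMap.range
      (TensorProduct.mapIncl (coradical L'.cobracket k) (coradical L'.cobracket k))
    have h3 : (envelopingCoalgebra L').cocommutator c = (envelopingCoalgebra L').comul c -
      (envelopingCoalgebra L').swap (envelopingCoalgebra L').toDGModule
        ((envelopingCoalgebra L').comul c) := rfl
    rw [← envelopingProj_cobracket, h3, map_sub, ← hw]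
    clear hw h3
    have h : ∀ u ∈ LinearMap.range (TensorProduct.mapIncl
        (coradical (envelopingCoalgebra L').comul k) (coradical (envelopingCoalgebra L').comul k)),
        TensorProduct.map (envelopingProj L') (envelopingProj L') u ∈ LinearMap.range
          (TensorProduct.mapIncl (coradical L'.cobracket k) (coradical L'.cobracket k)) := by
      rintro _ ⟨u, rfl⟩
      induction u using TensorProduct.induction_on with
      | zero => simp
      | add a b ha hb => rw [map_add, map_add]; exact add_mem ha hb
      | tmul a b => exact ⟨⟨_, ih a a.2⟩ ⊗ₜ ⟨_, ih b b.2⟩, rfl⟩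
    refine sub_mem (h _ ⟨w, rfl⟩) (h _ (DGModule.swap_mem_of_homogeneous _ ?_ _ ⟨w, rfl⟩))
    exact coradical_homogeneous _ _ (envelopingCoalgebra L').comul_mem k

/-- The induced map `hom(L, W) → hom(Uᶜ L, W)` preserves the filtrations. -/
theorem homProj_fil (L' : DGLieCoalgebra K V) (N : DGModule K W) (n : ℤ) (k : ℕ)
    (f : homGr L'.toDGModule N n) (hf : f ∈ homFil L'.toDGModule N L'.cobracket n k) :
    homProj L' N n f ∈
      homFil (envelopingCoalgebra L').toDGModule N (envelopingCoalgebra L').comul n k :=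
  fun c hc => hf _ (envelopingProj_coradical L' k c hc)

theorem mul_map_swap (M : DGModule K V) (A' : CommDGAlgebra K A) {m n : ℤ} {f g : V →ₗ[K] A}
    (hf : f ∈ homGr M A'.toDGModule m) (hg : g ∈ homGr M A'.toDGModule n) (w : V ⊗[K] V) :
    LinearMap.mul' K A (TensorProduct.map (f ∘ₗ M.sgn n) g (M.swap M w)) =
      ((-1 : K) ^ (m * n)) • LinearMap.mul' K A (TensorProduct.map (g ∘ₗ M.sgn m) f w) := by
  induction w using TensorProduct.induction_on with
  | zero => simp
  | add a b ha hb => simp only [map_add, ha, hb, smul_add]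
  | tmul x y =>
    induction x using M.hom_induction with
    | zero => simp
    | add a b ha hb => simp only [TensorProduct.add_tmul, map_add, ha, hb, smul_add]
    | mem i x hx =>
      induction y using M.hom_induction with
      | zero => simp
      | add a b ha hb => simp only [TensorProduct.tmul_add, map_add, ha, hb, smul_add]
      | mem j y hy =>
        rw [M.swap_tmul M hx hy]
        simp only [map_smul, TensorProduct.map_tmul, LinearMap.comp_apply, M.sgn_of_mem _ hx,
          M.sgn_of_mem _ hy, LinearMap.mul'_apply, smul_mul_assoc, smul_smul]
        rw [A'.comm _ _ _ _ (hf j y hy) (hg i x hx), smul_smul, ← zpow_add₀ (by simp),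
          ← zpow_add₀ (by simp), ← zpow_add₀ (by simp)]
        congr 1
        rw [show i * j + n * j + (j + m) * (i + n) = (m * n + m * i) + (i * j + n * j) * 2 by ring,
          zpow_add₀ (by simp), Even.neg_one_zpow (n := (i * j + n * j) * 2) (by simp), mul_one]

/-- The induced map `hom(L, A) → hom(Uᶜ L, A)` is compatible with brackets. -/
theorem homProj_bracket (L' : DGLieCoalgebra K V) (A' : CommDGAlgebra K A) {m n : ℤ}
    (f : homGr L'.toDGModule A'.toDGModule m) (g : homGr L'.toDGModule A'.toDGModule n) :
    homProj L' A'.toDGModule (m + n) (lieCoalgebraBracket L' A' f g) =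
      coalgebraBracket (envelopingCoalgebra L') A' (homProj L' A'.toDGModule m f)
        (homProj L' A'.toDGModule n g) := by
  apply Subtype.ext
  ext c
  have h1 := mul_map_swap _ A' (homProj L' A'.toDGModule m f).2 (homProj L' A'.toDGModule n g).2
    ((envelopingCoalgebra L').comul c)
  have h2 : ∀ w, TensorProduct.map (f.1 ∘ₗ L'.sgn n) g.1
      (TensorProduct.map (envelopingProj L') (envelopingProj L') w) =
      TensorProduct.map ((homProj L' A'.toDGModule m f).1 ∘ₗ (envelopingCoalgebra L').sgn n)
        (homProj L' A'.toDGModule n g).1 w := by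
    intro w
    rw [← LinearMap.comp_apply, ← TensorProduct.map_comp]
    congr 2
    apply (envelopingCoalgebra L').toDGModule.hom_ext
    intro i x hx
    simp [homProj, DGModule.sgn_of_mem _ _ hx, L'.sgn_of_mem _ (envelopingProj_mem L' hx)]
  change LinearMap.mul' K A (TensorProduct.map (f.1 ∘ₗ L'.sgn n) g.1
    (L'.cobracket (envelopingProj L' c))) = _
  have h3 : (envelopingCoalgebra L').cocommutator c = (envelopingCoalgebra L').comul c -
    (envelopingCoalgebra L').swap (envelopingCoalgebra L').toDGModule
      ((envelopingCoalgebra L').comul c) := rfl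
  rw [← envelopingProj_cobracket, h2, h3, map_sub, map_sub, h1]
  rfl

end Hom

end DGPBW

end

/-! The retraction is restriction along a section. Suppose s : L → UᶜL is a chain map with p s = 1
which respects the coradical filtrations and is a morphism of L-comodules, in the sense that (p ⊗
1)(Δ - τΔ) s = (1 ⊗ s) δ. Since A is commutative, [p^*f, g] is the product of f and g evaluated on
(p ⊗ 1)(Δ - τΔ), so g ↦ g ∘ s is a module morphism, and its other properties are immediate.
Everything therefore rests on `exists_comodule_section`, which is dual to the part of the
Poincaré–Birkhoff–Witt theorem saying that a Lie algebra is a direct summand of its enveloping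
algebra under the adjoint action.

Write σ_i for the signed exchange of adjacent letters (`exch`) and δ_i for the cobracket of the
letter at position i (`cobr`). The elements t of positive length with (1 - σ_i) t = δ_i t for all i
form a Lie subcoalgebra (`relKer_isLieSubcoalgebra`), hence lie in UᶜL; only this inclusion is
needed. So s may be sought as a sum of maps a_n : L → L^{⊗(n+1)} with a_0 the inclusion of letters
and (1 - σ_i) a_{n+1} = δ_i a_n. Once a_n satisfies its own equation, antisymmetry and co-Jacobi say
that the elements δ_i a_n are the values of a 1-cocycle of the symmetric group on adjacent
transpositions. In characteristic zero such a cocycle is a coboundary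
(`IsCoxeterFamily.exists_sub_eq`), which yields a_{n+1} (`exists_next`).

An arbitrary solution would satisfy none of the remaining requirements, so the equation is solved
inside `combSpan`, the space spanned by the permutations of an iterated cobracket. The cobrackets
δ_i carry each of these spaces into the next (`cobr_comp_mem`). All their members are chain maps,
vanish on the appropriate step of the coradical filtration, and are comodule morphisms for the
coadjoint coaction on words (`coadj_comp`). The vanishing and conilpotence make the sum of the a_n
locally finite and filtered.

It remains to compare two coactions on words. The map (p ⊗ 1)(Δ - τΔ) is the identity minus the
rotation of the last letter to the front; this telescopes into the differences 1 - σ_i, and where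
these equal δ_i the result is the coadjoint coaction (`projCocomm_of_mem_relKer`). -/

noncomputable section

open scoped TensorProduct DirectSum

namespace DGPBW

universe u v w

namespace TensorCoalgebra

open TensorAlgebra (ι)

/-! ### Operators on words: lengths, exchanges of adjacent letters, Coxeter relations -/

section Operators

variable {K : Type u} [Field K] {L : Type v} [AddCommGroup L] [Module K L]
variable {N : Type w} [AddCommGroup N] [Module K N]

/-- Two linear maps out of the tensor space agree when they agree on the unit and on all words
whose first letter is homogeneous. -/
theorem ext_letter (M : DGModule K L) {f g : TensorAlgebra K L →ₗ[K] N} (one : f 1 = g 1)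
    (cons : ∀ i, ∀ x ∈ M.gr i, f ∘ₗ LinearMap.mulLeft K (ι K x) = g ∘ₗ LinearMap.mulLeft K (ι K x)) :
    f = g := by
  refine linear_ext one fun x t _ => ?_
  induction x using M.hom_induction with
  | zero => simp
  | add x y hx hy => simp only [map_add, add_mul, hx, hy]
  | mem i x hx => exact LinearMap.congr_fun (cons i x hx) t

theorem ext_letter' {f g : TensorAlgebra K L →ₗ[K] N} (one : f 1 = g 1)
    (cons : ∀ x t, f (ι K x * t) = g (ι K x * t)) : f = g :=
  linear_ext one fun x t _ => cons x t

/-- Prepending a letter to a word. -/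
def cons : L ⊗[K] TensorAlgebra K L →ₗ[K] TensorAlgebra K L :=
  LinearMap.mul' K _ ∘ₗ (ι K).rTensor _

@[simp] theorem cons_tmul (x : L) (t : TensorAlgebra K L) : cons (x ⊗ₜ[K] t) = ι K x * t := by
  simp [cons]

/-- Splitting off the first letter of a word. -/
def uncons : TensorAlgebra K L →ₗ[K] L ⊗[K] TensorAlgebra K L :=
  leftRec
    { toFun := fun x => TensorProduct.mk K _ _ x ∘ₗ LinearMap.fst K _ _
      map_add' := fun x y => by ext <;> simp
      map_smul' := fun c x => by ext <;> simp [TensorProduct.smul_tmul'] }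

@[simp] theorem uncons_one : uncons (1 : TensorAlgebra K L) = 0 := leftRec_one _

@[simp] theorem uncons_ι_mul (x : L) (t : TensorAlgebra K L) :
    uncons (ι K x * t) = x ⊗ₜ[K] t := by
  rw [uncons, leftRec_ι_mul]; rfl

@[simp] theorem uncons_ι (x : L) : uncons (ι K x) = x ⊗ₜ[K] (1 : TensorAlgebra K L) := by
  simpa using uncons_ι_mul x (1 : TensorAlgebra K L)

theorem uncons_cons (w : L ⊗[K] TensorAlgebra K L) : uncons (cons w) = w := by
  induction w using TensorProduct.induction_on with
  | zero => simp
  | add a b ha hb => simp only [map_add, ha, hb]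
  | tmul x t => simp

theorem cons_injective : Function.Injective (cons : L ⊗[K] TensorAlgebra K L →ₗ[K] _) :=
  Function.LeftInverse.injective uncons_cons

/-- The operator `x ⊗ t ↦ x ⊗ f t` on the tensor space, which vanishes on the unit. -/
def tail : Module.End K (TensorAlgebra K L) →ₗ[K] Module.End K (TensorAlgebra K L) where
  toFun f := cons ∘ₗ f.lTensor L ∘ₗ uncons
  map_add' f g := by simp [LinearMap.lTensor_add, LinearMap.comp_add, LinearMap.add_comp]
  map_smul' c f := by simp [LinearMap.lTensor_smul, LinearMap.comp_smul, LinearMap.smul_comp]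

@[simp] theorem tail_one (f : Module.End K (TensorAlgebra K L)) : tail f 1 = 0 := by
  simp [tail]

@[simp] theorem tail_ι_mul (f : Module.End K (TensorAlgebra K L)) (x : L) (t : TensorAlgebra K L) :
    tail f (ι K x * t) = ι K x * f t := by
  simp [tail]

@[simp] theorem tail_ι (f : Module.End K (TensorAlgebra K L)) (x : L) :
    tail f (ι K x) = ι K x * f 1 := by
  simpa using tail_ι_mul f x 1

theorem tail_cons (f : Module.End K (TensorAlgebra K L)) (w : L ⊗[K] TensorAlgebra K L) :
    tail f (cons w) = cons (f.lTensor L w) := by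
  simp [tail, uncons_cons]

theorem tail_mul (f g : Module.End K (TensorAlgebra K L)) : tail (f * g) = tail f * tail g :=
  ext_letter' (by simp) (by simp)

/-- The projection onto the words with at least `k` letters. -/
def lenGE (k : ℕ) : Module.End K (TensorAlgebra K L) := tail^[k] 1

@[simp] theorem lenGE_zero : lenGE 0 = (1 : Module.End K (TensorAlgebra K L)) := rfl

theorem lenGE_succ (k : ℕ) :
    lenGE (k + 1) = tail (lenGE k : Module.End K (TensorAlgebra K L)) :=
  Function.iterate_succ_apply' _ _ _

@[simp] theorem lenGE_succ_one (k : ℕ) : lenGE (k + 1) (1 : TensorAlgebra K L) = 0 := by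
  simp [lenGE_succ]

@[simp] theorem lenGE_succ_ι_mul (k : ℕ) (x : L) (t : TensorAlgebra K L) :
    lenGE (k + 1) (ι K x * t) = ι K x * lenGE k t := by
  simp [lenGE_succ]

@[simp] theorem lenGE_succ_succ_ι (k : ℕ) (x : L) : lenGE (k + 1 + 1) (ι K x) = 0 := by
  simpa using lenGE_succ_ι_mul (k + 1) x 1

@[simp] theorem lenGE_one_ι (x : L) : lenGE (0 + 1) (ι K x) = ι K x := by
  simpa using lenGE_succ_ι_mul 0 x 1

theorem lenGE_one : (lenGE 1 : Module.End K (TensorAlgebra K L)) = pos :=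
  ext_letter' (by simp [pos_one, lenGE_succ]) (by simp [pos_ι_mul, lenGE_succ])

theorem lenGE_mul_lenGE {j k : ℕ} (h : j ≤ k) :
    lenGE j * lenGE k = (lenGE k : Module.End K (TensorAlgebra K L)) := by
  induction j generalizing k with
  | zero => simp
  | succ j ih =>
    obtain ⟨k, rfl⟩ := Nat.exists_eq_add_of_le' (show 1 ≤ k by omega)
    rw [lenGE_succ, lenGE_succ, ← tail_mul, ih (by omega)]

theorem lenGE_mul_lenGE' {j k : ℕ} (h : j ≤ k) :
    lenGE k * lenGE j = (lenGE k : Module.End K (TensorAlgebra K L)) := by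
  induction j generalizing k with
  | zero => simp
  | succ j ih =>
    obtain ⟨k, rfl⟩ := Nat.exists_eq_add_of_le' (show 1 ≤ k by omega)
    rw [lenGE_succ, lenGE_succ, ← tail_mul, ih (by omega)]

/-- Elements of the tensor space involve finitely many lengths; this is where descending inductions
on the length can start. -/
theorem exists_lenGE_eq_zero (t : TensorAlgebra K L) :
    ∃ k, ∀ l, k ≤ l → lenGE l t = 0 := by
  induction t using induction_left with
  | one =>
    refine ⟨1, fun l hl => ?_⟩
    obtain ⟨l, rfl⟩ := Nat.exists_eq_add_of_le' hl
    simp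
  | add s t hs ht =>
    obtain ⟨k, hk⟩ := hs
    obtain ⟨l, hl⟩ := ht
    exact ⟨max k l, fun m hm => by
      rw [map_add, hk m (by omega), hl m (by omega), add_zero]⟩
  | smul c t ht =>
    obtain ⟨k, hk⟩ := ht
    exact ⟨k, fun m hm => by rw [map_smul, hk m hm, smul_zero]⟩
  | ι_mul x t ht =>
    obtain ⟨k, hk⟩ := ht
    refine ⟨k + 1, fun l hl => ?_⟩
    obtain ⟨l, rfl⟩ := Nat.exists_eq_add_of_le' (show 1 ≤ l by omega)
    simp [hk l (by omega)]

/-- The two-letter word of a tensor. -/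
def pair : L ⊗[K] L →ₗ[K] TensorAlgebra K L :=
  LinearMap.mul' K _ ∘ₗ TensorProduct.map (ι K) (ι K)

@[simp] theorem pair_tmul (x y : L) : pair (x ⊗ₜ[K] y) = ι K x * ι K y := by
  simp [pair]

/-- Applying a linear map `L ⊗ L → L ⊗ L` to the first two letters of a word. -/
def headTwo (φ : L ⊗[K] L →ₗ[K] L ⊗[K] L) : Module.End K (TensorAlgebra K L) :=
  LinearMap.mul' K _ ∘ₗ (pair ∘ₗ φ).rTensor _ ∘ₗ (TensorProduct.assoc K L L _).symm.toLinearMap ∘ₗ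
    uncons.lTensor L ∘ₗ uncons

@[simp] theorem headTwo_one (φ : L ⊗[K] L →ₗ[K] L ⊗[K] L) : headTwo φ 1 = 0 := by simp [headTwo]

@[simp] theorem headTwo_ι (φ : L ⊗[K] L →ₗ[K] L ⊗[K] L) (x : L) : headTwo φ (ι K x) = 0 := by
  simp [headTwo]

@[simp] theorem headTwo_ι_mul_ι_mul (φ : L ⊗[K] L →ₗ[K] L ⊗[K] L) (x y : L)
    (t : TensorAlgebra K L) : headTwo φ (ι K x * (ι K y * t)) = pair (φ (x ⊗ₜ y)) * t := by
  simp [headTwo]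

@[simp] theorem headTwo_pair_mul (φ : L ⊗[K] L →ₗ[K] L ⊗[K] L) (w : L ⊗[K] L)
    (t : TensorAlgebra K L) : headTwo φ (pair w * t) = pair (φ w) * t := by
  induction w using TensorProduct.induction_on with
  | zero => simp
  | add a b ha hb => simp only [map_add, add_mul, ha, hb]
  | tmul x y => rw [pair_tmul, mul_assoc, headTwo_ι_mul_ι_mul]

/-- The difference of the identity and the Koszul signed exchange of the letters at the positions
`i` and `i + 1`. -/
def exchDiff (M : DGModule K L) (i : ℕ) : Module.End K (TensorAlgebra K L) :=
  tail^[i] (headTwo (LinearMap.id - M.swap M))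

theorem exchDiff_succ (M : DGModule K L) (i : ℕ) : exchDiff M (i + 1) = tail (exchDiff M i) :=
  Function.iterate_succ_apply' _ _ _

/-- The Koszul signed exchange of the letters at the positions `i` and `i + 1`, where the first
position is `0`. -/
def exch (M : DGModule K L) (i : ℕ) : Module.End K (TensorAlgebra K L) := 1 - exchDiff M i

@[simp] theorem exch_one (M : DGModule K L) (i : ℕ) : exch M i 1 = 1 := by
  cases i <;> simp [exch, exchDiff_succ]
  simp [exchDiff]

@[simp] theorem exch_ι (M : DGModule K L) (i : ℕ) (x : L) : exch M i (ι K x) = ι K x := by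
  cases i with
  | zero => simp [exch, exchDiff]
  | succ i =>
    have h := exch_one M i
    simp only [exch, LinearMap.sub_apply, Module.End.one_apply, sub_eq_self] at h
    simp [exch, exchDiff_succ, h]

theorem exch_zero_pair_mul (M : DGModule K L) (w : L ⊗[K] L) (t : TensorAlgebra K L) :
    exch M 0 (pair w * t) = pair (M.swap M w) * t := by
  simp [exch, exchDiff, sub_mul]

theorem exch_zero_ι_mul_ι_mul (M : DGModule K L) {i j : ℤ} {x y : L} (hx : x ∈ M.gr i)
    (hy : y ∈ M.gr j) (t : TensorAlgebra K L) :
    exch M 0 (ι K x * (ι K y * t)) = ((-1 : K) ^ (i * j)) • (ι K y * (ι K x * t)) := by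
  have h := exch_zero_pair_mul M (x ⊗ₜ y) t
  rw [M.swap_tmul M hx hy, map_smul, pair_tmul, pair_tmul, mul_assoc, smul_mul_assoc,
    mul_assoc] at h
  exact h

@[simp] theorem exch_succ_ι_mul (M : DGModule K L) (i : ℕ) (x : L) (t : TensorAlgebra K L) :
    exch M (i + 1) (ι K x * t) = ι K x * exch M i t := by
  simp [exch, exchDiff_succ, mul_sub]

theorem exch_zero_ι_mul_ι (M : DGModule K L) {i j : ℤ} {x y : L} (hx : x ∈ M.gr i)
    (hy : y ∈ M.gr j) :
    exch M 0 (ι K x * ι K y) = ((-1 : K) ^ (i * j)) • (ι K y * ι K x) := by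
  simpa using exch_zero_ι_mul_ι_mul M hx hy 1

theorem exch_succ_cons (M : DGModule K L) (i : ℕ) (w : L ⊗[K] TensorAlgebra K L) :
    exch M (i + 1) (cons w) = cons ((exch M i).lTensor L w) := by
  simp [exch, exchDiff_succ, tail_cons, LinearMap.lTensor_sub, Module.End.one_eq_id]

theorem exch_succ_mul_tail (M : DGModule K L) (i : ℕ) (f : Module.End K (TensorAlgebra K L)) :
    exch M (i + 1) * tail f = tail (exch M i * f) :=
  ext_letter' (by simp) (by simp)

theorem tail_mul_exch_succ (M : DGModule K L) (i : ℕ) (f : Module.End K (TensorAlgebra K L)) :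
    tail f * exch M (i + 1) = tail (f * exch M i) :=
  ext_letter' (by simp) (by simp)

theorem neg_one_zpow_mul_self (n : ℤ) : ((-1 : K) ^ n) * (-1 : K) ^ n = 1 := by
  rw [← zpow_add₀ (by simp), Even.neg_one_zpow ⟨n, rfl⟩]

theorem exch_mul_self (M : DGModule K L) (i : ℕ) : exch M i * exch M i = 1 := by
  induction i with
  | zero =>
    refine ext_letter M (by simp) fun i x hx => ext_letter M (by simp) fun j y hy => ?_
    ext1 t
    simp [exch_zero_ι_mul_ι_mul M hx hy, exch_zero_ι_mul_ι_mul M hy hx, smul_smul, mul_comm j i,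
      neg_one_zpow_mul_self]
  | succ i ih =>
    refine ext_letter' (by simp) fun x t => ?_
    have h := LinearMap.congr_fun ih t
    simp only [Module.End.mul_apply, Module.End.one_apply] at h
    simp [h]

/-- `tail (tail f)` leaves the first two letters alone. No sign appears, whatever the degree of f,
because `tail` itself introduces none. -/
theorem exch_zero_mul_tail_tail (M : DGModule K L) (f : Module.End K (TensorAlgebra K L)) :
    exch M 0 * tail (tail f) = tail (tail f) * exch M 0 := by
  refine ext_letter M (by simp) fun i x hx => ext_letter M (by simp) fun j y hy => ?_
  ext1 t
  simp [exch_zero_ι_mul_ι_mul M hx hy]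

theorem exch_comm (M : DGModule K L) {i j : ℕ} (h : i + 2 ≤ j) :
    exch M i * exch M j = exch M j * exch M i := by
  induction i generalizing j with
  | zero =>
    obtain ⟨j, rfl⟩ := Nat.exists_eq_add_of_le' h
    have := exch_zero_mul_tail_tail M (exchDiff M j)
    rw [exch.eq_1 M (j + (0 + 2)), exchDiff_succ, exchDiff_succ, mul_sub, sub_mul, this]
    simp
  | succ i ih =>
    obtain ⟨j, rfl⟩ := Nat.exists_eq_add_of_le' (show 1 ≤ j by omega)
    refine ext_letter' (by simp) fun x t => ?_
    have h := LinearMap.congr_fun (ih (j := j) (by omega)) t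
    simp only [Module.End.mul_apply] at h
    simp [h]

/-- The projection `lenGE (i + 3)` cannot be dropped: on words with exactly i + 2 letters `exch M (i
+ 1)` is the identity, and the relation would force `exch M i` to be the identity as well. -/
theorem exch_braid (M : DGModule K L) (i : ℕ) :
    exch M i * exch M (i + 1) * exch M i * lenGE (i + 3) =
      exch M (i + 1) * exch M i * exch M (i + 1) * lenGE (i + 3) := by
  induction i with
  | zero =>
    refine ext_letter M (by simp) fun i x hx => ext_letter M (by simp) fun j y hy =>
      ext_letter M (by simp) fun k z hz => ?_
    ext1 t
    simp [exch_zero_ι_mul_ι_mul M hx hy, exch_zero_ι_mul_ι_mul M hx hz,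
      exch_zero_ι_mul_ι_mul M hy hz, smul_smul]
    congr 1
    ring
  | succ i ih =>
    refine ext_letter' (by simp) fun x t => ?_
    have h := LinearMap.congr_fun ih t
    simp only [Module.End.mul_apply] at h
    simp [h]

theorem lenGE_mul_exch (M : DGModule K L) (k i : ℕ) :
    lenGE k * exch M i = exch M i * lenGE k := by
  induction i generalizing k with
  | zero =>
    match k with
    | 0 => simp
    | 1 =>
      refine ext_letter M (by simp [lenGE_succ]) fun i x hx =>
        ext_letter M (by simp [lenGE_succ]) fun j y hy => ?_
      ext1 t
      simp [lenGE_succ, exch_zero_ι_mul_ι_mul M hx hy]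
    | k + 2 => rw [lenGE_succ, lenGE_succ, exch_zero_mul_tail_tail]
  | succ i ih =>
    cases k with
    | zero => simp
    | succ k => rw [lenGE_succ, exch_succ_mul_tail, tail_mul_exch_succ, ih]

@[simp] theorem exchDiff_one (M : DGModule K L) (i : ℕ) : exchDiff M i 1 = 0 := by
  cases i with
  | zero => simp [exchDiff]
  | succ i => simp [exchDiff_succ]

@[simp] theorem exchDiff_ι (M : DGModule K L) (i : ℕ) (x : L) : exchDiff M i (ι K x) = 0 := by
  cases i with
  | zero => simp [exchDiff]
  | succ i => simp [exchDiff_succ]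

/-- An exchange that finds too few letters acts as the identity, so its difference from the identity
only sees words reaching position i + 1. -/
theorem exchDiff_mul_lenGE (M : DGModule K L) (i : ℕ) :
    exchDiff M i * lenGE (i + 2) = exchDiff M i := by
  induction i with
  | zero =>
    refine ext_letter M (by simp) fun i x hx => ext_letter M ?_ fun j y hy => ?_
    · simp
    · ext1 t
      simp [lenGE_succ]
  | succ i ih => rw [exchDiff_succ, lenGE_succ, ← tail_mul, ih]

end Operators

/-! ### The cobracket on the letters of a word and the co-Jacobi identity -/

section Cobracket

variable {K : Type u} [Field K] {L : Type v} [AddCommGroup L] [Module K L]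

/-- The cobracket applied to the letter at the position `i` of a word. -/
def cobr (L' : DGLieCoalgebra K L) (i : ℕ) : Module.End K (TensorAlgebra K L) :=
  tail^[i] (LinearMap.mul' K _ ∘ₗ (pair ∘ₗ L'.cobracket).rTensor _ ∘ₗ uncons)

theorem cobr_succ (L' : DGLieCoalgebra K L) (i : ℕ) : cobr L' (i + 1) = tail (cobr L' i) :=
  Function.iterate_succ_apply' _ _ _

@[simp] theorem cobr_one (L' : DGLieCoalgebra K L) (i : ℕ) : cobr L' i 1 = 0 := by
  cases i with
  | zero => simp [cobr]
  | succ i => simp [cobr_succ]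

@[simp] theorem cobr_zero_ι_mul (L' : DGLieCoalgebra K L) (x : L) (t : TensorAlgebra K L) :
    cobr L' 0 (ι K x * t) = pair (L'.cobracket x) * t := by
  simp [cobr]

@[simp] theorem cobr_zero_ι (L' : DGLieCoalgebra K L) (x : L) :
    cobr L' 0 (ι K x) = pair (L'.cobracket x) := by
  simpa using cobr_zero_ι_mul L' x 1

@[simp] theorem cobr_succ_ι_mul (L' : DGLieCoalgebra K L) (i : ℕ) (x : L) (t : TensorAlgebra K L) :
    cobr L' (i + 1) (ι K x * t) = ι K x * cobr L' i t := by
  simp [cobr_succ]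

@[simp] theorem cobr_succ_ι (L' : DGLieCoalgebra K L) (i : ℕ) (x : L) :
    cobr L' (i + 1) (ι K x) = 0 := by
  simpa using cobr_succ_ι_mul L' i x 1

theorem cobr_mul_lenGE (L' : DGLieCoalgebra K L) (i : ℕ) :
    cobr L' i * lenGE (i + 1) = cobr L' i := by
  induction i with
  | zero => exact ext_letter' (by simp) (by simp)
  | succ i ih => rw [cobr_succ, lenGE_succ, ← tail_mul, ih]

theorem tail_pair_mul (f : Module.End K (TensorAlgebra K L)) (w : L ⊗[K] L)
    (t : TensorAlgebra K L) : tail (tail f) (pair w * t) = pair w * f t := by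
  induction w using TensorProduct.induction_on with
  | zero => simp
  | add a b ha hb => simp only [map_add, add_mul, ha, hb]
  | tmul x y => simp [mul_assoc]

/-- The cobracket replaces one letter by two, so whatever happens behind the first letter is pushed
back by one position. -/
theorem cobr_zero_mul_tail (L' : DGLieCoalgebra K L) (f : Module.End K (TensorAlgebra K L)) :
    cobr L' 0 * tail f = tail (tail f) * cobr L' 0 :=
  ext_letter' (by simp) fun x t => by simp [tail_pair_mul]

theorem exch_mul_cobr_self (L' : DGLieCoalgebra K L) (i : ℕ) :
    exch L'.toDGModule i * cobr L' i = - cobr L' i := by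
  induction i with
  | zero =>
    exact ext_letter' (by simp) fun x t => by simp [exch_zero_pair_mul, L'.antisymm]
  | succ i ih => rw [cobr_succ, exch_succ_mul_tail, ih, map_neg]

theorem cobr_mul_cobr (L' : DGLieCoalgebra K L) {i j : ℕ} (h : i < j) :
    cobr L' i * cobr L' j = cobr L' (j + 1) * cobr L' i := by
  induction i generalizing j with
  | zero =>
    obtain ⟨j, rfl⟩ := Nat.exists_eq_add_of_le' (show 1 ≤ j by omega)
    rw [cobr_succ _ (j + 1), cobr_succ _ j, cobr_zero_mul_tail]
  | succ i ih =>
    obtain ⟨j, rfl⟩ := Nat.exists_eq_add_of_le' (show 1 ≤ j by omega)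
    rw [cobr_succ, cobr_succ, ← tail_mul, ih (by omega), cobr_succ _ (j + 1), tail_mul]

theorem exch_mul_cobr_of_lt (L' : DGLieCoalgebra K L) {i j : ℕ} (h : i + 1 < j) :
    exch L'.toDGModule i * cobr L' j = cobr L' j * exch L'.toDGModule i := by
  induction i generalizing j with
  | zero =>
    obtain ⟨j, rfl⟩ := Nat.exists_eq_add_of_le' (show 2 ≤ j by omega)
    rw [cobr_succ, cobr_succ, exch_zero_mul_tail_tail]
  | succ i ih =>
    obtain ⟨j, rfl⟩ := Nat.exists_eq_add_of_le' (show 1 ≤ j by omega)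
    rw [cobr_succ, exch_succ_mul_tail, tail_mul_exch_succ, ih (by omega)]

theorem cobr_mul_exch_of_lt (L' : DGLieCoalgebra K L) {i j : ℕ} (h : i < j) :
    cobr L' i * exch L'.toDGModule j = exch L'.toDGModule (j + 1) * cobr L' i := by
  induction i generalizing j with
  | zero =>
    obtain ⟨j, rfl⟩ := Nat.exists_eq_add_of_le' (show 1 ≤ j by omega)
    rw [exch.eq_1 _ (j + 1), exch.eq_1 _ (j + 1 + 1), exchDiff_succ _ (j + 1), exchDiff_succ,
      mul_sub, sub_mul, cobr_zero_mul_tail]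
    simp
  | succ i ih =>
    obtain ⟨j, rfl⟩ := Nat.exists_eq_add_of_le' (show 1 ≤ j by omega)
    rw [cobr_succ, tail_mul_exch_succ, exch_succ_mul_tail, ih (by omega)]

/-- A letter moved past a two-letter block picks up the Koszul sign of the total degree of the
block. Applied to a cobracket, which preserves degrees, this gives the naturality of exchanges with
respect to δ. -/
theorem exch_one_exch_zero_ι_mul_pair_mul (M : DGModule K L) {i j : ℤ} {x : L} (hx : x ∈ M.gr i)
    {w : L ⊗[K] L} (hw : w ∈ M.tensorGr M j) (t : TensorAlgebra K L) :
    exch M (0 + 1) (exch M 0 (ι K x * (pair w * t))) =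
      ((-1 : K) ^ (i * j)) • (pair w * (ι K x * t)) := by
  induction hw using Submodule.span_induction with
  | mem w hw =>
    obtain ⟨k, l, rfl, y, hy, z, hz, rfl⟩ := hw
    simp [mul_assoc, exch_zero_ι_mul_ι_mul M hx hy, exch_zero_ι_mul_ι_mul M hx hz, smul_smul,
      mul_add, zpow_add₀]
  | zero => simp
  | add a b _ _ ha hb => simp only [map_add, mul_add, add_mul, ha, hb, smul_add]
  | smul c a _ ha => simp only [map_smul, mul_smul_comm, smul_mul_assoc, ha, smul_comm c]

theorem lenGE_mul_cobr (L' : DGLieCoalgebra K L) (i : ℕ) :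
    lenGE (i + 2) * cobr L' i = cobr L' i := by
  induction i with
  | zero => exact ext_letter' (by simp) fun x t => by simp [lenGE_succ, tail_pair_mul]
  | succ i ih => rw [cobr_succ, lenGE_succ, ← tail_mul, ih]

/-- Naturality of the symmetry: splitting the letter that was moved forward is the same as splitting
it in place and moving both halves forward. On words with only i + 1 letters there is nothing to
exchange and the right side vanishes while the left need not, hence the projection. -/
theorem cobr_mul_exch_self (L' : DGLieCoalgebra K L) (i : ℕ) :
    cobr L' i * exch L'.toDGModule i * lenGE (i + 2) =
      exch L'.toDGModule (i + 1) * exch L'.toDGModule i * cobr L' (i + 1) := by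
  induction i with
  | zero =>
    refine ext_letter L'.toDGModule (by simp) fun i x hx =>
      ext_letter L'.toDGModule (by simp) fun j y hy => ?_
    ext1 t
    have h := exch_one_exch_zero_ι_mul_pair_mul L'.toDGModule hx (L'.cobracket_mem j y hy) t
    simp only [LinearMap.comp_apply, LinearMap.mulLeft_apply, Module.End.mul_apply,
      cobr_succ_ι_mul, cobr_zero_ι_mul, exch_zero_ι_mul_ι_mul _ hx hy, map_smul, h,
      lenGE_succ_ι_mul, lenGE_zero, Module.End.one_apply]
  | succ i ih =>
    rw [cobr_succ, tail_mul_exch_succ, lenGE_succ, ← tail_mul, ih, cobr_succ _ (i + 1), mul_assoc,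
      mul_assoc, exch_succ_mul_tail, exch_succ_mul_tail]

/-- The mirror image of `cobr_mul_exch_self`, deduced from it because exchanges are involutions. -/
theorem cobr_succ_mul_exch (L' : DGLieCoalgebra K L) (i : ℕ) :
    cobr L' (i + 1) * exch L'.toDGModule i =
      exch L'.toDGModule i * exch L'.toDGModule (i + 1) * cobr L' i * lenGE (i + 2) := by
  have h1 := exch_mul_self L'.toDGModule i
  have h2 := exch_mul_self L'.toDGModule (i + 1)
  have h : cobr L' i * lenGE (i + 2) =
      exch L'.toDGModule (i + 1) * exch L'.toDGModule i * cobr L' (i + 1) *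
        exch L'.toDGModule i := by
    rw [← cobr_mul_exch_self, mul_assoc _ (lenGE (i + 2)), lenGE_mul_exch, ← mul_assoc, mul_assoc _ _
      (exch L'.toDGModule i), h1, mul_one]
  have h3 : exch L'.toDGModule i * exch L'.toDGModule (i + 1) *
      (exch L'.toDGModule (i + 1) * exch L'.toDGModule i) = 1 := by
    rw [mul_assoc, ← mul_assoc _ _ (exch L'.toDGModule i), h2, one_mul, h1]
  rw [mul_assoc _ (cobr L' i), h, ← mul_assoc, ← mul_assoc, h3, one_mul]

/-- The co-Jacobi axiom read on words: the cyclic permutation of three tensor factors is σ_0 σ_1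
acting on the first three letters. -/
theorem cobracket_mul_cyc (L' : DGLieCoalgebra K L) :
    cobr L' 0 * cobr L' 0 +
      exch L'.toDGModule 0 * exch L'.toDGModule 1 * (cobr L' 0 * cobr L' 0) +
      exch L'.toDGModule 0 * exch L'.toDGModule 1 * (exch L'.toDGModule 0 * exch L'.toDGModule 1 *
        (cobr L' 0 * cobr L' 0)) = 0 := by
  let triple : (L ⊗[K] L) ⊗[K] L →ₗ[K] TensorAlgebra K L :=
    LinearMap.mul' K _ ∘ₗ TensorProduct.map pair (ι K)
  have h1 : ∀ x t, cobr L' 0 (cobr L' 0 (ι K x * t)) =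
      triple (L'.cobracket.rTensor L (L'.cobracket x)) * t := by
    intro x t
    rw [cobr_zero_ι_mul]
    induction L'.cobracket x using TensorProduct.induction_on with
    | zero => simp
    | add a b ha hb => simp only [map_add, add_mul, ha, hb]
    | tmul x y => simp [mul_assoc, triple]
  have h2 : ∀ w t, exch L'.toDGModule 0 (exch L'.toDGModule 1 (triple w * t)) =
      triple (L'.cyc w) * t := by
    intro w t
    have aux : ∀ u z t, exch L'.toDGModule 0
        (triple ((TensorProduct.assoc K L L L).symm (z ⊗ₜ[K] u)) * t) =
        triple ((L'.swap L'.toDGModule).rTensor L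
          ((TensorProduct.assoc K L L L).symm (z ⊗ₜ[K] u))) * t := by
      intro u z t
      induction u using TensorProduct.induction_on with
      | zero => simp
      | add a b ha hb => simp only [TensorProduct.tmul_add, map_add, add_mul, ha, hb]
      | tmul x y =>
        have := exch_zero_pair_mul L'.toDGModule (z ⊗ₜ x) (ι K y * t)
        simpa [triple, mul_assoc] using this
    have aux' : ∀ z u t, ι K z * (pair u * t) =
        triple ((TensorProduct.assoc K L L L).symm (z ⊗ₜ[K] u)) * t := by
      intro z u t
      induction u using TensorProduct.induction_on with
      | zero => simp
      | add a b ha hb => simp only [TensorProduct.tmul_add, map_add, mul_add, add_mul, ha, hb]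
      | tmul x y => simp [triple, mul_assoc]
    induction w using TensorProduct.induction_on with
    | zero => simp
    | add a b ha hb => simp only [map_add, add_mul, ha, hb]
    | tmul u z =>
      induction u using TensorProduct.induction_on with
      | zero => simp
      | add a b ha hb => simp only [map_add, TensorProduct.add_tmul, add_mul, ha, hb]
      | tmul x y =>
        have h : triple ((x ⊗ₜ[K] y) ⊗ₜ[K] z) * t = ι K x * (pair (y ⊗ₜ z) * t) := by
          simp [triple, mul_assoc]
        rw [h, ← zero_add 1, exch_succ_ι_mul, exch_zero_pair_mul, aux', aux]
        simp [DGModule.cyc]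
  refine ext_letter' (by simp) fun x t => ?_
  simp only [LinearMap.add_apply, Module.End.mul_apply, h1, h2, ← add_mul, ← map_add, L'.cojacobi]
  simp

/-- Here a, b, d, e stand for σ_0, σ_1, δ_0, δ_1. Antisymmetry turns e d into -a b d², and with the
braid relation it turns the second cyclic rotation of d² into -b d². Substituting both in the cyclic
identity gives the Leibniz form, in which co-Jacobi enters the cocycle condition. -/
theorem jacobi_of_cyclic {R : Type*} [Ring R] {a b d e : R} (ha : a * a = 1)
    (hab : a * b * a * (d * d) = b * a * b * (d * d)) (had : a * d = - d) (he : e * a * d = a * b * (d * d))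
    (h : d * d + a * b * (d * d) + a * b * (a * b * (d * d)) = 0) :
    d * d = (1 - a) * (e * d) := by
  have h1 : e * d = - (a * b * (d * d)) := by rw [← he, mul_assoc, had, mul_neg, neg_neg]
  have h2 : a * b * (a * b * (d * d)) = - (b * (d * d)) := by
    have had' : a * (d * d) = - (d * d) := by rw [← mul_assoc, had, neg_mul]
    calc a * b * (a * b * (d * d)) = a * (b * a * b * (d * d)) := by simp only [mul_assoc]
      _ = a * a * (b * (a * (d * d))) := by rw [← hab]; simp only [mul_assoc]
      _ = _ := by rw [ha, one_mul, had', mul_neg]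
  have h3 : a * (a * b * (d * d)) = b * (d * d) := by
    rw [← mul_assoc, ← mul_assoc a a b, ha, one_mul]
  rw [h2] at h
  rw [h1, sub_mul, one_mul, mul_neg, h3, ← sub_eq_zero, ← h]
  abel

/-- The co-Jacobi identity in the form `(δ ⊗ 1) δ = (1 - τ) (1 ⊗ δ) δ`, where `τ` exchanges the
first two letters. -/
theorem cobr_zero_mul_cobr_zero (L' : DGLieCoalgebra K L) :
    cobr L' 0 * cobr L' 0 = (1 - exch L'.toDGModule 0) * (cobr L' 1 * cobr L' 0) := by
  -- Two cobrackets leave at least three letters, so the braid relation is available on their image.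
  have h3 : lenGE (0 + 3) * (cobr L' 0 * cobr L' 0) = cobr L' 0 * cobr L' 0 := by
    rw [lenGE_succ, lenGE_succ, ← mul_assoc, ← cobr_zero_mul_tail, mul_assoc, ← lenGE_succ,
      lenGE_mul_cobr]
  refine jacobi_of_cyclic (exch_mul_self _ 0) ?_ (exch_mul_cobr_self L' 0) ?_
    (cobracket_mul_cyc L')
  · rw [← h3, ← mul_assoc, exch_braid, mul_assoc]
  have h := cobr_succ_mul_exch L' 0
  rw [zero_add] at h
  · rw [h, mul_assoc, mul_assoc, mul_assoc, lenGE_mul_cobr L' 0, mul_assoc]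

theorem cobr_mul_cobr_self (L' : DGLieCoalgebra K L) (i : ℕ) :
    cobr L' i * cobr L' i = (1 - exch L'.toDGModule i) * (cobr L' (i + 1) * cobr L' i) := by
  induction i with
  | zero => exact cobr_zero_mul_cobr_zero L'
  | succ i ih =>
    rw [sub_mul, one_mul, cobr_succ, ← tail_mul, ih, cobr_succ L' (i + 1), ← tail_mul,
      exch_succ_mul_tail, ← map_sub, sub_mul, one_mul]

end Cobracket

end TensorCoalgebra

/-! ### Tensor products of intersections of kernels -/

section Kernels

variable {K : Type u} [Field K] {V : Type v} [AddCommGroup V] [Module K V]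
variable {V' : Type w} [AddCommGroup V'] [Module K V']

/-- Expanding the second factor in a basis of W turns the hypothesis into one on each coefficient in
V. The number of operators plays no role, so infinite families are allowed. -/
theorem mem_range_rTensor_iInf_ker {ι : Type*} {W : Type*} [AddCommGroup W] [Module K W]
    (Q : ι → V →ₗ[K] V') (w : V ⊗[K] W) (h : ∀ i, (Q i).rTensor W w = 0) :
    w ∈ LinearMap.range ((⨅ i, LinearMap.ker (Q i)).subtype.rTensor W) := by
  classical
  let b := Module.Basis.ofVectorSpace K W
  have key : ∀ (i) (w : V ⊗[K] W) (c), TensorProduct.equivFinsuppOfBasisRight b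
      ((Q i).rTensor W w) c = Q i (TensorProduct.equivFinsuppOfBasisRight b w c) := by
    intro i w c
    induction w using TensorProduct.induction_on with
    | zero => simp
    | add x y hx hy => simp only [map_add, Finsupp.add_apply, hx, hy]
    | tmul x y => simp
  have hmem : ∀ c, TensorProduct.equivFinsuppOfBasisRight b w c ∈ ⨅ i, LinearMap.ker (Q i) := by
    intro c
    simp only [Submodule.mem_iInf, LinearMap.mem_ker]
    intro i
    rw [← key, h i]
    simp
  rw [← (TensorProduct.equivFinsuppOfBasisRight b).symm_apply_apply w,
    TensorProduct.equivFinsuppOfBasisRight_symm_apply, Finsupp.sum]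
  exact sum_mem fun c _ => ⟨⟨_, hmem c⟩ ⊗ₜ b c, by simp⟩

/-- This is (U ⊗ V) ∩ (V ⊗ U) = U ⊗ U for a common kernel U: after moving w into U ⊗ V, flatness
lets the second condition be tested there. It reduces statements about subcoalgebras and coradical
filtrations to equations on each tensor factor. -/
theorem mem_range_mapIncl_iInf_ker {ι : Type*} (Q : ι → V →ₗ[K] V') (w : V ⊗[K] V)
    (h1 : ∀ i, (Q i).rTensor V w = 0) (h2 : ∀ i, (Q i).lTensor V w = 0) :
    w ∈ LinearMap.range (TensorProduct.mapIncl (⨅ i, LinearMap.ker (Q i))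
      (⨅ i, LinearMap.ker (Q i))) := by
  set U := ⨅ i, LinearMap.ker (Q i)
  obtain ⟨v, hv⟩ := mem_range_rTensor_iInf_ker Q w h1
  have h3 : ∀ i, (Q i).rTensor U (TensorProduct.comm K U V v) = 0 := by
    intro i
    have inj : Function.Injective (U.subtype.rTensor V') :=
      Module.Flat.rTensor_preserves_injective_linearMap _ U.subtype_injective
    rw [← LinearMap.comm_comp_lTensor_comp_comm_eq]
    simp only [LinearMap.comp_apply, LinearEquiv.coe_coe, TensorProduct.comm_comm]
    rw [LinearEquiv.map_eq_zero_iff]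
    apply inj
    rw [map_zero, ← h2 i, ← hv, ← LinearMap.comp_apply, ← LinearMap.comp_apply,
      LinearMap.rTensor_comp_lTensor, LinearMap.lTensor_comp_rTensor]
  obtain ⟨z, hz⟩ := mem_range_rTensor_iInf_ker Q _ h3
  refine ⟨TensorProduct.comm K U U z, ?_⟩
  have h4 : v = (TensorProduct.comm K V U) (U.subtype.rTensor U z) := by
    rw [hz]; simp
  rw [← hv, h4]
  clear hz h4 hv h2 h3 h1
  induction z using TensorProduct.induction_on with
  | zero => simp
  | add x y hx hy => simp only [map_add, hx, hy]
  | tmul x y => simp [TensorProduct.mapIncl]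

end Kernels

/-! ### Koszul signs and maps preserving degrees -/

namespace DGModule

variable {K : Type u} [Field K]
variable {V : Type v} [AddCommGroup V] [Module K V]
variable {W : Type w} [AddCommGroup W] [Module K W]

theorem map_comp (M : DGModule K V) (N : DGModule K W) {f : V →ₗ[K] W}
    (hf : ∀ n, ∀ x ∈ M.gr n, f x ∈ N.gr n) (n : ℤ) (x : V) : f (M.comp n x) = N.comp n (f x) := by
  induction x using M.hom_induction with
  | zero => simp
  | add x y hx hy => simp only [map_add, hx, hy]
  | mem i x hx =>
    rw [M.comp_of_mem hx, N.comp_of_mem (hf i x hx)]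
    split_ifs <;> simp

theorem map_sgn (M : DGModule K V) (N : DGModule K W) {f : V →ₗ[K] W}
    (hf : ∀ n, ∀ x ∈ M.gr n, f x ∈ N.gr n) (n : ℤ) (x : V) : f (M.sgn n x) = N.sgn n (f x) := by
  induction x using M.hom_induction with
  | zero => simp
  | add x y hx hy => simp only [map_add, hx, hy]
  | mem i x hx => rw [M.sgn_of_mem n hx, N.sgn_of_mem n (hf i x hx), map_smul]

theorem tensor_induction (M : DGModule K V) (N : DGModule K W) {P : V ⊗[K] W → Prop} (zero : P 0)
    (add : ∀ x y, P x → P y → P (x + y))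
    (tmul : ∀ i j, ∀ x ∈ M.gr i, ∀ y ∈ N.gr j, P (x ⊗ₜ y)) (w : V ⊗[K] W) : P w := by
  induction w using TensorProduct.induction_on with
  | zero => exact zero
  | add x y hx hy => exact add x y hx hy
  | tmul x y =>
    induction x using M.hom_induction with
    | zero => simpa using zero
    | add a b ha hb => rw [TensorProduct.add_tmul]; exact add _ _ ha hb
    | mem i x hx =>
      induction y using N.hom_induction with
      | zero => simpa using zero
      | add a b ha hb => rw [TensorProduct.tmul_add]; exact add _ _ ha hb
      | mem j y hy => exact tmul i j x hx y hy

theorem swap_map (M : DGModule K V) (N : DGModule K W) {f : V →ₗ[K] W}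
    (hf : ∀ n, ∀ x ∈ M.gr n, f x ∈ N.gr n) (w : V ⊗[K] V) :
    TensorProduct.map f f (M.swap M w) = N.swap N (TensorProduct.map f f w) := by
  induction w using M.tensor_induction M with
  | zero => simp
  | add x y hx hy => simp only [map_add, hx, hy]
  | tmul i j x hx y hy =>
    rw [swap_tmul _ _ hx hy, map_smul, TensorProduct.map_tmul, TensorProduct.map_tmul,
      swap_tmul _ _ (hf _ x hx) (hf _ y hy)]

theorem swap_mem_tensorGr (M : DGModule K V) {n : ℤ} {w : V ⊗[K] V} (hw : w ∈ M.tensorGr M n) :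
    M.swap M w ∈ M.tensorGr M n := by
  have : M.tensorGr M n ≤ (M.tensorGr M n).comap (M.swap M) := by
    refine Submodule.span_le.2 ?_
    rintro _ ⟨i, j, h, x, hx, y, hy, rfl⟩
    change M.swap M (x ⊗ₜ y) ∈ M.tensorGr M n
    rw [swap_tmul _ _ hx hy]
    exact Submodule.smul_mem _ _ (M.tmul_mem_tensorGr M (by omega) hy hx)
  exact this hw

theorem map_sgn_sgn (M : DGModule K V) (m : ℤ) {n : ℤ} {w : V ⊗[K] V} (hw : w ∈ M.tensorGr M n) :
    TensorProduct.map (M.sgn m) (M.sgn m) w = ((-1 : K) ^ (m * n)) • w := by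
  induction hw using Submodule.span_induction with
  | mem w hw =>
    obtain ⟨i, j, rfl, x, hx, y, hy, rfl⟩ := hw
    simp [M.sgn_of_mem m hx, M.sgn_of_mem m hy, TensorProduct.smul_tmul', TensorProduct.tmul_smul,
      smul_smul, mul_add, zpow_add₀, mul_comm]
  | zero => simp
  | add a b _ _ ha hb => simp only [map_add, smul_add, ha, hb]
  | smul c a _ ha => simp only [map_smul, ha, smul_comm c]

theorem map_sgn_sgn_comm (M : DGModule K V) (m : ℤ) {φ : V ⊗[K] V →ₗ[K] V ⊗[K] V}
    (hφ : ∀ (n : ℤ) (w : V ⊗[K] V), w ∈ M.tensorGr M n → φ w ∈ M.tensorGr M n) (w : V ⊗[K] V) :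
    TensorProduct.map (M.sgn m) (M.sgn m) (φ w) = φ (TensorProduct.map (M.sgn m) (M.sgn m) w) := by
  induction w using M.tensor_induction M with
  | zero => simp
  | add x y hx hy => simp only [map_add, hx, hy]
  | tmul i j x hx y hy =>
    have h := M.tmul_mem_tensorGr M rfl hx hy
    rw [M.map_sgn_sgn m h, M.map_sgn_sgn m (hφ _ _ h), map_smul]

theorem swap_tensorD (M : DGModule K V) (w : V ⊗[K] V) :
    M.swap M (M.tensorD M w) = M.tensorD M (M.swap M w) := by
  induction w using M.tensor_induction M with
  | zero => simp
  | add x y hx hy => simp only [map_add, hx, hy]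
  | tmul i j x hx y hy =>
    have e1 : ((-1 : K) ^ ((i - 1) * j)) = (-1) ^ (i * j) * (-1) ^ (-1 * j) := by
      rw [← zpow_add₀ (by simp)]; congr 1; ring
    have e2 : ((-1 : K) ^ (-1 * i)) * (-1) ^ (i * (j - 1)) = (-1) ^ (i * j) := by
      rw [← zpow_add₀ (by simp), show -1 * i + i * (j - 1) = i * j + (-i) * 2 by ring,
        zpow_add₀ (by simp), Even.neg_one_zpow (n := -i * 2) (by simp), mul_one]
    simp only [tensorD, LinearMap.add_apply, TensorProduct.map_tmul, LinearMap.id_apply, map_add,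
      M.sgn_of_mem _ hx, M.sgn_of_mem _ hy, ← TensorProduct.smul_tmul', map_smul,
      swap_tmul _ _ hx hy, swap_tmul _ _ (M.d_mem i x hx) hy, swap_tmul _ _ hx (M.d_mem j y hy),
      smul_smul, smul_add, e1, e2]
    rw [add_comm]

end DGModule

theorem DGLieCoalgebra.cobracket_sgn {K : Type u} [Field K] {L : Type v} [AddCommGroup L]
    [Module K L] (L' : DGLieCoalgebra K L) (m : ℤ) (x : L) :
    L'.cobracket (L'.sgn m x) = TensorProduct.map (L'.sgn m) (L'.sgn m) (L'.cobracket x) := by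
  induction x using L'.hom_induction with
  | zero => simp
  | add x y hx hy => simp only [map_add, hx, hy]
  | mem i x hx =>
    rw [L'.sgn_of_mem m hx, map_smul, L'.map_sgn_sgn m (L'.cobracket_mem i x hx)]

namespace TensorCoalgebra

open TensorAlgebra (ι)

/-! ### Compatibility of the word operators with degrees and differentials -/

section Graded

variable {K : Type u} [Field K] {L : Type v} [AddCommGroup L] [Module K L]

/-- An operator on the tensor space which preserves degrees and commutes with the differential. -/
structure IsChainEnd (M : DGModule K L) (f : Module.End K (TensorAlgebra K L)) : Prop where
  mem : ∀ (n : ℤ) (t : TensorAlgebra K L), t ∈ wordGr M n → f t ∈ wordGr M n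
  comm : ∀ t, wordD M (f t) = f (wordD M t)

theorem wordD_ι (M : DGModule K L) (x : L) : wordD M (ι K x) = ι K (M.d x) := by
  simpa [wordD_one] using wordD_ι_mul M x 1

theorem IsChainEnd.one (M : DGModule K L) : IsChainEnd M (1 : Module.End K (TensorAlgebra K L)) :=
  ⟨fun _ _ h => h, fun _ => rfl⟩

theorem IsChainEnd.sub {M : DGModule K L} {f g : Module.End K (TensorAlgebra K L)}
    (hf : IsChainEnd M f) (hg : IsChainEnd M g) : IsChainEnd M (f - g) :=
  ⟨fun n t ht => sub_mem (hf.mem n t ht) (hg.mem n t ht), fun t => by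
    simp only [LinearMap.sub_apply, map_sub, hf.comm, hg.comm]⟩

theorem IsChainEnd.tail {M : DGModule K L} {f : Module.End K (TensorAlgebra K L)}
    (hf : IsChainEnd M f) : IsChainEnd M (tail f) := by
  constructor
  · intro n t ht
    refine wordGr_induction M (P := fun n t => TensorCoalgebra.tail f t ∈ wordGr M n)
      ?_ ?_ ?_ ?_ ?_ ht
    · simp
    · simp
    · intro n s t hs ht; rw [map_add]; exact add_mem hs ht
    · intro n c t ht; rw [map_smul]; exact Submodule.smul_mem _ c ht
    · intro i x n t hx ht _
      rw [tail_ι_mul]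
      exact SetLike.GradedMul.mul_mem (ι_mem_wordGr M hx) (hf.mem n t ht)
  · intro t
    refine LinearMap.congr_fun (f := wordD M ∘ₗ TensorCoalgebra.tail f)
      (g := TensorCoalgebra.tail f ∘ₗ wordD M) (ext_letter' ?_ fun x t => ?_) t
    · simp [wordD_one]
    · simp [wordD_ι_mul, hf.comm]

theorem pair_mem (M : DGModule K L) {n : ℤ} {w : L ⊗[K] L} (hw : w ∈ M.tensorGr M n) :
    pair w ∈ wordGr M n := by
  have : M.tensorGr M n ≤ (wordGr M n).comap pair := by
    refine Submodule.span_le.2 ?_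
    rintro _ ⟨i, j, rfl, x, hx, y, hy, rfl⟩
    change pair (x ⊗ₜ y) ∈ wordGr M (i + j)
    rw [pair_tmul]
    exact SetLike.GradedMul.mul_mem (ι_mem_wordGr M hx) (ι_mem_wordGr M hy)
  exact this hw

theorem wordD_pair_mul (M : DGModule K L) (w : L ⊗[K] L) (t : TensorAlgebra K L) :
    wordD M (pair w * t) = pair (M.tensorD M w) * t +
      pair (TensorProduct.map (M.sgn (-1)) (M.sgn (-1)) w) * wordD M t := by
  induction w using TensorProduct.induction_on with
  | zero => simp
  | add a b ha hb => simp only [map_add, add_mul, ha, hb]; abel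
  | tmul x y =>
    simp only [pair_tmul, mul_assoc, wordD_ι_mul, DGModule.tensorD, LinearMap.add_apply,
      TensorProduct.map_tmul, LinearMap.id_apply, map_add, add_mul, mul_add]
    abel

theorem isChainEnd_headTwo (M : DGModule K L) {φ : L ⊗[K] L →ₗ[K] L ⊗[K] L}
    (hφ : ∀ (n : ℤ) (w : L ⊗[K] L), w ∈ M.tensorGr M n → φ w ∈ M.tensorGr M n)
    (hd : ∀ w, M.tensorD M (φ w) = φ (M.tensorD M w)) : IsChainEnd M (headTwo φ) := by
  constructor
  · intro n t ht
    -- The operator looks two letters deep, while the induction removes one letter at a time; so the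
    -- claim is carried along also for the word with one more letter in front.
    refine (wordGr_induction M (P := fun n t => headTwo φ t ∈ wordGr M n ∧
      ∀ i, ∀ x ∈ M.gr i, headTwo φ (ι K x * t) ∈ wordGr M (i + n)) ?_ ?_ ?_ ?_ ?_ ht).1
    · simp
    · simp
    · intro n s t hs ht
      simp only [mul_add, map_add]
      exact ⟨add_mem hs.1 ht.1, fun i x hx => add_mem (hs.2 i x hx) (ht.2 i x hx)⟩
    · intro n c t ht
      simp only [mul_smul_comm, map_smul]
      exact ⟨Submodule.smul_mem _ c ht.1, fun i x hx => Submodule.smul_mem _ c (ht.2 i x hx)⟩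
    · intro j y n t hy ht h
      refine ⟨h.2 j y hy, fun i x hx => ?_⟩
      rw [headTwo_ι_mul_ι_mul, ← add_assoc]
      exact SetLike.GradedMul.mul_mem
        (pair_mem M (hφ _ _ (M.tmul_mem_tensorGr M rfl hx hy))) ht
  · intro t
    refine LinearMap.congr_fun (f := wordD M ∘ₗ headTwo φ) (g := headTwo φ ∘ₗ wordD M)
      (ext_letter M ?_ fun i x _ => ext_letter M ?_ fun j y _ => ?_) t
    · simp [wordD_one]
    · simp [wordD_ι]
    · ext1 t
      have h := wordD_pair_mul M (x ⊗ₜ y) t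
      rw [pair_tmul, mul_assoc] at h
      simp only [LinearMap.comp_apply, LinearMap.mulLeft_apply, headTwo_ι_mul_ι_mul, h, map_add,
        headTwo_pair_mul, wordD_pair_mul, hd, M.map_sgn_sgn_comm (-1) hφ]

theorem isChainEnd_exchDiff (M : DGModule K L) (i : ℕ) : IsChainEnd M (exchDiff M i) := by
  induction i with
  | zero =>
    refine isChainEnd_headTwo M (fun n w hw => sub_mem hw (M.swap_mem_tensorGr hw)) fun w => ?_
    simp only [LinearMap.sub_apply, LinearMap.id_apply, map_sub, M.swap_tensorD]
  | succ i ih => rw [exchDiff_succ]; exact ih.tail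

theorem isChainEnd_exch (M : DGModule K L) (i : ℕ) : IsChainEnd M (exch M i) :=
  (IsChainEnd.one M).sub (isChainEnd_exchDiff M i)

theorem isChainEnd_lenGE (M : DGModule K L) (k : ℕ) : IsChainEnd M (lenGE k) := by
  induction k with
  | zero => exact IsChainEnd.one M
  | succ k ih => rw [lenGE_succ]; exact ih.tail

theorem isChainEnd_cobr (L' : DGLieCoalgebra K L) (i : ℕ) :
    IsChainEnd L'.toDGModule (cobr L' i) := by
  induction i with
  | zero =>
    constructor
    · intro n t ht
      refine wordGr_induction _ (P := fun n t => cobr L' 0 t ∈ wordGr L'.toDGModule n)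
        ?_ ?_ ?_ ?_ ?_ ht
      · simp
      · simp
      · intro n s t hs ht; rw [map_add]; exact add_mem hs ht
      · intro n c t ht; rw [map_smul]; exact Submodule.smul_mem _ c ht
      · intro i x n t hx ht _
        rw [cobr_zero_ι_mul]
        exact SetLike.GradedMul.mul_mem (pair_mem _ (L'.cobracket_mem _ x hx)) ht
    · intro t
      refine LinearMap.congr_fun (f := wordD L'.toDGModule ∘ₗ cobr L' 0)
        (g := cobr L' 0 ∘ₗ wordD L'.toDGModule) (ext_letter' ?_ fun x t => ?_) t
      · simp [wordD_one]
      · simp [wordD_pair_mul, wordD_ι_mul, L'.cobracket_d, L'.cobracket_sgn]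
  | succ i ih => rw [cobr_succ]; exact ih.tail

end Graded

/-! ### The subcoalgebra of words on which exchange differences equal cobrackets -/

section Relations

variable {K : Type u} [Field K] {L : Type v} [AddCommGroup L] [Module K L]

/-- The operators whose common kernel is the universal enveloping coalgebra: the words of positive
length are selected by the first one, and the others compare the exchange of adjacent letters with
the cobracket. -/
def rel (L' : DGLieCoalgebra K L) : ℕ → Module.End K (TensorAlgebra K L)
  | 0 => 1 - lenGE 1
  | i + 1 => exchDiff L'.toDGModule i - cobr L' i

/-- The common kernel of the operators `rel L' i`. -/
def relKer (L' : DGLieCoalgebra K L) : Submodule K (TensorAlgebra K L) :=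
  ⨅ i, LinearMap.ker (rel L' i)

theorem mem_relKer {L' : DGLieCoalgebra K L} {t : TensorAlgebra K L} :
    t ∈ relKer L' ↔ ∀ i, rel L' i t = 0 := by
  simp [relKer]

theorem isChainEnd_rel (L' : DGLieCoalgebra K L) (i : ℕ) :
    IsChainEnd L'.toDGModule (rel L' i) := by
  cases i with
  | zero => exact (IsChainEnd.one _).sub (isChainEnd_lenGE _ 1)
  | succ i => exact (isChainEnd_exchDiff _ i).sub (isChainEnd_cobr _ i)

theorem pos_lTensor_deconc (t : TensorAlgebra K L) :
    pos.lTensor (TensorAlgebra K L) (deconc t) = deconc t := by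
  induction t using induction_left with
  | one => simp [deconc_one]
  | add s t hs ht => simp [hs, ht]
  | smul c t ht => simp [ht]
  | ι_mul x t ht =>
    have h : ∀ w : TensorAlgebra K L ⊗[K] TensorAlgebra K L,
        pos.lTensor (TensorAlgebra K L) ((LinearMap.mulLeft K (ι K x)).rTensor _ w) =
        (LinearMap.mulLeft K (ι K x)).rTensor _ (pos.lTensor (TensorAlgebra K L) w) := by
      intro w
      rw [← LinearMap.comp_apply, ← LinearMap.comp_apply, LinearMap.lTensor_comp_rTensor,
        LinearMap.rTensor_comp_lTensor]
    rw [deconc_ι_mul, map_add, h, ht, LinearMap.lTensor_tmul, pos_pos]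

theorem rTensor_rTensor_mulLeft {f g : Module.End K (TensorAlgebra K L)} {a b : TensorAlgebra K L}
    (h : ∀ t, f (a * t) = b * g t) (w : TensorAlgebra K L ⊗[K] TensorAlgebra K L) :
    f.rTensor _ ((LinearMap.mulLeft K a).rTensor _ w) =
      (LinearMap.mulLeft K b).rTensor _ (g.rTensor _ w) := by
  rw [← LinearMap.rTensor_comp_apply, ← LinearMap.rTensor_comp_apply]
  congr 2
  ext1 t
  exact h t

/-- The induction step on positions for the two statements below. Only the cut right after the first
letter needs care: on the left it is killed by f 1 = 0, on the right by the length projection. -/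
theorem rTensor_tail_deconc {f : Module.End K (TensorAlgebra K L)} {k : ℕ} (h1 : f 1 = 0)
    (h : ∀ t, f.rTensor (TensorAlgebra K L) (deconc t) = (lenGE (k + 1)).rTensor _ (deconc (f t)))
    (t : TensorAlgebra K L) :
    (tail f).rTensor (TensorAlgebra K L) (deconc t) =
      (lenGE (k + 1 + 1)).rTensor _ (deconc (tail f t)) := by
  induction t using induction_left with
  | one => simp [deconc_one]
  | add s t hs ht => simp [hs, ht]
  | smul c t ht => simp [ht]
  | ι_mul x t _ =>
    rw [tail_ι_mul, deconc_ι_mul, deconc_ι_mul, map_add, map_add, LinearMap.rTensor_tmul,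
      LinearMap.rTensor_tmul, tail_ι, h1, lenGE_succ_succ_ι, mul_zero, TensorProduct.zero_tmul,
      TensorProduct.zero_tmul, rTensor_rTensor_mulLeft (tail_ι_mul f x), h,
      rTensor_rTensor_mulLeft (lenGE_succ_ι_mul (k + 1) x)]

/-- Requiring at least two letters in the left factor discards exactly the cut between the two
letters of w. -/
theorem rTensor_lenGE_deconc_pair_mul (w : L ⊗[K] L) (t : TensorAlgebra K L) :
    (lenGE (0 + 1 + 1)).rTensor (TensorAlgebra K L) (deconc (pair w * t)) =
      pair w ⊗ₜ pos t + (LinearMap.mulLeft K (pair w)).rTensor _ (deconc t) := by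
  induction w using TensorProduct.induction_on with
  | zero => simp
  | add a b ha hb =>
    have h : LinearMap.mulLeft K (pair a + pair b) =
        LinearMap.mulLeft K (pair a) + LinearMap.mulLeft K (pair b) := by
      ext1 t; simp [add_mul]
    rw [map_add, add_mul, map_add, map_add, ha, hb, h, LinearMap.rTensor_add, LinearMap.add_apply,
      TensorProduct.add_tmul]
    abel
  | tmul x y =>
    have h : ∀ s : TensorAlgebra K L, lenGE (0 + 1 + 1) (ι K x * s) = ι K x * lenGE (0 + 1) s :=
      fun s => lenGE_succ_ι_mul _ x s
    have h' : ∀ s : TensorAlgebra K L, lenGE (0 + 1) (ι K y * s) =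
        ι K y * (LinearMap.id : Module.End K (TensorAlgebra K L)) s :=
      fun s => lenGE_succ_ι_mul _ y s
    rw [pair_tmul, mul_assoc, deconc_ι_mul, map_add, LinearMap.rTensor_tmul, lenGE_succ_succ_ι,
      TensorProduct.zero_tmul, rTensor_rTensor_mulLeft h, deconc_ι_mul, map_add,
      rTensor_rTensor_mulLeft h', LinearMap.rTensor_tmul, lenGE_one_ι, LinearMap.rTensor_id,
      LinearMap.id_apply, map_add, LinearMap.rTensor_tmul, ← LinearMap.rTensor_comp_apply,
      ← LinearMap.mulLeft_mul, LinearMap.mulLeft_apply]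
    simp

theorem exchDiff_zero_ι_mul_ι_mul (M : DGModule K L) (x y : L) (t : TensorAlgebra K L) :
    exchDiff M 0 (ι K x * (ι K y * t)) = pair (x ⊗ₜ y - M.swap M (x ⊗ₜ y)) * t :=
  headTwo_ι_mul_ι_mul _ x y t

/-- Cuts after at least i + 2 letters do not separate the exchanged letters, so exchanging before or
after the cut is the same; shorter left factors are killed by the exchange difference. -/
theorem rTensor_exchDiff_deconc (M : DGModule K L) (i : ℕ) (t : TensorAlgebra K L) :
    (exchDiff M i).rTensor (TensorAlgebra K L) (deconc t) =
      (lenGE (i + 1 + 1)).rTensor _ (deconc (exchDiff M i t)) := by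
  induction i generalizing t with
  | zero =>
    refine LinearMap.congr_fun (f := (exchDiff M 0).rTensor (TensorAlgebra K L) ∘ₗ deconc)
      (g := (lenGE (0 + 1 + 1)).rTensor _ ∘ₗ deconc ∘ₗ exchDiff M 0)
      (ext_letter M ?_ fun i x _ => ext_letter M ?_ fun j y _ => ?_) t
    · simp [deconc_one]
    · have h := deconc_ι_mul x (1 : TensorAlgebra K L)
      rw [mul_one, pos_one, deconc_one, map_zero, TensorProduct.tmul_zero, add_zero] at h
      simp [h]
    · ext1 t
      have h : ∀ s, exchDiff M 0 (ι K x * s) = (1 : TensorAlgebra K L) *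
          (exchDiff M 0 ∘ₗ LinearMap.mulLeft K (ι K x)) s := fun s => by simp
      have h' : ∀ s, (exchDiff M 0 ∘ₗ LinearMap.mulLeft K (ι K x)) (ι K y * s) =
          pair (x ⊗ₜ y - M.swap M (x ⊗ₜ y)) *
            (LinearMap.id : Module.End K (TensorAlgebra K L)) s :=
        fun s => exchDiff_zero_ι_mul_ι_mul M x y s
      simp only [LinearMap.comp_apply, LinearMap.mulLeft_apply]
      rw [exchDiff_zero_ι_mul_ι_mul, rTensor_lenGE_deconc_pair_mul, deconc_ι_mul, map_add,
        LinearMap.rTensor_tmul, exchDiff_ι, TensorProduct.zero_tmul, zero_add,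
        rTensor_rTensor_mulLeft h, deconc_ι_mul, map_add, rTensor_rTensor_mulLeft h',
        LinearMap.rTensor_tmul, LinearMap.rTensor_id, LinearMap.id_apply, map_add,
        LinearMap.rTensor_tmul, LinearMap.mulLeft_one, LinearMap.rTensor_id, LinearMap.id_apply]
      have h2 := exchDiff_zero_ι_mul_ι_mul M x y 1
      rw [mul_one, mul_one] at h2
      simp only [LinearMap.comp_apply, LinearMap.mulLeft_apply, h2, LinearMap.id_apply]
  | succ i ih => rw [exchDiff_succ]; exact rTensor_tail_deconc (by simp) ih t

/-- The same bound as for `exchDiff` appears because a left factor containing position i has at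
least i + 2 letters after the cobracket. This coincidence makes the difference of the two operators
compatible with cuts. -/
theorem rTensor_cobr_deconc (L' : DGLieCoalgebra K L) (i : ℕ) (t : TensorAlgebra K L) :
    (cobr L' i).rTensor (TensorAlgebra K L) (deconc t) =
      (lenGE (i + 1 + 1)).rTensor _ (deconc (cobr L' i t)) := by
  induction i generalizing t with
  | zero =>
    induction t using induction_left with
    | one => simp [deconc_one]
    | add s t hs ht => simp [hs, ht]
    | smul c t ht => simp [ht]
    | ι_mul x t _ =>
      have h : ∀ s, cobr L' 0 (ι K x * s) =
          pair (L'.cobracket x) * (LinearMap.id : Module.End K (TensorAlgebra K L)) s :=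
        fun s => cobr_zero_ι_mul L' x s
      rw [cobr_zero_ι_mul, rTensor_lenGE_deconc_pair_mul, deconc_ι_mul, map_add,
        rTensor_rTensor_mulLeft h, LinearMap.rTensor_tmul, cobr_zero_ι, LinearMap.rTensor_id,
        LinearMap.id_apply]
  | succ i ih => rw [cobr_succ]; exact rTensor_tail_deconc (by simp) ih t

theorem rTensor_rel_deconc (L' : DGLieCoalgebra K L) {t : TensorAlgebra K L} (ht : t ∈ relKer L')
    (i : ℕ) : (rel L' i).rTensor (TensorAlgebra K L) (deconc t) = 0 := by
  cases i with
  | zero =>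
    rw [rel, LinearMap.rTensor_sub, LinearMap.sub_apply, lenGE_one, pos_rTensor_deconc,
      Module.End.one_eq_id, LinearMap.rTensor_id, LinearMap.id_apply, sub_self]
  | succ i =>
    have h := mem_relKer.1 ht (i + 1)
    rw [rel, LinearMap.sub_apply, sub_eq_zero] at h
    rw [rel, LinearMap.rTensor_sub, LinearMap.sub_apply, rTensor_exchDiff_deconc,
      rTensor_cobr_deconc, h, sub_self]

/-- The projection onto the words with exactly `k` letters. -/
def lenEQ (k : ℕ) : Module.End K (TensorAlgebra K L) := lenGE k - lenGE (k + 1)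

theorem lenEQ_succ (k : ℕ) :
    lenEQ (k + 1) = tail (lenEQ k : Module.End K (TensorAlgebra K L)) := by
  rw [lenEQ, lenEQ, map_sub, ← lenGE_succ, ← lenGE_succ]

theorem rTensor_lenEQ_zero_deconc (t : TensorAlgebra K L) :
    (lenEQ 0).rTensor (TensorAlgebra K L) (deconc t) = 0 := by
  rw [lenEQ, LinearMap.rTensor_sub, LinearMap.sub_apply, zero_add, lenGE_one, pos_rTensor_deconc,
    lenGE_zero, Module.End.one_eq_id, LinearMap.rTensor_id, LinearMap.id_apply, sub_self]

/-- Acting on what remains after cutting off p + 1 letters is acting on the whole word p + 1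
positions further on. The two hypotheses on f are needed because the reduced coproduct omits the cut
with empty right factor. -/
theorem map_lenEQ_deconc {f : Module.End K (TensorAlgebra K L)} (h1 : f * pos = f)
    (h2 : pos * f = f) (p : ℕ) (t : TensorAlgebra K L) :
    TensorProduct.map (lenEQ (p + 1)) f (deconc t) =
      (lenEQ (p + 1)).rTensor _ (deconc (tail^[p + 1] f t)) := by
  have aux : ∀ (q : ℕ) (g : Module.End K (TensorAlgebra K L)) (x : L) w,
      TensorProduct.map (lenEQ (q + 1)) g ((LinearMap.mulLeft K (ι K x)).rTensor _ w) =
      (LinearMap.mulLeft K (ι K x)).rTensor _ (TensorProduct.map (lenEQ q) g w) := by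
    intro q g x w
    induction w using TensorProduct.induction_on with
    | zero => simp
    | add a b ha hb => simp only [map_add, ha, hb]
    | tmul a b => simp [lenEQ_succ]
  have aux' : ∀ (q : ℕ) (x : L) (s : TensorAlgebra K L),
      lenEQ (q + 1) (ι K x * s) = ι K x * lenEQ q s := fun q x s => by rw [lenEQ_succ, tail_ι_mul]
  induction p generalizing t with
  | zero =>
    induction t using induction_left with
    | one => simp [deconc_one]
    | add s t hs ht => simp [hs, ht]
    | smul c t ht => simp [ht]
    | ι_mul x t _ =>
      have h3 : TensorProduct.map (lenEQ 0) f (deconc t) = 0 := by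
        have : TensorProduct.map (lenEQ 0) f = f.lTensor (TensorAlgebra K L) ∘ₗ
            (lenEQ 0).rTensor (TensorAlgebra K L) :=
          (LinearMap.lTensor_comp_rTensor _ _ _).symm
        rw [this, LinearMap.comp_apply, rTensor_lenEQ_zero_deconc, map_zero]
      have h4 := LinearMap.congr_fun h1 t
      have h5 := LinearMap.congr_fun h2 t
      simp only [Module.End.mul_apply] at h4 h5
      rw [Function.iterate_succ_apply, Function.iterate_zero_apply, tail_ι_mul, deconc_ι_mul,
        deconc_ι_mul, map_add, map_add, aux, h3, map_zero, rTensor_rTensor_mulLeft (aux' 0 x),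
        rTensor_lenEQ_zero_deconc, map_zero, TensorProduct.map_tmul, LinearMap.rTensor_tmul, h4, h5]
  | succ p ih =>
    induction t using induction_left with
    | one => rw [Function.iterate_succ_apply']; simp [deconc_one]
    | add s t hs ht => simp [hs, ht]
    | smul c t ht => simp [ht]
    | ι_mul x t _ =>
      have h3 : lenEQ (p + 1 + 1) (ι K x) = 0 := by simp [lenEQ]
      rw [Function.iterate_succ_apply', tail_ι_mul, deconc_ι_mul, deconc_ι_mul, map_add, map_add,
        aux, ih, rTensor_rTensor_mulLeft (aux' _ x), TensorProduct.map_tmul,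
        LinearMap.rTensor_tmul, h3, TensorProduct.zero_tmul, TensorProduct.zero_tmul]

theorem exists_lenGE_rTensor_eq_zero {W : Type w} [AddCommGroup W] [Module K W]
    (w : TensorAlgebra K L ⊗[K] W) : ∃ k, ∀ l, k ≤ l → (lenGE l).rTensor W w = 0 := by
  induction w using TensorProduct.induction_on with
  | zero => exact ⟨0, by simp⟩
  | add s t hs ht =>
    obtain ⟨k, hk⟩ := hs
    obtain ⟨l, hl⟩ := ht
    exact ⟨max k l, fun m hm => by
      rw [map_add, hk m (by omega), hl m (by omega), add_zero]⟩
  | tmul t x =>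
    obtain ⟨k, hk⟩ := exists_lenGE_eq_zero t
    exact ⟨k, fun l hl => by rw [LinearMap.rTensor_tmul, hk l hl, TensorProduct.zero_tmul]⟩

/-- Lengths of left factors are bounded, so a tensor may be tested one left length at a time; this
is what makes a shift of positions by a fixed amount usable. -/
theorem eq_zero_of_lenEQ_rTensor {W : Type w} [AddCommGroup W] [Module K W]
    (w : TensorAlgebra K L ⊗[K] W) (h : ∀ p, (lenEQ p).rTensor W w = 0) : w = 0 := by
  have key : ∀ p, (lenGE p).rTensor W w = w := by
    intro p
    induction p with
    | zero => rw [lenGE_zero, Module.End.one_eq_id, LinearMap.rTensor_id, LinearMap.id_apply]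
    | succ p ih =>
      have := h p
      rw [lenEQ, LinearMap.rTensor_sub, LinearMap.sub_apply, sub_eq_zero] at this
      rw [← this, ih]
  obtain ⟨k, hk⟩ := exists_lenGE_rTensor_eq_zero w
  rw [← key k, hk k le_rfl]

theorem rel_succ_mul_pos (L' : DGLieCoalgebra K L) (i : ℕ) : rel L' (i + 1) * pos = rel L' (i + 1) :=
  ext_letter' (by simp [rel, pos_one]) (by simp [pos_ι_mul])

theorem pos_mul_rel_succ (L' : DGLieCoalgebra K L) (i : ℕ) :
    pos * rel L' (i + 1) = rel L' (i + 1) := by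
  have h1 : lenGE 1 * exchDiff L'.toDGModule i = exchDiff L'.toDGModule i := by
    have h := lenGE_mul_exch L'.toDGModule 1 i
    rw [exch, mul_sub, sub_mul, mul_one, one_mul, sub_right_inj] at h
    rw [h, ← exchDiff_mul_lenGE, mul_assoc, lenGE_mul_lenGE' (by omega)]
  have h2 : lenGE 1 * cobr L' i = cobr L' i := by
    rw [← lenGE_mul_cobr, ← mul_assoc, lenGE_mul_lenGE (by omega)]
  rw [← lenGE_one, rel, mul_sub, h1, h2]

theorem tail_iterate_rel (L' : DGLieCoalgebra K L) (i p : ℕ) :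
    tail^[p] (rel L' (i + 1)) = rel L' (i + p + 1) := by
  induction p with
  | zero => rfl
  | succ p ih =>
    rw [Function.iterate_succ_apply', ih, rel, rel, map_sub, ← exchDiff_succ, ← cobr_succ,
      add_assoc i p 1]

/-- A relation at position i of the right factor is a relation at a later position of the whole
word, and all positions are imposed on t. -/
theorem lTensor_rel_deconc (L' : DGLieCoalgebra K L) {t : TensorAlgebra K L} (ht : t ∈ relKer L')
    (i : ℕ) : (rel L' i).lTensor (TensorAlgebra K L) (deconc t) = 0 := by
  cases i with
  | zero =>
    rw [rel, LinearMap.lTensor_sub, LinearMap.sub_apply, lenGE_one, pos_lTensor_deconc,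
      Module.End.one_eq_id, LinearMap.lTensor_id, LinearMap.id_apply, sub_self]
  | succ i =>
    refine eq_zero_of_lenEQ_rTensor _ fun p => ?_
    cases p with
    | zero =>
      rw [← LinearMap.comp_apply, LinearMap.rTensor_comp_lTensor, ← LinearMap.lTensor_comp_rTensor,
        LinearMap.comp_apply, rTensor_lenEQ_zero_deconc, map_zero]
    | succ p =>
      rw [← LinearMap.comp_apply, LinearMap.rTensor_comp_lTensor,
        map_lenEQ_deconc (rel_succ_mul_pos L' i) (pos_mul_rel_succ L' i), tail_iterate_rel,
        mem_relKer.1 ht, map_zero, map_zero]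

/-- The part of length two of a word. -/
def lenTwo : TensorAlgebra K L →ₗ[K] L ⊗[K] L := TensorAlgebra.ιInv.lTensor L ∘ₗ uncons

theorem ιInv_pos (t : TensorAlgebra K L) : TensorAlgebra.ιInv (pos t) = TensorAlgebra.ιInv t := by
  simp [pos, Algebra.algebraMap_eq_smul_one, ιInv_one]

theorem lenTwo_pair_mul (w : L ⊗[K] L) (t : TensorAlgebra K L) :
    lenTwo (pair w * t) = TensorAlgebra.algebraMapInv t • w := by
  induction w using TensorProduct.induction_on with
  | zero => simp
  | add a b ha hb => simp only [map_add, add_mul, ha, hb, smul_add]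
  | tmul x y => simp [lenTwo, mul_assoc, ιInv_ι_mul]

/-- Both factors are single letters only when a two-letter word is cut in the middle. -/
theorem map_ιInv_deconc (t : TensorAlgebra K L) :
    TensorProduct.map TensorAlgebra.ιInv TensorAlgebra.ιInv (deconc t) = lenTwo t := by
  induction t using induction_left with
  | one => simp [deconc_one, lenTwo]
  | add s t hs ht => simp [hs, ht]
  | smul c t ht => simp [ht]
  | ι_mul x t _ =>
    have h : ∀ w : TensorAlgebra K L ⊗[K] TensorAlgebra K L,
        TensorProduct.map TensorAlgebra.ιInv TensorAlgebra.ιInv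
          ((LinearMap.mulLeft K (ι K x)).rTensor _ (pos.rTensor _ w)) = (0 : L ⊗[K] L) := by
      intro w
      induction w using TensorProduct.induction_on with
      | zero => simp
      | add a b ha hb => simp only [map_add, ha, hb, add_zero]
      | tmul a b => simp [ιInv_ι_mul, pos]
    rw [deconc_ι_mul, map_add, ← pos_rTensor_deconc t, h]
    have h2 := ιInv_ι_mul x (1 : TensorAlgebra K L)
    rw [mul_one] at h2
    simp [lenTwo, ιInv_pos, h2]

theorem lenTwo_exchDiff (M : DGModule K L) (t : TensorAlgebra K L) :
    lenTwo (exchDiff M 0 t) = lenTwo t - M.swap M (lenTwo t) := by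
  refine LinearMap.congr_fun (f := lenTwo ∘ₗ exchDiff M 0)
    (g := lenTwo - M.swap M ∘ₗ lenTwo)
    (ext_letter M ?_ fun i x _ => ext_letter M ?_ fun j y _ => ?_) t
  · simp [lenTwo]
  · simp [lenTwo, ιInv_one]
  · ext1 t
    have h := lenTwo_pair_mul (x ⊗ₜ y) t
    rw [pair_tmul, mul_assoc] at h
    simp only [LinearMap.comp_apply, LinearMap.mulLeft_apply, LinearMap.sub_apply,
      exchDiff_zero_ι_mul_ι_mul, lenTwo_pair_mul, h, smul_sub, map_smul]

theorem lenTwo_cobr (L' : DGLieCoalgebra K L) (t : TensorAlgebra K L) :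
    lenTwo (cobr L' 0 t) = L'.cobracket (TensorAlgebra.ιInv t) := by
  refine LinearMap.congr_fun (f := lenTwo ∘ₗ cobr L' 0)
    (g := L'.cobracket ∘ₗ TensorAlgebra.ιInv) (ext_letter' ?_ fun x t => ?_) t
  · simp [ιInv_one]
  · simp [lenTwo_pair_mul, ιInv_ι_mul]

/-- The relations are chain maps compatible with cuts, so their common kernel is a dg subcoalgebra.
The Lie condition is the length-two component of the relation at position 0. -/
theorem relKer_isLieSubcoalgebra (L' : DGLieCoalgebra K L) :
    IsLieSubcoalgebra L' (relKer L') where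
  reduced t ht := by
    have h := mem_relKer.1 ht 0
    rw [rel, LinearMap.sub_apply, sub_eq_zero, lenGE_one, Module.End.one_apply] at h
    rw [h]
    simp [pos]
  homogeneous n t ht := mem_relKer.2 fun i => by
    rw [(words L'.toDGModule).map_comp (words L'.toDGModule) (isChainEnd_rel L' i).mem,
      mem_relKer.1 ht, map_zero]
  d_mem t ht := mem_relKer.2 fun i => by
    change rel L' i (wordD _ t) = 0
    rw [← (isChainEnd_rel L' i).comm, mem_relKer.1 ht, map_zero]
  deconc_mem t ht :=
    mem_range_mapIncl_iInf_ker _ _ (rTensor_rel_deconc L' ht) (lTensor_rel_deconc L' ht)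
  lie t ht := by
    have h := mem_relKer.1 ht 1
    rw [rel, LinearMap.sub_apply, sub_eq_zero] at h
    rw [map_sub, DGModule.swap_map (words L'.toDGModule) L'.toDGModule
      (fun n t ht => ιInv_mem L'.toDGModule ht), map_ιInv_deconc, ← lenTwo_exchDiff, h, lenTwo_cobr]

theorem relKer_le_envelopingSubmodule (L' : DGLieCoalgebra K L) :
    relKer L' ≤ envelopingSubmodule L' :=
  le_sSup (relKer_isLieSubcoalgebra L')

end Relations

end TensorCoalgebra

/-! ### Coxeter relations, symmetrization and vanishing of first cohomology -/

section Symmetrizer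

/-- The Coxeter relations of the symmetric group for the elements `s 0, …, s (n - 1)`. -/
structure IsCoxeterFamily {R : Type*} [Monoid R] (s : ℕ → R) (n : ℕ) : Prop where
  sq : ∀ i, i < n → s i * s i = 1
  comm : ∀ i j, i + 2 ≤ j → j < n → s i * s j = s j * s i
  braid : ∀ i, i + 1 < n → s i * s (i + 1) * s i = s (i + 1) * s i * s (i + 1)

theorem IsCoxeterFamily.mono {R : Type*} [Monoid R] {s : ℕ → R} {m n : ℕ}
    (h : IsCoxeterFamily s n) (hmn : m ≤ n) : IsCoxeterFamily s m :=
  ⟨fun i hi => h.sq i (by omega), fun i j hij hj => h.comm i j hij (by omega),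
    fun i hi => h.braid i (by omega)⟩

/-- The product `s k * s (k + 1) * ⋯ * s (k + d - 1)`. -/
def ascProd {R : Type*} [Monoid R] (s : ℕ → R) : ℕ → ℕ → R
  | _, 0 => 1
  | k, d + 1 => s k * ascProd s (k + 1) d

theorem IsCoxeterFamily.mul_ascProd_of_lt {R : Type*} [Monoid R] {s : ℕ → R} {n : ℕ}
    (h : IsCoxeterFamily s n) {i k d : ℕ} (hik : i + 2 ≤ k) (hk : k + d ≤ n) :
    s i * ascProd s k d = ascProd s k d * s i := by
  induction d generalizing k with
  | zero => simp [ascProd]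
  | succ d ih =>
    rw [ascProd, ← mul_assoc, h.comm i k hik (by omega), mul_assoc, ih (by omega) (by omega),
      mul_assoc]

/-- Conjugation by a cycle of consecutive letters shifts the transpositions inside its range by one;
the braid relation does this at the place where the indices meet. -/
theorem IsCoxeterFamily.mul_ascProd_of_le {R : Type*} [Monoid R] {s : ℕ → R} {n : ℕ}
    (h : IsCoxeterFamily s n) {j k d : ℕ} (hkj : k ≤ j) (hj : j + 1 < k + d) (hk : k + d ≤ n) :
    s (j + 1) * ascProd s k d = ascProd s k d * s j := by
  induction d generalizing k with
  | zero => omega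
  | succ d ih =>
    rcases hkj.eq_or_lt with rfl | hkj
    · obtain ⟨d, rfl⟩ := Nat.exists_eq_add_of_le' (show 1 ≤ d by omega)
      rw [ascProd, ascProd, ← mul_assoc, ← mul_assoc, ← h.braid k (by omega), mul_assoc,
        h.mul_ascProd_of_lt le_rfl (by omega)]
      simp only [mul_assoc]
    · rw [ascProd, ← mul_assoc, ← h.comm k (j + 1) (by omega) (by omega), mul_assoc,
        ih hkj (by omega) (by omega), mul_assoc]

/-- The sum over the symmetric group on `n + 1` letters, written in terms of the elements
`s 0, …, s (n - 1)` which represent the adjacent transpositions. -/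
def symmetrizer {R : Type*} [Ring R] (s : ℕ → R) : ℕ → R
  | 0 => 1
  | n + 1 => (∑ k ∈ Finset.range (n + 2), ascProd s k (n + 1 - k)) * symmetrizer s n

/-- The products `ascProd s k (n + 1 - k)` represent the cosets of the smaller symmetric group. Left
multiplication by s i interchanges the cosets k = i and k = i + 1; past any other representative it
moves to the right as a generator of the smaller group, where induction absorbs it. -/
theorem IsCoxeterFamily.mul_symmetrizer {R : Type*} [Ring R] {s : ℕ → R} {n : ℕ}
    (h : IsCoxeterFamily s n) {i : ℕ} (hi : i < n) :
    s i * symmetrizer s n = symmetrizer s n := by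
  induction n generalizing i with
  | zero => omega
  | succ n ih =>
    have ih := fun {i} => @ih (h.mono (Nat.le_succ n)) i
    rw [symmetrizer, Finset.sum_mul, Finset.mul_sum]
    refine Finset.sum_equiv (Equiv.swap i (i + 1)) (fun k => ?_) fun k hk => ?_
    · simp only [Finset.mem_range, Equiv.swap_apply_def]
      split_ifs <;> omega
    · rw [Finset.mem_range] at hk
      rcases lt_trichotomy k i with hki | rfl | hki
      · obtain ⟨j, rfl⟩ := Nat.exists_eq_add_of_le' (show 1 ≤ i by omega)
        rw [Equiv.swap_apply_of_ne_of_ne (by omega) (by omega), ← mul_assoc,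
          h.mul_ascProd_of_le (by omega) (by omega) (by omega), mul_assoc, ih (by omega)]
      · rw [Equiv.swap_apply_left, show n + 1 - k = (n + 1 - (k + 1)) + 1 by omega, ascProd,
          ← mul_assoc, ← mul_assoc, h.sq k hi, one_mul]
      · rcases (Nat.succ_le_of_lt hki).eq_or_lt with rfl | hki'
        · rw [Nat.succ_eq_add_one, Equiv.swap_apply_right,
            show n + 1 - i = (n + 1 - (i + 1)) + 1 by omega, ascProd, mul_assoc]
        · rw [Equiv.swap_apply_of_ne_of_ne (by omega) (by omega), ← mul_assoc,
            h.mul_ascProd_of_lt (by omega) (by omega), mul_assoc, ih (by omega)]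

variable {K : Type u} [Field K] {V : Type v} [AddCommGroup V] [Module K V]

/-- Every one of the (n + 1)! terms contributes the same value to an invariant functional. -/
theorem apply_symmetrizer {s : ℕ → Module.End K V} (φ : V →ₗ[K] K)
    (h : ∀ i x, φ (s i x) = φ x) (n : ℕ) (x : V) :
    φ (symmetrizer s n x) = (n + 1).factorial * φ x := by
  have h' : ∀ d k x, φ (ascProd s k d x) = φ x := by
    intro d
    induction d with
    | zero => intro k x; rfl
    | succ d ih => intro k x; rw [ascProd, Module.End.mul_apply, h, ih]
  induction n with
  | zero => simp [symmetrizer]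
  | succ n ih =>
    rw [symmetrizer, Module.End.mul_apply, LinearMap.sum_apply, map_sum]
    simp only [h', ih, Finset.sum_const, Finset.card_range, nsmul_eq_mul]
    rw [Nat.factorial_succ (n + 1)]
    push_cast
    ring

/-- The vanishing of the first cohomology of the symmetric group in characteristic zero: a
1-cocycle, given by its values on the adjacent transpositions, is a coboundary. -/
theorem IsCoxeterFamily.exists_sub_eq [CharZero K] {s : ℕ → Module.End K V} {n : ℕ}
    (h : IsCoxeterFamily s n) (c : ℕ → V) (hsq : ∀ i, i < n → s i (c i) = - c i)
    (hcomm : ∀ i j, i + 2 ≤ j → j < n → c i - s j (c i) = c j - s i (c j))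
    (hbraid : ∀ i, i + 1 < n → c i + s i (c (i + 1)) + s i (s (i + 1) (c i)) =
      c (i + 1) + s (i + 1) (c i) + s (i + 1) (s i (c (i + 1)))) :
    ∃ m : V, ∀ i, i < n → m - s i m = c i := by
  -- The cocycle is encoded as an extension of the trivial representation K by V: the three cocycle
  -- conditions say precisely that these affine operators again satisfy the Coxeter relations. An
  -- invariant vector with nonzero last coordinate splits the extension.
  let S : ℕ → Module.End K (V × K) := fun i =>
    (s i ∘ₗ LinearMap.fst K V K + LinearMap.toSpanSingleton K V (c i) ∘ₗ LinearMap.snd K V K).prod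
      (LinearMap.snd K V K)
  have hS : ∀ i x a, S i (x, a) = (s i x + a • c i, a) := fun i x a => rfl
  have fam : IsCoxeterFamily S n := by
    constructor
    · intro i hi
      refine LinearMap.ext fun ⟨x, a⟩ => ?_
      have e := LinearMap.congr_fun (h.sq i hi) x
      rw [Module.End.mul_apply, Module.End.one_apply] at e
      rw [Module.End.mul_apply, hS, hS, map_add, map_smul, hsq i hi, e]
      simp
    · intro i j hij hj
      refine LinearMap.ext fun ⟨x, a⟩ => ?_
      have e := LinearMap.congr_fun (h.comm i j hij hj) x
      rw [Module.End.mul_apply, Module.End.mul_apply] at e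
      have e' := hcomm i j hij hj
      rw [Module.End.mul_apply, Module.End.mul_apply, hS, hS, hS, hS, map_add, map_add, e, map_smul,
        map_smul, add_assoc, add_assoc, ← smul_add, ← smul_add]
      congr 3
      rw [sub_eq_sub_iff_add_eq_add] at e'
      rw [add_comm, e', add_comm]
    · intro i hi
      refine LinearMap.ext fun ⟨x, a⟩ => ?_
      have e := LinearMap.congr_fun (h.braid i hi) x
      simp only [Module.End.mul_apply] at e
      have e' := hbraid i hi
      simp only [Module.End.mul_apply, hS, map_add, map_smul, e]
      rw [add_assoc, add_assoc, add_assoc, add_assoc, ← smul_add, ← smul_add, ← smul_add,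
        ← smul_add]
      congr 3
      refine Eq.trans ?_ (e'.trans ?_) <;> abel
  -- Symmetrizing (0, 1) gives an invariant vector whose last coordinate is (n + 1)!. Characteristic
  -- zero makes it invertible, and after normalization the V-coordinate is the required m.
  obtain ⟨⟨x, a⟩, hp⟩ : ∃ p, symmetrizer S n ((0 : V), (1 : K)) = p := ⟨_, rfl⟩
  have ha : a = ((n + 1).factorial : K) := by
    have := apply_symmetrizer (s := S) (LinearMap.snd K V K) (fun i x => rfl) n (0, 1)
    rw [hp] at this
    simpa using this
  have ha0 : a ≠ 0 := by rw [ha]; exact_mod_cast Nat.factorial_ne_zero _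
  refine ⟨a⁻¹ • x, fun i hi => ?_⟩
  have e := LinearMap.congr_fun (fam.mul_symmetrizer hi) ((0 : V), (1 : K))
  rw [Module.End.mul_apply, hp, hS, Prod.mk.injEq] at e
  rw [map_smul, ← smul_sub, sub_eq_of_eq_add' e.1.symm, smul_smul, inv_mul_cancel₀ ha0, one_smul]

end Symmetrizer

namespace TensorCoalgebra

open TensorAlgebra (ι)

/-! ### Iterated cobrackets and the coadjoint coaction on words -/

section Coadjoint

variable {K : Type u} [Field K] {L : Type v} [AddCommGroup L] [Module K L]

/-- The map `(1 ⊗ f) δ` associated with a map `f` from a Lie coalgebra to the tensor space. -/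
def coact (L' : DGLieCoalgebra K L) :
    (L →ₗ[K] TensorAlgebra K L) →ₗ[K] L →ₗ[K] TensorAlgebra K L where
  toFun f := cons ∘ₗ f.lTensor L ∘ₗ L'.cobracket
  map_add' f g := by simp [LinearMap.lTensor_add, LinearMap.comp_add, LinearMap.add_comp]
  map_smul' c f := by simp [LinearMap.lTensor_smul, LinearMap.comp_smul, LinearMap.smul_comp]

theorem coact_apply (L' : DGLieCoalgebra K L) (f : L →ₗ[K] TensorAlgebra K L) (x : L) :
    coact L' f x = cons (f.lTensor L (L'.cobracket x)) := rfl

theorem tail_coact (L' : DGLieCoalgebra K L) (g : Module.End K (TensorAlgebra K L))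
    (f : L →ₗ[K] TensorAlgebra K L) : tail g ∘ₗ coact L' f = coact L' (g ∘ₗ f) := by
  ext1 x
  rw [LinearMap.comp_apply, coact_apply, coact_apply, tail_cons, LinearMap.lTensor_comp,
    LinearMap.comp_apply]

theorem exch_succ_coact (L' : DGLieCoalgebra K L) (i : ℕ) (f : L →ₗ[K] TensorAlgebra K L) :
    exch L'.toDGModule (i + 1) ∘ₗ coact L' f = coact L' (exch L'.toDGModule i ∘ₗ f) := by
  ext1 x
  rw [LinearMap.comp_apply, coact_apply, coact_apply, exch_succ_cons, LinearMap.lTensor_comp,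
    LinearMap.comp_apply]

/-- Applying a map `L → T(L)` to the first letter of a word. -/
def headMap (f : L →ₗ[K] TensorAlgebra K L) : Module.End K (TensorAlgebra K L) :=
  LinearMap.mul' K _ ∘ₗ f.rTensor _ ∘ₗ uncons

/-- Expresses `coact` through operators on words, so that identities between exchanges and
cobrackets can be used in front of an arbitrary f. -/
theorem tail_headMap_pair (L' : DGLieCoalgebra K L) (f : L →ₗ[K] TensorAlgebra K L) (x : L) :
    tail (headMap f) (pair (L'.cobracket x)) = coact L' f x := by
  rw [coact_apply]
  induction L'.cobracket x using TensorProduct.induction_on with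
  | zero => simp
  | add a b ha hb => simp only [map_add, ha, hb]
  | tmul x y => simp [headMap]

/-- Co-Jacobi in Leibniz form with f applied to the last of the three letters. It serves both to
show that `combSpan` is stable under cobrackets and to show that its members are comodule morphisms.
-/
theorem cobr_zero_coact (L' : DGLieCoalgebra K L) (f : L →ₗ[K] TensorAlgebra K L) :
    cobr L' 0 ∘ₗ coact L' f =
      coact L' (coact L' f) - exch L'.toDGModule 0 ∘ₗ coact L' (coact L' f) := by
  ext1 x
  have h1 : coact L' (coact L' f) x =
      tail (tail (headMap f)) (cobr L' 1 (cobr L' 0 (ι K x))) := by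
    rw [← tail_headMap_pair, cobr_zero_ι]
    induction L'.cobracket x using TensorProduct.induction_on with
    | zero => simp
    | add a b ha hb => simp only [map_add, ha, hb]
    | tmul y z =>
      rw [pair_tmul, tail_ι_mul, ← zero_add 1, cobr_succ_ι_mul, tail_ι_mul, cobr_zero_ι,
        tail_headMap_pair]
      simp [headMap]
  have h2 := LinearMap.congr_fun (cobr_zero_mul_tail L' (headMap f)) (pair (L'.cobracket x))
  have h3 := LinearMap.congr_fun (cobr_zero_mul_cobr_zero L') (ι K x)
  have h4 := LinearMap.congr_fun (exch_zero_mul_tail_tail L'.toDGModule (headMap f))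
    (cobr L' 1 (cobr L' 0 (ι K x)))
  simp only [Module.End.mul_apply, LinearMap.sub_apply, Module.End.one_apply] at h2 h3 h4
  rw [LinearMap.comp_apply, ← tail_headMap_pair, h2, ← cobr_zero_ι, h3, map_sub,
    LinearMap.sub_apply, LinearMap.comp_apply, h1, h4]

/-- The coadjoint coaction of a Lie coalgebra on the tensor space; the coacting letter is put in
front of the word. -/
def coadj (L' : DGLieCoalgebra K L) : Module.End K (TensorAlgebra K L) :=
  leftRec
    { toFun := fun x => (LinearMap.mulLeft K (pair (L'.cobracket x))).coprod
        (exch L'.toDGModule 0 ∘ₗ LinearMap.mulLeft K (ι K x))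
      map_add' := fun x y => by ext <;> simp [add_mul]
      map_smul' := fun c x => by ext <;> simp }

@[simp] theorem coadj_one (L' : DGLieCoalgebra K L) : coadj L' 1 = 0 := leftRec_one _

@[simp] theorem coadj_ι_mul (L' : DGLieCoalgebra K L) (x : L) (t : TensorAlgebra K L) :
    coadj L' (ι K x * t) =
      pair (L'.cobracket x) * t + exch L'.toDGModule 0 (ι K x * coadj L' t) := by
  rw [coadj, leftRec_ι_mul]; rfl

@[simp] theorem coadj_ι (L' : DGLieCoalgebra K L) (x : L) :
    coadj L' (ι K x) = pair (L'.cobracket x) := by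
  simpa using coadj_ι_mul L' x 1

theorem coadj_eq (L' : DGLieCoalgebra K L) :
    coadj L' = cobr L' 0 + exch L'.toDGModule 0 * tail (coadj L') :=
  ext_letter' (by simp) (by simp)

theorem lenGE_one_coadj (L' : DGLieCoalgebra K L) (t : TensorAlgebra K L) :
    lenGE 1 (coadj L' t) = coadj L' t := by
  have h := lenGE_mul_exch L'.toDGModule 1 0
  refine LinearMap.congr_fun (f := lenGE 1 ∘ₗ coadj L') (g := coadj L')
    (ext_letter' (by simp) fun x t => ?_) t
  have h1 := LinearMap.congr_fun h (ι K x * coadj L' t)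
  simp only [Module.End.mul_apply] at h1
  have h2 : ∀ w : L ⊗[K] L, lenGE 1 (pair w * t) = pair w * t := by
    intro w
    induction w using TensorProduct.induction_on with
    | zero => simp
    | add a b ha hb => simp only [map_add, add_mul, ha, hb]
    | tmul y z => rw [lenGE_one, pair_tmul, mul_assoc, pos_ι_mul]
  rw [LinearMap.comp_apply, coadj_ι_mul, map_add, h1, h2, lenGE_one, pos_ι_mul]

theorem exch_one_pair (M : DGModule K L) (w : L ⊗[K] L) :
    exch M (0 + 1) (pair w) = pair w := by
  induction w using TensorProduct.induction_on with
  | zero => simp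
  | add a b ha hb => simp only [map_add, ha, hb]
  | tmul x y => simp

theorem exch_succ_succ_pair_mul (M : DGModule K L) (i : ℕ) (w : L ⊗[K] L) (t : TensorAlgebra K L) :
    exch M (i + 1 + 1) (pair w * t) = pair w * exch M i t := by
  induction w using TensorProduct.induction_on with
  | zero => simp
  | add a b ha hb => simp only [map_add, add_mul, ha, hb]
  | tmul x y => simp [mul_assoc]

/-- The coaction on a tensor power is equivariant for permutations of the factors; the index grows
by one because the coacting letter stands in front. -/
theorem coadj_exch (L' : DGLieCoalgebra K L) (i : ℕ) (t : TensorAlgebra K L) :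
    coadj L' (exch L'.toDGModule i t) = exch L'.toDGModule (i + 1) (coadj L' t) := by
  induction i generalizing t with
  | zero =>
    refine LinearMap.congr_fun (f := coadj L' ∘ₗ exch L'.toDGModule 0)
      (g := exch L'.toDGModule (0 + 1) ∘ₗ coadj L')
      (ext_letter L'.toDGModule ?_ fun i x hx => ext_letter L'.toDGModule ?_ fun j y hy => ?_) t
    · simp
    · simp only [LinearMap.comp_apply, LinearMap.mulLeft_apply, mul_one, exch_ι, coadj_ι,
        exch_one_pair]
    · ext1 t
      have h1 := exch_one_exch_zero_ι_mul_pair_mul L'.toDGModule hx (L'.cobracket_mem j y hy) t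
      have h2 := congrArg (exch L'.toDGModule (0 + 1))
        (exch_one_exch_zero_ι_mul_pair_mul L'.toDGModule hy (L'.cobracket_mem i x hx) t)
      have h3 := LinearMap.congr_fun (exch_mul_self L'.toDGModule (0 + 1))
        (exch L'.toDGModule 0 (ι K y * (pair (L'.cobracket x) * t)))
      simp only [Module.End.mul_apply, Module.End.one_apply] at h3
      rw [h3, map_smul] at h2
      -- The term in which the coaction happens behind x and y is the braid relation; it applies
      -- because the coaction on t leaves at least one letter, so that there are three in all.
      have h4 := LinearMap.congr_fun (exch_braid L'.toDGModule 0)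
        (ι K x * (ι K y * coadj L' t))
      have h5 : lenGE (0 + 3) (ι K x * (ι K y * coadj L' t)) = ι K x * (ι K y * coadj L' t) := by
        rw [lenGE_succ_ι_mul, lenGE_succ_ι_mul, lenGE_one_coadj]
      simp only [Module.End.mul_apply, h5] at h4
      rw [exch_zero_ι_mul_ι_mul _ hx hy, map_smul, map_smul, exch_succ_ι_mul, exch_succ_ι_mul] at h4
      simp only [LinearMap.comp_apply, LinearMap.mulLeft_apply]
      rw [exch_zero_ι_mul_ι_mul _ hx hy, map_smul]
      simp only [coadj_ι_mul, mul_add, map_add, smul_add]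
      rw [h1, h2, h4, smul_smul, mul_comm j i, neg_one_zpow_mul_self, one_smul]
      abel
  | succ i ih =>
    refine LinearMap.congr_fun (f := coadj L' ∘ₗ exch L'.toDGModule (i + 1))
      (g := exch L'.toDGModule (i + 1 + 1) ∘ₗ coadj L') (ext_letter' (by simp) fun x t => ?_) t
    have h := LinearMap.congr_fun (exch_comm L'.toDGModule (show 0 + 2 ≤ i + 1 + 1 by omega))
      (ι K x * coadj L' t)
    simp only [Module.End.mul_apply] at h
    simp only [LinearMap.comp_apply, exch_succ_ι_mul, coadj_ι_mul, map_add, ih,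
      exch_succ_succ_pair_mul, ← h]

/-- The left normed iterated cobrackets. -/
def comb (L' : DGLieCoalgebra K L) : ℕ → L →ₗ[K] TensorAlgebra K L
  | 0 => ι K
  | n + 1 => coact L' (comb L' n)

/-- The smallest space of maps from `L` to the tensor space which contains the left normed iterated
cobracket with `n + 1` outputs and is stable under permutations of the letters. -/
def combSpan (L' : DGLieCoalgebra K L) (n : ℕ) : Submodule K (L →ₗ[K] TensorAlgebra K L) :=
  sInf {U | comb L' n ∈ U ∧ ∀ i, ∀ f ∈ U, exch L'.toDGModule i ∘ₗ f ∈ U}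

theorem comb_mem (L' : DGLieCoalgebra K L) (n : ℕ) : comb L' n ∈ combSpan L' n := by
  rw [combSpan, Submodule.mem_sInf]
  exact fun U hU => hU.1

theorem exch_comp_mem (L' : DGLieCoalgebra K L) {n : ℕ} (i : ℕ) {f : L →ₗ[K] TensorAlgebra K L}
    (hf : f ∈ combSpan L' n) : exch L'.toDGModule i ∘ₗ f ∈ combSpan L' n := by
  rw [combSpan, Submodule.mem_sInf] at hf ⊢
  exact fun U hU => hU.2 i f (hf U hU)

theorem combSpan_induction {L' : DGLieCoalgebra K L} {n : ℕ}
    {P : (f : L →ₗ[K] TensorAlgebra K L) → f ∈ combSpan L' n → Prop} (zero : P 0 (zero_mem _))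
    (add : ∀ f g hf hg, P f hf → P g hg → P (f + g) (add_mem hf hg))
    (smul : ∀ (c : K) f hf, P f hf → P (c • f) (Submodule.smul_mem _ c hf))
    (comb : P (comb L' n) (comb_mem L' n))
    (exch : ∀ i f hf, P f hf → P (exch L'.toDGModule i ∘ₗ f) (exch_comp_mem L' i hf))
    {f : L →ₗ[K] TensorAlgebra K L} (hf : f ∈ combSpan L' n) : P f hf := by
  let U : Submodule K (L →ₗ[K] TensorAlgebra K L) :=
    { carrier := {f | ∃ hf, P f hf}
      zero_mem' := ⟨_, zero⟩
      add_mem' := fun hf hg => ⟨_, add _ _ _ _ hf.2 hg.2⟩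
      smul_mem' := fun c f hf => ⟨_, smul c f _ hf.2⟩ }
  have hU : combSpan L' n ≤ U := sInf_le ⟨⟨_, comb⟩, fun i f hf => ⟨_, exch i f _ hf.2⟩⟩
  exact (hU hf).2

theorem coact_mem (L' : DGLieCoalgebra K L) {n : ℕ} {f : L →ₗ[K] TensorAlgebra K L}
    (hf : f ∈ combSpan L' n) : coact L' f ∈ combSpan L' (n + 1) := by
  induction hf using combSpan_induction with
  | zero => rw [map_zero]; exact zero_mem _
  | add f g _ _ hf hg => rw [map_add]; exact add_mem hf hg
  | smul c f _ hf => rw [map_smul]; exact Submodule.smul_mem _ c hf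
  | comb => exact comb_mem L' (n + 1)
  | exch i f _ hf => rw [← exch_succ_coact]; exact exch_comp_mem L' _ hf

theorem lenGE_comp (L' : DGLieCoalgebra K L) {n : ℕ} {f : L →ₗ[K] TensorAlgebra K L}
    (hf : f ∈ combSpan L' n) : lenGE (n + 1) ∘ₗ f = f := by
  induction hf using combSpan_induction with
  | zero => simp
  | add f g _ _ hf hg => rw [LinearMap.comp_add, hf, hg]
  | smul c f _ hf => rw [LinearMap.comp_smul, hf]
  | comb =>
    induction n with
    | zero => ext1 x; simp [comb]
    | succ n ih => rw [comb, lenGE_succ, tail_coact, ih]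
  | exch i f _ hf =>
    rw [← LinearMap.comp_assoc, ← Module.End.mul_eq_comp, lenGE_mul_exch, Module.End.mul_eq_comp,
      LinearMap.comp_assoc, hf]

theorem lenGE_succ_comp (L' : DGLieCoalgebra K L) {n : ℕ} {f : L →ₗ[K] TensorAlgebra K L}
    (hf : f ∈ combSpan L' n) : lenGE (n + 2) ∘ₗ f = 0 := by
  induction hf using combSpan_induction with
  | zero => simp
  | add f g _ _ hf hg => rw [LinearMap.comp_add, hf, hg, add_zero]
  | smul c f _ hf => rw [LinearMap.comp_smul, hf, smul_zero]
  | comb =>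
    induction n with
    | zero => ext1 x; simp [comb]
    | succ n ih => rw [comb, lenGE_succ, tail_coact, ih, map_zero]
  | exch i f _ hf =>
    rw [← LinearMap.comp_assoc, ← Module.End.mul_eq_comp, lenGE_mul_exch, Module.End.mul_eq_comp,
      LinearMap.comp_assoc, hf, LinearMap.comp_zero]

theorem lenGE_apply_eq_self (L' : DGLieCoalgebra K L) {n k : ℕ} {f : L →ₗ[K] TensorAlgebra K L}
    (hf : f ∈ combSpan L' n) (hk : k ≤ n + 1) (x : L) : lenGE k (f x) = f x := by
  have h := LinearMap.congr_fun (lenGE_comp L' hf) x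
  rw [LinearMap.comp_apply] at h
  rw [← h, ← Module.End.mul_apply, lenGE_mul_lenGE hk]

theorem lenGE_apply_eq_zero (L' : DGLieCoalgebra K L) {n k : ℕ} {f : L →ₗ[K] TensorAlgebra K L}
    (hf : f ∈ combSpan L' n) (hk : n + 2 ≤ k) (x : L) : lenGE k (f x) = 0 := by
  have h := LinearMap.congr_fun (lenGE_succ_comp L' hf) x
  rw [LinearMap.comp_apply, LinearMap.zero_apply] at h
  rw [← lenGE_mul_lenGE' hk, Module.End.mul_apply, h, map_zero]

/-- Values of f have exactly n + 1 letters, so only the positions i < n carry a genuine exchange. -/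
theorem exch_apply_eq_self (L' : DGLieCoalgebra K L) {n i : ℕ} {f : L →ₗ[K] TensorAlgebra K L}
    (hf : f ∈ combSpan L' n) (hi : n ≤ i) (x : L) : exch L'.toDGModule i (f x) = f x := by
  rw [exch, LinearMap.sub_apply, ← exchDiff_mul_lenGE, Module.End.mul_apply,
    lenGE_apply_eq_zero L' hf (by omega), map_zero, sub_zero, Module.End.one_apply]

theorem cobr_apply_eq_zero (L' : DGLieCoalgebra K L) {n i : ℕ} {f : L →ₗ[K] TensorAlgebra K L}
    (hf : f ∈ combSpan L' n) (hi : n < i) (x : L) : cobr L' i (f x) = 0 := by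
  rw [← cobr_mul_lenGE, Module.End.mul_apply, lenGE_apply_eq_zero L' hf (by omega), map_zero]

theorem cobr_exch_apply (L' : DGLieCoalgebra K L) {n i : ℕ} {f : L →ₗ[K] TensorAlgebra K L}
    (hf : f ∈ combSpan L' n) (hi : i < n) (x : L) :
    cobr L' i (exch L'.toDGModule i (f x)) =
      exch L'.toDGModule (i + 1) (exch L'.toDGModule i (cobr L' (i + 1) (f x))) := by
  have h := LinearMap.congr_fun (cobr_mul_exch_self L' i) (f x)
  simp only [Module.End.mul_apply] at h
  rw [lenGE_apply_eq_self L' hf (by omega)] at h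
  exact h

theorem cobr_succ_exch_apply (L' : DGLieCoalgebra K L) {n i : ℕ}
    {f : L →ₗ[K] TensorAlgebra K L} (hf : f ∈ combSpan L' n) (hi : i < n) (x : L) :
    cobr L' (i + 1) (exch L'.toDGModule i (f x)) =
      exch L'.toDGModule i (exch L'.toDGModule (i + 1) (cobr L' i (f x))) := by
  have h := LinearMap.congr_fun (cobr_succ_mul_exch L' i) (f x)
  simp only [Module.End.mul_apply] at h
  rw [lenGE_apply_eq_self L' hf (by omega)] at h
  exact h

/-- At position 0 of an iterated cobracket, co-Jacobi produces the next iterated cobracket minus its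
exchange; at later positions the outermost cobracket is a spectator. -/
theorem cobr_comp_comb_mem (L' : DGLieCoalgebra K L) (n i : ℕ) :
    cobr L' i ∘ₗ comb L' n ∈ combSpan L' (n + 1) := by
  induction n generalizing i with
  | zero =>
    cases i with
    | zero =>
      have h : cobr L' 0 ∘ₗ comb L' 0 = comb L' (0 + 1) := by
        ext1 x
        rw [LinearMap.comp_apply, comb, comb, comb, cobr_zero_ι, coact_apply]
        induction L'.cobracket x using TensorProduct.induction_on with
        | zero => simp
        | add a b ha hb => simp only [map_add, ha, hb]
        | tmul x y => simp
      rw [h]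
      exact comb_mem L' _
    | succ i =>
      have h : cobr L' (i + 1) ∘ₗ comb L' 0 = 0 := by
        ext1 x
        exact cobr_apply_eq_zero L' (comb_mem L' 0) (by omega) x
      rw [h]
      exact zero_mem _
  | succ n ih =>
    cases i with
    | zero =>
      rw [comb, cobr_zero_coact]
      exact sub_mem (comb_mem L' (n + 1 + 1)) (exch_comp_mem L' _ (comb_mem L' (n + 1 + 1)))
    | succ i =>
      rw [comb, cobr_succ, tail_coact]
      exact coact_mem L' (ih i)

/-- Cobrackets can be moved to the right of permutations, changing positions, until they meet the
iterated cobracket itself. The induction is uniform in i since the position changes on the way. -/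
theorem cobr_comp_mem (L' : DGLieCoalgebra K L) {n : ℕ} {f : L →ₗ[K] TensorAlgebra K L}
    (hf : f ∈ combSpan L' n) (i : ℕ) : cobr L' i ∘ₗ f ∈ combSpan L' (n + 1) := by
  induction hf using combSpan_induction generalizing i with
  | zero => rw [LinearMap.comp_zero]; exact zero_mem _
  | add f g _ _ hf hg => rw [LinearMap.comp_add]; exact add_mem (hf i) (hg i)
  | smul c f _ hf => rw [LinearMap.comp_smul]; exact Submodule.smul_mem _ c (hf i)
  | comb => exact cobr_comp_comb_mem L' n i
  | exch j f hf ih =>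
    rcases le_or_gt n j with hj | hj
    · have h : exch L'.toDGModule j ∘ₗ f = f := LinearMap.ext (exch_apply_eq_self L' hf hj)
      rw [h]; exact ih i
    rcases lt_trichotomy i j with hij | rfl | hij
    · rw [← LinearMap.comp_assoc, ← Module.End.mul_eq_comp, cobr_mul_exch_of_lt L' hij,
        Module.End.mul_eq_comp, LinearMap.comp_assoc]
      exact exch_comp_mem L' _ (ih i)
    · have h : cobr L' i ∘ₗ exch L'.toDGModule i ∘ₗ f =
          exch L'.toDGModule (i + 1) ∘ₗ exch L'.toDGModule i ∘ₗ cobr L' (i + 1) ∘ₗ f :=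
        LinearMap.ext (cobr_exch_apply L' hf hj)
      rw [h]
      exact exch_comp_mem L' _ (exch_comp_mem L' _ (ih _))
    · rcases (Nat.succ_le_of_lt hij).eq_or_lt with rfl | hij'
      · have h : cobr L' (j + 1) ∘ₗ exch L'.toDGModule j ∘ₗ f =
            exch L'.toDGModule j ∘ₗ exch L'.toDGModule (j + 1) ∘ₗ cobr L' j ∘ₗ f :=
          LinearMap.ext (cobr_succ_exch_apply L' hf hj)
        rw [Nat.succ_eq_add_one, h]
        exact exch_comp_mem L' _ (exch_comp_mem L' _ (ih _))
      · rw [← LinearMap.comp_assoc, ← Module.End.mul_eq_comp, ← exch_mul_cobr_of_lt L' hij',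
          Module.End.mul_eq_comp, LinearMap.comp_assoc]
        exact exch_comp_mem L' _ (ih i)

/-- The maps in `combSpan` are morphisms of comodules from `L` to the tensor space. -/
theorem coadj_comp (L' : DGLieCoalgebra K L) {n : ℕ} {f : L →ₗ[K] TensorAlgebra K L}
    (hf : f ∈ combSpan L' n) : coadj L' ∘ₗ f = coact L' f := by
  induction hf using combSpan_induction with
  | zero => simp
  | add f g _ _ hf hg => rw [LinearMap.comp_add, hf, hg, map_add]
  | smul c f _ hf => rw [LinearMap.comp_smul, hf, map_smul]
  | comb =>
    induction n with
    | zero =>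
      ext1 x
      rw [LinearMap.comp_apply, comb, coadj_ι, coact_apply]
      induction L'.cobracket x using TensorProduct.induction_on with
      | zero => simp
      | add a b ha hb => simp only [map_add, ha, hb]
      | tmul x y => simp
    | succ n ih =>
      -- The coaction on the first letter gives the wanted term minus its exchange, and by induction
      -- the coaction on the remaining letters gives just that exchange; the two exchanged terms
      -- cancel.
      have h := cobr_zero_coact L' (comb L' n)
      have h2 : tail (coadj L') ∘ₗ comb L' (n + 1) = coact L' (comb L' (n + 1)) := by
        rw [comb, tail_coact, ih]
      rw [coadj_eq, LinearMap.add_comp, Module.End.mul_eq_comp, LinearMap.comp_assoc, h2, comb, h]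
      abel
  | exch i f _ hf =>
    have h : coadj L' ∘ₗ exch L'.toDGModule i ∘ₗ f =
        exch L'.toDGModule (i + 1) ∘ₗ coadj L' ∘ₗ f :=
      LinearMap.ext fun x => coadj_exch L' i (f x)
    rw [h, hf, exch_succ_coact]

/-- Cobrackets and signed permutations are chain maps of degree 0, hence so is every combination of
them. -/
theorem wordD_comp (L' : DGLieCoalgebra K L) {n : ℕ} {f : L →ₗ[K] TensorAlgebra K L}
    (hf : f ∈ combSpan L' n) :
    (∀ (i : ℤ) (x : L), x ∈ L'.gr i → f x ∈ wordGr L'.toDGModule i) ∧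
      ∀ x, wordD L'.toDGModule (f x) = f (L'.d x) := by
  induction hf using combSpan_induction with
  | zero => simp
  | add f g _ _ hf hg =>
    exact ⟨fun i x hx => add_mem (hf.1 i x hx) (hg.1 i x hx), fun x => by
      simp only [LinearMap.add_apply, map_add, hf.2, hg.2]⟩
  | smul c f _ hf =>
    exact ⟨fun i x hx => Submodule.smul_mem _ c (hf.1 i x hx), fun x => by
      simp only [LinearMap.smul_apply, map_smul, hf.2]⟩
  | comb =>
    induction n with
    | zero => exact ⟨fun i x hx => ι_mem_wordGr _ hx, fun x => wordD_ι _ x⟩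
    | succ n ih =>
      constructor
      · intro i x hx
        have h : L'.tensorGr L'.toDGModule i ≤
            (wordGr L'.toDGModule i).comap (cons ∘ₗ (comb L' n).lTensor L) := by
          refine Submodule.span_le.2 ?_
          rintro _ ⟨j, k, rfl, y, hy, z, hz, rfl⟩
          have := SetLike.GradedMul.mul_mem (ι_mem_wordGr L'.toDGModule hy) (ih.1 k z hz)
          simpa using this
        exact h (L'.cobracket_mem i x hx)
      · intro x
        rw [comb, coact_apply, coact_apply, L'.cobracket_d]
        induction L'.cobracket x using TensorProduct.induction_on with
        | zero => simp
        | add a b ha hb => simp only [map_add, ha, hb]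
        | tmul y z => simp [DGModule.tensorD, wordD_ι_mul, ih.2]
  | exch i f _ hf =>
    exact ⟨fun j x hx => (isChainEnd_exch _ i).mem _ _ (hf.1 j x hx), fun x => by
      rw [LinearMap.comp_apply, (isChainEnd_exch _ i).comm, hf.2, LinearMap.comp_apply]⟩

/-- A map in `combSpan L' n` factors through iterated cobrackets with n + 1 > k outputs. -/
theorem apply_eq_zero_of_mem_coradical (L' : DGLieCoalgebra K L) {n k : ℕ}
    {f : L →ₗ[K] TensorAlgebra K L} (hf : f ∈ combSpan L' n) (hk : k ≤ n) {x : L}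
    (hx : x ∈ coradical L'.cobracket k) : f x = 0 := by
  induction hf using combSpan_induction with
  | zero => rfl
  | add f g _ _ hf hg => rw [LinearMap.add_apply, hf, hg, add_zero]
  | smul c f _ hf => rw [LinearMap.smul_apply, hf, smul_zero]
  | exch i f _ hf => rw [LinearMap.comp_apply, hf, map_zero]
  | comb =>
    induction k generalizing n x with
    | zero =>
      obtain rfl : x = 0 := hx
      exact map_zero _
    | succ k ih =>
      obtain ⟨n, rfl⟩ := Nat.exists_eq_add_of_le' (show 1 ≤ n by omega)
      obtain ⟨w, hw⟩ := hx
      rw [comb, coact_apply, ← hw]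
      clear hw
      induction w using TensorProduct.induction_on with
      | zero => simp
      | add a b ha hb => simp only [map_add, ha, hb, add_zero]
      | tmul y z =>
        have := ih (n := n) (by omega) z.2
        simp [TensorProduct.mapIncl, this]

end Coadjoint

/-! ### Recursive construction of the components of the section -/

section Construction

variable {K : Type u} [Field K] [CharZero K] {L : Type v} [AddCommGroup L] [Module K L]

/-- The maps δ_i g form a 1-cocycle of the symmetric group on n + 2 letters with values in `combSpan
L' (n + 1)`, and h is a cochain bounding it. The previous component f enters only through the
equation for g, which is what makes the cocycle conditions hold. -/
theorem exists_next (L' : DGLieCoalgebra K L) {n : ℕ} {f g : L →ₗ[K] TensorAlgebra K L}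
    (hg : g ∈ combSpan L' n)
    (hfg : ∀ i x, g x - exch L'.toDGModule i (g x) = cobr L' i (f x)) :
    ∃ h ∈ combSpan L' (n + 1), ∀ i x, h x - exch L'.toDGModule i (h x) = cobr L' i (g x) := by
  let s : ℕ → Module.End K (combSpan L' (n + 1)) := fun i =>
    { toFun := fun f => ⟨exch L'.toDGModule i ∘ₗ f.1, exch_comp_mem L' i f.2⟩
      map_add' := fun f g => Subtype.ext (LinearMap.comp_add _ _ _)
      map_smul' := fun c f => Subtype.ext (LinearMap.comp_smul _ _ _) }
  have hs : ∀ i (f : combSpan L' (n + 1)) x, (s i f).1 x = exch L'.toDGModule i (f.1 x) :=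
    fun _ _ _ => rfl
  have hext : ∀ f g : combSpan L' (n + 1), (∀ x, f.1 x = g.1 x) → f = g :=
    fun f g h => Subtype.ext (LinearMap.ext h)
  have fam : IsCoxeterFamily s (n + 1) := by
    constructor
    · intro i hi
      refine LinearMap.ext fun f => hext _ _ fun x => ?_
      exact LinearMap.congr_fun (exch_mul_self L'.toDGModule i) (f.1 x)
    · intro i j hij hj
      refine LinearMap.ext fun f => hext _ _ fun x => ?_
      exact LinearMap.congr_fun (exch_comm L'.toDGModule hij) (f.1 x)
    · intro i hi
      refine LinearMap.ext fun f => hext _ _ fun x => ?_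
      have h := LinearMap.congr_fun (exch_braid L'.toDGModule i) (f.1 x)
      rw [Module.End.mul_apply, Module.End.mul_apply _ (lenGE (i + 3)),
        lenGE_apply_eq_self L' f.2 (by omega)] at h
      exact h
  have hlt : ∀ {i j : ℕ}, i < j → ∀ t, exch L'.toDGModule (j + 1) (cobr L' i t) =
      cobr L' i (exch L'.toDGModule j t) := fun hij t =>
    (LinearMap.congr_fun (cobr_mul_exch_of_lt L' hij) t).symm
  have hgt : ∀ {i j : ℕ}, i + 1 < j → ∀ t, exch L'.toDGModule i (cobr L' j t) =
      cobr L' j (exch L'.toDGModule i t) := fun hij t =>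
    LinearMap.congr_fun (exch_mul_cobr_of_lt L' hij) t
  obtain ⟨m, hm⟩ := fam.exists_sub_eq (fun i => ⟨cobr L' i ∘ₗ g, cobr_comp_mem L' hg i⟩)
    (fun i hi => hext _ _ fun x => LinearMap.congr_fun (exch_mul_cobr_self L' i) (g x))
    (fun i j hij hj => hext _ _ fun x => by
      -- By naturality and the equation for g, both sides become cobrackets of f at two different
      -- letters, and these commute up to the shift of position.
      obtain ⟨j, rfl⟩ := Nat.exists_eq_add_of_le' (show 1 ≤ j by omega)
      change cobr L' i (g x) - exch L'.toDGModule (j + 1) (cobr L' i (g x)) =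
        cobr L' (j + 1) (g x) - exch L'.toDGModule i (cobr L' (j + 1) (g x))
      rw [hlt (by omega), hgt (by omega), ← map_sub, ← map_sub, hfg, hfg]
      exact LinearMap.congr_fun (cobr_mul_cobr L' (show i < j by omega)) (f x))
    (fun i hi => hext _ _ fun x => by
      change cobr L' i (g x) + exch L'.toDGModule i (cobr L' (i + 1) (g x)) +
          exch L'.toDGModule i (exch L'.toDGModule (i + 1) (cobr L' i (g x))) =
        cobr L' (i + 1) (g x) + exch L'.toDGModule (i + 1) (cobr L' i (g x)) +
          exch L'.toDGModule (i + 1) (exch L'.toDGModule i (cobr L' (i + 1) (g x)))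
      -- Naturality rewrites the double exchanges as cobrackets of σ_i g = g - δ_i f. The terms in g
      -- cancel, and what remains is the co-Jacobi identity for δ_i δ_i f.
      have h1 := cobr_exch_apply L' hg (show i < n by omega) x
      have h2 := cobr_succ_exch_apply L' hg (show i < n by omega) x
      have h3 : exch L'.toDGModule i (g x) = g x - cobr L' i (f x) := by
        rw [← hfg]; abel
      have h4 := LinearMap.congr_fun (exch_mul_self L'.toDGModule i)
        (exch L'.toDGModule (i + 1) (cobr L' i (g x)))
      have h5 := LinearMap.congr_fun (cobr_mul_cobr_self L' i) (f x)
      simp only [Module.End.mul_apply, Module.End.one_apply, LinearMap.sub_apply] at h4 h5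
      rw [← h2, h3] at h4
      rw [← h1, ← h2, ← h4, h3]
      simp only [map_sub, h5]
      abel)
  refine ⟨m.1, m.2, fun i x => ?_⟩
  -- Beyond the last pair of letters both sides vanish, so the equation for all i costs nothing and
  -- can be fed back into the recursion.
  rcases le_or_gt (n + 1) i with hi | hi
  · rw [exch_apply_eq_self L' m.2 hi, sub_self, cobr_apply_eq_zero L' hg (by omega)]
  · exact LinearMap.congr_fun (congrArg Subtype.val (hm i hi)) x

/-- The homogeneous components of the embedding of a Lie coalgebra into its universal enveloping
coalgebra. -/
theorem exists_components (L' : DGLieCoalgebra K L) :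
    ∃ s : ℕ → L →ₗ[K] TensorAlgebra K L, s 0 = ι K ∧ (∀ n, s n ∈ combSpan L' n) ∧
      ∀ n i x, s (n + 1) x - exch L'.toDGModule i (s (n + 1) x) = cobr L' i (s n x) := by
  -- Each step needs the equation linking the current component to its predecessor, so consecutive
  -- pairs are constructed. The zero map serves as predecessor of the inclusion of letters, since
  -- exchanges fix single letters.
  let P : ℕ → (L →ₗ[K] TensorAlgebra K L) × (L →ₗ[K] TensorAlgebra K L) → Prop := fun n p =>
    p.2 ∈ combSpan L' n ∧ ∀ i x, p.2 x - exch L'.toDGModule i (p.2 x) = cobr L' i (p.1 x)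
  have h0 : P 0 (0, ι K) := ⟨comb_mem L' 0, fun i x => by simp⟩
  have step : ∀ n (p : {p // P n p}), ∃ q : {q // P (n + 1) q}, q.1.1 = p.1.2 := by
    rintro n ⟨p, hp1, hp2⟩
    obtain ⟨h, h1, h2⟩ := exists_next L' hp1 hp2
    exact ⟨⟨(p.2, h), h1, h2⟩, rfl⟩
  choose next hnext using step
  let seq : (n : ℕ) → {p // P n p} := fun n => Nat.rec ⟨(0, ι K), h0⟩ next n
  refine ⟨fun n => (seq n).1.2, rfl, fun n => (seq n).2.1, fun n i x => ?_⟩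
  rw [(seq (n + 1)).2.2 i x]
  exact congrArg (fun f : L →ₗ[K] TensorAlgebra K L => cobr L' i (f x)) (hnext n (seq n))

end Construction

end TensorCoalgebra

/-! ### Locally finite sums of linear maps -/

section LocallyFinite

variable {K : Type u} [Field K] {V : Type v} [AddCommGroup V] [Module K V]
variable {W : Type w} [AddCommGroup W] [Module K W]

theorem finsum_eq_sum_range {a : ℕ → W} {k : ℕ} (h : ∀ n, k ≤ n → a n = 0) :
    ∑ᶠ n, a n = ∑ n ∈ Finset.range k, a n := by
  refine finsum_eq_sum_of_support_subset _ fun n hn => ?_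
  by_contra hk
  exact hn (h n (by simpa using hk))

/-- The sum of a locally finite sequence of linear maps. -/
def locallyFiniteSum (a : ℕ → V →ₗ[K] W) (h : ∀ x, ∃ k, ∀ n, k ≤ n → a n x = 0) : V →ₗ[K] W where
  toFun x := ∑ᶠ n, a n x
  map_add' x y := by
    obtain ⟨k, hk⟩ := h x
    obtain ⟨l, hl⟩ := h y
    rw [finsum_eq_sum_range (k := max k l), finsum_eq_sum_range (k := max k l),
      finsum_eq_sum_range (k := max k l), ← Finset.sum_add_distrib]
    · simp only [map_add]
    · exact fun n hn => hl n (le_trans (le_max_right _ _) hn)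
    · exact fun n hn => hk n (le_trans (le_max_left _ _) hn)
    · intro n hn
      rw [map_add, hk n (le_trans (le_max_left _ _) hn), hl n (le_trans (le_max_right _ _) hn),
        add_zero]
  map_smul' c x := by
    obtain ⟨k, hk⟩ := h x
    rw [finsum_eq_sum_range hk, finsum_eq_sum_range (k := k), RingHom.id_apply, Finset.smul_sum]
    · simp only [map_smul]
    · intro n hn
      rw [map_smul, hk n hn, smul_zero]

theorem locallyFiniteSum_apply {a : ℕ → V →ₗ[K] W} (h : ∀ x, ∃ k, ∀ n, k ≤ n → a n x = 0) {x : V}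
    {k : ℕ} (hk : ∀ n, k ≤ n → a n x = 0) :
    locallyFiniteSum a h x = ∑ n ∈ Finset.range k, a n x :=
  finsum_eq_sum_range hk

theorem exists_lTensor_locallyFiniteSum {a : ℕ → V →ₗ[K] W}
    (h : ∀ x, ∃ k, ∀ n, k ≤ n → a n x = 0) {U : Type*} [AddCommGroup U] [Module K U]
    (w : U ⊗[K] V) : ∃ k, ∀ l, k ≤ l →
      (locallyFiniteSum a h).lTensor U w = ∑ n ∈ Finset.range l, (a n).lTensor U w := by
  induction w using TensorProduct.induction_on with
  | zero => exact ⟨0, by simp⟩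
  | add s t hs ht =>
    obtain ⟨k, hk⟩ := hs
    obtain ⟨l, hl⟩ := ht
    refine ⟨max k l, fun m hm => ?_⟩
    simp only [map_add, Finset.sum_add_distrib, hk m (le_trans (le_max_left _ _) hm),
      hl m (le_trans (le_max_right _ _) hm)]
  | tmul u x =>
    obtain ⟨k, hk⟩ := h x
    refine ⟨k, fun l hl => ?_⟩
    simp only [LinearMap.lTensor_tmul]
    rw [locallyFiniteSum_apply h fun n hn => hk n (hl.trans hn), TensorProduct.tmul_sum]

end LocallyFinite

namespace TensorCoalgebra

open TensorAlgebra (ι)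

/-! ### The cocommutator coaction on words, and the coradical filtration by length -/

section Cocommutator

variable {K : Type u} [Field K] {L : Type v} [AddCommGroup L] [Module K L]

/-- The cocommutator of the deconcatenation coproduct, followed by the projection of the first
factor onto `L`. -/
def projCocomm (M : DGModule K L) : Module.End K (TensorAlgebra K L) :=
  cons ∘ₗ TensorAlgebra.ιInv.rTensor (TensorAlgebra K L) ∘ₗ
    (LinearMap.id - (words M).swap (words M)) ∘ₗ deconc

/-- Only the cut after the first letter survives, and concatenation glues the word together again.
-/
theorem cons_ιInv_deconc (t : TensorAlgebra K L) :
    cons (TensorAlgebra.ιInv.rTensor (TensorAlgebra K L) (deconc t)) = lenGE 2 t := by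
  induction t using induction_left with
  | one => simp [deconc_one]
  | add s t hs ht => simp [hs, ht]
  | smul c t ht => simp [ht]
  | ι_mul x t _ =>
    have h : ∀ w : TensorAlgebra K L ⊗[K] TensorAlgebra K L,
        TensorAlgebra.ιInv.rTensor (TensorAlgebra K L)
          ((LinearMap.mulLeft K (ι K x)).rTensor _ (pos.rTensor _ w)) =
            (0 : L ⊗[K] TensorAlgebra K L) := by
      intro w
      induction w using TensorProduct.induction_on with
      | zero => simp
      | add a b ha hb => simp only [map_add, ha, hb, add_zero]
      | tmul a b => simp [ιInv_ι_mul, pos]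
    have h2 := ιInv_ι_mul x (1 : TensorAlgebra K L)
    rw [mul_one, map_one, one_smul] at h2
    rw [deconc_ι_mul, map_add, ← pos_rTensor_deconc t, h, add_zero, LinearMap.rTensor_tmul, h2,
      cons_tmul, lenGE_succ_ι_mul, lenGE_one]

theorem ι_ιInv_add_lenGE_two (t : TensorAlgebra K L) :
    ι K (TensorAlgebra.ιInv t) + lenGE 2 t = pos t := by
  refine LinearMap.congr_fun (f := ι K ∘ₗ TensorAlgebra.ιInv + lenGE 2) (g := pos)
    (ext_letter' ?_ fun x t => ?_) t
  · simp [ιInv_one, pos_one]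
  · simp only [LinearMap.add_apply, LinearMap.comp_apply, ιInv_ι_mul, lenGE_succ_ι_mul, lenGE_one,
      pos_ι_mul]
    simp [pos, mul_sub, Algebra.algebraMap_eq_smul_one]

theorem cons_ιInv_swap_ι_tmul (M : DGModule K L) (x : L) (t : TensorAlgebra K L) :
    cons (TensorAlgebra.ιInv.rTensor (TensorAlgebra K L) ((words M).swap (words M) (ι K x ⊗ₜ t))) =
      exch M 0 (ι K x * ι K (TensorAlgebra.ιInv t)) := by
  induction x using M.hom_induction with
  | zero => simp
  | add a b ha hb => simp only [map_add, TensorProduct.add_tmul, add_mul, ha, hb]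
  | mem i x hx =>
    induction t using (words M).hom_induction with
    | zero => simp
    | add a b ha hb => simp only [map_add, TensorProduct.tmul_add, mul_add, ha, hb]
    | mem j t ht =>
      have hx' : ι K x ∈ (words M).gr i := ι_mem_wordGr M hx
      rw [DGModule.swap_tmul _ _ hx' ht, exch_zero_ι_mul_ι M hx (ιInv_mem M ht), map_smul, map_smul,
        LinearMap.rTensor_tmul, cons_tmul]

/-- After the symmetry, the projection selects the last letter and puts it in front. For a word
beginning with x this means bringing it to the second place and then exchanging it with x. -/
theorem cons_ιInv_swap_mulLeft (M : DGModule K L) (x : L)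
    (w : TensorAlgebra K L ⊗[K] TensorAlgebra K L) :
    cons (TensorAlgebra.ιInv.rTensor (TensorAlgebra K L) ((words M).swap (words M)
      ((LinearMap.mulLeft K (ι K x)).rTensor _ w))) =
      exch M 0 (ι K x * cons (TensorAlgebra.ιInv.rTensor (TensorAlgebra K L)
        ((words M).swap (words M) w))) := by
  induction x using M.hom_induction with
  | zero => simp
  | add a b ha hb =>
    have h : LinearMap.mulLeft K (ι K (a + b)) =
        LinearMap.mulLeft K (ι K a) + LinearMap.mulLeft K (ι K b) := by
      ext1 t; simp [add_mul]
    rw [h, LinearMap.rTensor_add, LinearMap.add_apply, map_add, map_add, map_add, ha, hb, map_add,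
      add_mul, map_add]
  | mem i x hx =>
    induction w using (words M).tensor_induction (words M) with
    | zero => simp
    | add a b ha hb => simp only [map_add, mul_add, ha, hb]
    | tmul k j a ha b hb =>
      have h : ι K x * a ∈ (words M).gr (i + k) :=
        SetLike.GradedMul.mul_mem (A := wordGr M) (ι_mem_wordGr M hx) ha
      rw [LinearMap.rTensor_tmul, LinearMap.mulLeft_apply, DGModule.swap_tmul _ _ h hb,
        DGModule.swap_tmul _ _ ha hb]
      simp only [map_smul, LinearMap.rTensor_tmul, cons_tmul, mul_smul_comm]
      rw [exch_zero_ι_mul_ι_mul M hx (ιInv_mem M hb), smul_smul, add_mul, zpow_add₀ (by simp),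
        mul_comm]

/-- On words with at least two letters the operator is 1 - ρ, where the rotation ρ brings the last
letter to the front. With ρ = σ_0 · tail ρ this is 1 - σ_0 plus σ_0 applied to the same expression
behind the first letter, a recursion of the same shape as `coadj_eq`. -/
theorem projCocomm_eq (M : DGModule K L) :
    projCocomm M = exchDiff M 0 + exch M 0 * tail (projCocomm M) := by
  refine ext_letter' (by simp [projCocomm, deconc_one]) fun x t => ?_
  have h1 : ∀ t, projCocomm M t = lenGE 2 t - cons (TensorAlgebra.ιInv.rTensor (TensorAlgebra K L)
      ((words M).swap (words M) (deconc t))) := by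
    intro t
    rw [← cons_ιInv_deconc]
    simp [projCocomm]
  -- The element pos t - t is a scalar, so this is a one-letter word; it accounts for the case in
  -- which nothing follows x.
  have h2 : exch M 0 (ι K x * (pos t - t)) = ι K x * (pos t - t) := by
    simp [pos, Algebra.algebraMap_eq_smul_one]
  have h3 := ι_ιInv_add_lenGE_two t
  rw [h1, LinearMap.add_apply, Module.End.mul_apply, tail_ι_mul, h1, deconc_ι_mul, map_add,
    map_add, map_add, cons_ιInv_swap_ι_tmul, cons_ιInv_swap_mulLeft, lenGE_succ_ι_mul, lenGE_one,
    ιInv_pos, mul_sub, map_sub, eq_sub_of_add_eq h3]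
  have h4 : exchDiff M 0 (ι K x * t) = ι K x * t - exch M 0 (ι K x * t) := by simp [exch]
  rw [h4]
  simp only [mul_sub, map_sub] at h2 ⊢
  rw [eq_add_of_sub_eq h2]
  abel

/-- Both operators satisfy the same recursion, with source terms `exchDiff` and `cobr`, which agree
on t. The difference Z therefore propagates without source from one position to the next, and it
vanishes at positions beyond the length of t. -/
theorem projCocomm_of_mem_relKer (L' : DGLieCoalgebra K L) {t : TensorAlgebra K L}
    (ht : t ∈ relKer L') : projCocomm L'.toDGModule t = coadj L' t := by
  let Z := projCocomm L'.toDGModule - coadj L'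
  have hZ : Z = rel L' (0 + 1) + exch L'.toDGModule 0 * tail Z := by
    change projCocomm L'.toDGModule - coadj L' = rel L' (0 + 1) + exch L'.toDGModule 0 * tail Z
    rw [projCocomm_eq, coadj_eq, rel, map_sub, mul_sub]
    abel
  have key : ∀ n, tail^[n] Z = rel L' (n + 1) + exch L'.toDGModule n * tail^[n + 1] Z := by
    intro n
    induction n with
    | zero => exact hZ
    | succ n ih =>
      rw [Function.iterate_succ_apply', ih, map_add, ← exch_succ_mul_tail,
        ← Function.iterate_succ_apply' tail (n + 1), rel, rel, map_sub, ← exchDiff_succ, ← cobr_succ]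
  have hlen : ∀ n, tail^[n] Z * lenGE n = tail^[n] Z := by
    intro n
    induction n with
    | zero => rfl
    | succ n ih => rw [Function.iterate_succ_apply', lenGE_succ, ← tail_mul, ih]
  -- Descent from far positions: the relation at each position annihilates t itself, so t is never
  -- modified on the way.
  have hdown : ∀ n, (tail^[n] Z) t = 0 → Z t = 0 := by
    intro n
    induction n with
    | zero => exact id
    | succ n ih =>
      intro h
      apply ih
      rw [key, LinearMap.add_apply, Module.End.mul_apply, h, map_zero, mem_relKer.1 ht, add_zero]
  obtain ⟨k, hk⟩ := exists_lenGE_eq_zero t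
  have h := hdown k (by rw [← hlen, Module.End.mul_apply, hk k le_rfl, map_zero])
  exact sub_eq_zero.1 h

/-- A left factor with at least j letters, together with a nonempty right factor, comes from a word
with at least j + 1 letters. -/
theorem rTensor_lenGE_deconc (j : ℕ) (t : TensorAlgebra K L) :
    (lenGE j).rTensor (TensorAlgebra K L) (deconc (lenGE (j + 1) t)) =
      (lenGE j).rTensor (TensorAlgebra K L) (deconc t) := by
  induction j generalizing t with
  | zero => rw [zero_add, lenGE_one, deconc_pos]
  | succ j ih =>
    refine LinearMap.congr_fun
      (f := (lenGE (j + 1)).rTensor (TensorAlgebra K L) ∘ₗ deconc ∘ₗ lenGE (j + 1 + 1))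
      (g := (lenGE (j + 1)).rTensor (TensorAlgebra K L) ∘ₗ deconc)
      (ext_letter' (by simp [deconc_one]) fun x t => ?_) t
    simp only [LinearMap.comp_apply]
    rw [lenGE_succ_ι_mul, deconc_ι_mul, deconc_ι_mul, map_add, map_add,
      rTensor_rTensor_mulLeft (lenGE_succ_ι_mul j x), rTensor_rTensor_mulLeft (lenGE_succ_ι_mul j x),
      ih, LinearMap.rTensor_tmul, LinearMap.rTensor_tmul]
    cases j with
    | zero => rw [zero_add, lenGE_one, pos_pos]
    | succ j => rw [lenGE_succ_succ_ι, TensorProduct.zero_tmul, TensorProduct.zero_tmul]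

/-- The counterpart for the right factor. Removing a first letter lowers the bound on the word but
not that on the right factor, so the induction needs every m up to the bound j + 1 that is finally
used. -/
theorem lTensor_lenGE_deconc {j m : ℕ} (hm : m ≤ j + 1) (t : TensorAlgebra K L) :
    (lenGE j).lTensor (TensorAlgebra K L) (deconc (lenGE m t)) =
      (lenGE j).lTensor (TensorAlgebra K L) (deconc t) := by
  induction m generalizing t with
  | zero => rfl
  | succ m ih =>
    refine LinearMap.congr_fun
      (f := (lenGE j).lTensor (TensorAlgebra K L) ∘ₗ deconc ∘ₗ lenGE (m + 1))
      (g := (lenGE j).lTensor (TensorAlgebra K L) ∘ₗ deconc)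
      (ext_letter' (by simp [deconc_one]) fun x t => ?_) t
    have h : ∀ w : TensorAlgebra K L ⊗[K] TensorAlgebra K L,
        (lenGE j).lTensor (TensorAlgebra K L) ((LinearMap.mulLeft K (ι K x)).rTensor _ w) =
        (LinearMap.mulLeft K (ι K x)).rTensor _ ((lenGE j).lTensor (TensorAlgebra K L) w) := by
      intro w
      rw [← LinearMap.comp_apply, ← LinearMap.comp_apply, LinearMap.lTensor_comp_rTensor,
        LinearMap.rTensor_comp_lTensor]
    simp only [LinearMap.comp_apply]
    rw [lenGE_succ_ι_mul, deconc_ι_mul, deconc_ι_mul, map_add, map_add, h, h, ih (by omega),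
      LinearMap.lTensor_tmul, LinearMap.lTensor_tmul]
    congr 2
    cases j with
    | zero =>
      obtain rfl : m = 0 := by omega
      rfl
    | succ j =>
      rw [← lenGE_one, ← Module.End.mul_apply, ← Module.End.mul_apply, ← Module.End.mul_apply,
        mul_assoc, ← mul_assoc, lenGE_mul_lenGE' (by omega), lenGE_mul_lenGE' (by omega)]

/-- Cutting a word into two nonempty parts makes both strictly shorter, so words with at most k
letters lie in the k-th step of the filtration. -/
theorem mem_coradical_of_lenGE_eq_zero (L' : DGLieCoalgebra K L) {k : ℕ}
    {c : envelopingSubmodule L'} (hc : lenGE (k + 1) (c : TensorAlgebra K L) = 0) :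
    c ∈ coradical (envelopingCoalgebra L').comul k := by
  induction k generalizing c with
  | zero =>
    have h := (envelopingSubmodule_isLieSubcoalgebra L').reduced c c.2
    rw [zero_add, lenGE_one, pos, LinearMap.sub_apply, LinearMap.comp_apply,
      AlgHom.toLinearMap_apply, h, map_zero, sub_zero] at hc
    exact Subtype.ext hc
  | succ k ih =>
    -- A one-element family of operators: its kernel consists of the elements with at most k
    -- letters, so membership of the coproduct in the tensor square can be tested on each factor.
    let Q : Unit → envelopingSubmodule L' →ₗ[K] TensorAlgebra K L :=
      fun _ => lenGE (k + 1) ∘ₗ (envelopingSubmodule L').subtype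
    have hQ : ⨅ i, LinearMap.ker (Q i) ≤ coradical (envelopingCoalgebra L').comul k := by
      intro c hc
      simp only [Submodule.mem_iInf, LinearMap.mem_ker] at hc
      exact ih (hc ())
    have hmap : ∀ w, (lenGE (k + 1)).rTensor (TensorAlgebra K L) (TensorProduct.mapIncl _ _ w) =
        (envelopingSubmodule L').subtype.lTensor (TensorAlgebra K L) ((Q ()).rTensor _ w) := by
      intro w
      induction w using TensorProduct.induction_on with
      | zero => simp
      | add a b ha hb => simp only [map_add, ha, hb]
      | tmul a b => simp [TensorProduct.mapIncl, Q]
    have hmap' : ∀ w, (lenGE (k + 1)).lTensor (TensorAlgebra K L) (TensorProduct.mapIncl _ _ w) =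
        (envelopingSubmodule L').subtype.rTensor (TensorAlgebra K L) ((Q ()).lTensor _ w) := by
      intro w
      induction w using TensorProduct.induction_on with
      | zero => simp
      | add a b ha hb => simp only [map_add, ha, hb]
      | tmul a b => simp [TensorProduct.mapIncl, Q]
    obtain ⟨w, hw⟩ := mem_range_mapIncl_iInf_ker Q (envelopingComul L' c)
      (fun _ => by
        apply Module.Flat.lTensor_preserves_injective_linearMap (M := TensorAlgebra K L) _
          (envelopingSubmodule L').subtype_injective
        rw [map_zero, ← hmap, mapIncl_envelopingComul, ← rTensor_lenGE_deconc, hc, map_zero,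
          map_zero])
      (fun _ => by
        apply Module.Flat.rTensor_preserves_injective_linearMap (M := TensorAlgebra K L) _
          (envelopingSubmodule L').subtype_injective
        rw [map_zero, ← hmap', mapIncl_envelopingComul,
          ← lTensor_lenGE_deconc (m := k + 1 + 1) le_rfl, hc, map_zero, map_zero])
    refine ⟨TensorProduct.map (Submodule.inclusion hQ) (Submodule.inclusion hQ) w, ?_⟩
    change _ = envelopingComul L' c
    rw [← hw, TensorProduct.mapIncl, TensorProduct.mapIncl, ← LinearMap.comp_apply,
      ← TensorProduct.map_comp]
    rfl

end Cocommutator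

end TensorCoalgebra

/-! ### The comodule section of the projection -/

section Section

open TensorCoalgebra

variable {K : Type u} [Field K] {L : Type v} [AddCommGroup L] [Module K L]

/-- Identifies the coaction defined by the coalgebra structure with an explicit operator on words,
where it can be compared with the coadjoint coaction. -/
theorem cons_map_envelopingProj_cocommutator (L' : DGLieCoalgebra K L)
    (c : envelopingSubmodule L') :
    cons ((envelopingSubmodule L').subtype.lTensor L (TensorProduct.map (envelopingProj L')
      LinearMap.id ((envelopingCoalgebra L').cocommutator c))) =
      projCocomm L'.toDGModule (c : TensorAlgebra K L) := by
  have h1 : ∀ w, (envelopingSubmodule L').subtype.lTensor L (TensorProduct.map (envelopingProj L')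
      LinearMap.id w) =
      TensorAlgebra.ιInv.rTensor (TensorAlgebra K L) (TensorProduct.mapIncl _ _ w) := by
    intro w
    induction w using TensorProduct.induction_on with
    | zero => simp
    | add a b ha hb => simp only [map_add, ha, hb]
    | tmul a b => simp [TensorProduct.mapIncl, envelopingProj]
  have h2 : TensorProduct.mapIncl _ _ ((envelopingCoalgebra L').cocommutator c) =
      deconc (c : TensorAlgebra K L) - (words L'.toDGModule).swap (words L'.toDGModule)
        (deconc (c : TensorAlgebra K L)) := by
    rw [← mapIncl_envelopingComul, ← DGModule.mapIncl_swap _ _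
      (envelopingSubmodule_isLieSubcoalgebra L').homogeneous
      (envelopingSubmodule_isLieSubcoalgebra L').d_mem, ← map_sub]
    rfl
  rw [h1, h2]
  rfl

/-- The projection of the universal enveloping coalgebra of a conilpotent Lie coalgebra `L` onto `L`
has a section which is a filtered morphism of complexes and of `L`-comodules. -/
theorem exists_comodule_section [CharZero K] (L' : DGLieCoalgebra K L) (hL : L'.IsConilpotent) :
    ∃ s : L →ₗ[K] envelopingSubmodule L',
      (∀ (i : ℤ) (x : L), x ∈ L'.gr i → s x ∈ (envelopingCoalgebra L').gr i) ∧
      (∀ x, s (L'.d x) = (envelopingCoalgebra L').d (s x)) ∧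
      (∀ x, envelopingProj L' (s x) = x) ∧
      (∀ k, ∀ x ∈ coradical L'.cobracket k, s x ∈ coradical (envelopingCoalgebra L').comul k) ∧
      ∀ x, TensorProduct.map (envelopingProj L') LinearMap.id
        ((envelopingCoalgebra L').cocommutator (s x)) = s.lTensor L (L'.cobracket x) := by
  obtain ⟨a, ha0, ha, hrel⟩ := exists_components L'
  have hvan : ∀ {x k}, x ∈ coradical L'.cobracket k → ∀ n, k ≤ n → a n x = 0 :=
    fun hx n hn => apply_eq_zero_of_mem_coradical L' (ha n) hn hx
  have hfin : ∀ x, ∃ k, ∀ n, k ≤ n → a n x = 0 := fun x => (hL x).imp fun k hk => hvan hk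
  let s := locallyFiniteSum a hfin
  have hs : ∀ {x k}, (∀ n, k ≤ n → a n x = 0) → s x = ∑ n ∈ Finset.range k, a n x :=
    fun hk => locallyFiniteSum_apply hfin hk
  have hmem : ∀ x, s x ∈ relKer L' := by
    intro x
    obtain ⟨k, hk⟩ := hfin x
    refine mem_relKer.2 fun i => ?_
    cases i with
    | zero =>
      rw [hs hk, map_sum]
      refine Finset.sum_eq_zero fun n _ => ?_
      rw [rel, LinearMap.sub_apply, lenGE_apply_eq_self L' (ha n) (by omega), Module.End.one_apply,
        sub_self]
    | succ i =>
      have e : ∀ n, exchDiff L'.toDGModule i (a (n + 1) x) = cobr L' i (a n x) := by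
        intro n
        rw [← hrel]
        simp [exch]
      have e0 : exchDiff L'.toDGModule i (a 0 x) = 0 := by rw [ha0, exchDiff_ι]
      rw [rel, LinearMap.sub_apply, sub_eq_zero]
      -- The relation matches the exchange difference of the (n + 1)-st component with the cobracket
      -- of the n-th. Taking one more term on the left, where the first contributes nothing, makes
      -- the sums agree term by term.
      conv_lhs => rw [hs (k := k + 1) fun n hn => hk n (by omega)]
      rw [hs hk, map_sum, map_sum, Finset.sum_range_succ', e0, add_zero]
      exact Finset.sum_congr rfl fun n _ => e n
  let S : L →ₗ[K] envelopingSubmodule L' :=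
    s.codRestrict _ fun x => relKer_le_envelopingSubmodule L' (hmem x)
  have hS : ∀ x, (S x : TensorAlgebra K L) = s x := fun x => rfl
  refine ⟨S, ?_, ?_, ?_, ?_, ?_⟩
  · intro i x hx
    change s x ∈ wordGr L'.toDGModule i
    obtain ⟨k, hk⟩ := hfin x
    rw [hs hk]
    exact sum_mem fun n _ => (wordD_comp L' (ha n)).1 i x hx
  · intro x
    apply Subtype.ext
    change s (L'.d x) = wordD L'.toDGModule (s x)
    obtain ⟨k, hk⟩ := hfin x
    have e : ∀ n, a n (L'.d x) = wordD L'.toDGModule (a n x) :=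
      fun n => ((wordD_comp L' (ha n)).2 x).symm
    rw [hs hk, hs (k := k) fun n hn => by rw [e, hk n hn, map_zero], map_sum]
    exact Finset.sum_congr rfl fun n _ => e n
  · intro x
    change TensorAlgebra.ιInv (s x) = x
    obtain ⟨k, hk⟩ := hfin x
    rw [hs (k := k + 1) fun n hn => hk n (by omega), map_sum, Finset.sum_range_succ']
    -- All components but the first consist of words with at least two letters, so the projection to
    -- L sees only a_0.
    have e : ∀ n, TensorAlgebra.ιInv (a (n + 1) x) = (0 : L) := by
      intro n
      have h1 := lenGE_apply_eq_self L' (ha (n + 1)) (show 2 ≤ n + 1 + 1 by omega) x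
      have h2 := lenGE_apply_eq_self L' (ha (n + 1)) (show 1 ≤ n + 1 + 1 by omega) x
      have h3 := ι_ιInv_add_lenGE_two (a (n + 1) x)
      rw [← lenGE_one, h1, h2, add_eq_right] at h3
      exact TensorAlgebra.ι_leftInverse.injective (h3.trans (map_zero _).symm)
    simp [e, ha0, TensorAlgebra.ι_leftInverse x]
  · intro k x hx
    -- For x in the k-th step only a_0, …, a_{k-1} contribute, and their values have at most k
    -- letters.
    apply mem_coradical_of_lenGE_eq_zero
    rw [hS, hs (hvan hx), map_sum]
    refine Finset.sum_eq_zero fun n hn => ?_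
    exact lenGE_apply_eq_zero L' (ha n) (by have := Finset.mem_range.1 hn; omega) x
  · intro x
    -- Both sides are embedded into words. There the left side becomes the coadjoint coaction of s
    -- x, and the identity follows component by component from `coadj_comp`.
    apply Module.Flat.lTensor_preserves_injective_linearMap (M := L) _
      (envelopingSubmodule L').subtype_injective
    apply cons_injective
    rw [cons_map_envelopingProj_cocommutator, hS, projCocomm_of_mem_relKer L' (hmem x),
      ← LinearMap.lTensor_comp_apply]
    change coadj L' (s x) = cons (s.lTensor L (L'.cobracket x))
    obtain ⟨k, hk⟩ := hfin x
    -- The sum may need more terms on the second tensor factors of the cobracket of x than on x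
    -- itself, hence the common bound max k l.
    obtain ⟨l, hl⟩ := exists_lTensor_locallyFiniteSum hfin (L'.cobracket x)
    rw [hs (k := max k l) fun n hn => hk n ((le_max_left _ _).trans hn), hl _ (le_max_right _ _),
      map_sum, map_sum]
    refine Finset.sum_congr rfl fun n _ => ?_
    exact LinearMap.congr_fun (coadj_comp L' (ha n)) x

end Section

end DGPBW

end

/-- Let `L` be a conilpotent dg Lie coalgebra and `A` a commutative dg algebra over a field of
characteristic zero. The map `hom(L, A) → hom(Uᶜ L, A)` induced by the projection `Uᶜ L → L` admits
a left inverse `r` (a family of linear maps `r n` in each degree `n`) which is a chain map, preserves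
the filtrations induced by the coradical filtrations, and is a morphism of `hom(L, A)`-modules. -/
theorem proposition3p3 {K : Type*} [Field K] [CharZero K]
    {L : Type*} [AddCommGroup L] [Module K L] (L' : DGPBW.DGLieCoalgebra K L)
    (hL : L'.IsConilpotent)
    {A : Type*} [NonUnitalRing A] [Module K A] [IsScalarTower K A A] [SMulCommClass K A A]
    (A' : DGPBW.CommDGAlgebra K A) :
    ∃ r : (n : ℤ) →
        DGPBW.homGr (DGPBW.envelopingCoalgebra L').toDGModule A'.toDGModule n →ₗ[K]
          DGPBW.homGr L'.toDGModule A'.toDGModule n,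
      -- `r` is a chain map
      (∀ (n : ℤ) (f : DGPBW.homGr (DGPBW.envelopingCoalgebra L').toDGModule A'.toDGModule n),
        r (n - 1) (DGPBW.homD (DGPBW.envelopingCoalgebra L').toDGModule A'.toDGModule n f) =
          DGPBW.homD L'.toDGModule A'.toDGModule n (r n f)) ∧
      -- `r` is left inverse to the map induced by the projection
      (∀ (n : ℤ) (f : DGPBW.homGr L'.toDGModule A'.toDGModule n),
        r n (DGPBW.homProj L' A'.toDGModule n f) = f) ∧
      -- `r` preserves the filtrations
      (∀ (n : ℤ) (k : ℕ),
        ∀ f ∈ DGPBW.homFil (DGPBW.envelopingCoalgebra L').toDGModule A'.toDGModule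
            (DGPBW.envelopingCoalgebra L').comul n k,
          r n f ∈ DGPBW.homFil L'.toDGModule A'.toDGModule L'.cobracket n k) ∧
      -- `r` is a morphism of modules over the Lie algebra `hom(L, A)`
      (∀ (m n : ℤ) (f : DGPBW.homGr L'.toDGModule A'.toDGModule m)
          (g : DGPBW.homGr (DGPBW.envelopingCoalgebra L').toDGModule A'.toDGModule n),
        r (m + n) (DGPBW.coalgebraBracket (DGPBW.envelopingCoalgebra L') A'
            (DGPBW.homProj L' A'.toDGModule m f) g) =
          DGPBW.lieCoalgebraBracket L' A' f (r n g)) := by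
  obtain ⟨s, hgr, hd, hproj, hfil, hcom⟩ := DGPBW.exists_comodule_section L' hL
  refine ⟨fun n =>
    { toFun := fun g => ⟨g.1 ∘ₗ s, fun i x hx => g.2 i _ (hgr i x hx)⟩
      map_add' := fun _ _ => rfl
      map_smul' := fun _ _ => rfl }, ?_, ?_, ?_, ?_⟩
  · intro n g
    apply Subtype.ext
    ext x
    simp [DGPBW.homD, hd]
  · intro n f
    apply Subtype.ext
    ext x
    exact congrArg f.1 (hproj x)
  · exact fun n k g hg x hx => hg _ (hfil k x hx)
  · intro m n f g
    apply Subtype.ext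
    ext x
    -- Commutativity of A rewrites the second term of the graded commutator as the first one
    -- evaluated on τΔ. The bracket is thus evaluated on the cocommutator, to which the comodule
    -- property of s applies.
    have h1 := DGPBW.mul_map_swap _ A' (DGPBW.homProj L' A'.toDGModule m f).2 g.2
      ((DGPBW.envelopingCoalgebra L').comul (s x))
    have h2 : ∀ w, TensorProduct.map ((DGPBW.homProj L' A'.toDGModule m f).1 ∘ₗ
        (DGPBW.envelopingCoalgebra L').sgn n) g.1 w = TensorProduct.map (f.1 ∘ₗ L'.sgn n) g.1
          (TensorProduct.map (DGPBW.envelopingProj L') LinearMap.id w) := by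
      intro w
      rw [← LinearMap.comp_apply, ← TensorProduct.map_comp]
      congr 2
      ext c
      exact congrArg f.1 (DGPBW.DGModule.map_sgn _ _
        (fun n c hc => DGPBW.envelopingProj_mem L' hc) n c)
    have h3 : (DGPBW.envelopingCoalgebra L').cocommutator (s x) =
      (DGPBW.envelopingCoalgebra L').comul (s x) -
        (DGPBW.envelopingCoalgebra L').swap (DGPBW.envelopingCoalgebra L').toDGModule
          ((DGPBW.envelopingCoalgebra L').comul (s x)) := rfl
    change LinearMap.mul' K A (TensorProduct.map ((DGPBW.homProj L' A'.toDGModule m f).1 ∘ₗ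
        (DGPBW.envelopingCoalgebra L').sgn n) g.1
          ((DGPBW.envelopingCoalgebra L').comul (s x))) - _ =
      LinearMap.mul' K A (TensorProduct.map (f.1 ∘ₗ L'.sgn n) (g.1 ∘ₗ s) (L'.cobracket x))
    have h4 : ∀ w, TensorProduct.map (f.1 ∘ₗ L'.sgn n) (g.1 ∘ₗ s) w =
        TensorProduct.map (f.1 ∘ₗ L'.sgn n) g.1 (s.lTensor L w) := by
      intro w
      induction w using TensorProduct.induction_on with
      | zero => simp
      | add a b ha hb => simp only [map_add, ha, hb]
      | tmul a b => simp
    rw [h4, ← hcom, ← h2, h3, map_sub, map_sub, h1]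
    rfl
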